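/- All manifolds, metrics and maps are $C^\infty$, manifolds are without boundary. Let $(M^2,g)$ be a compact connected Riemannian surface, let $(N^n,\langle\cdot,\cdot\rangle)$ be a Riemannian manifold of arbitrary dimension, and let $\varphi:M\to N$ be a Riemannian (isometric) immersion. Let $B=\nabla d\varphi$ be its second fundamental form, $\tau(\varphi)=\operatorname{trace}_g B$ its tension field, $H=\tfrac12\operatorname{trace}_g B$ its mean curvature vector field, and $A_H$ the shape operator in the direction of $H$, i.e. $\langle A_H X,Y\rangle=\langle B(X,Y),H\rangle$. The stress-bienergy tensor $S_2$ of $\varphi$ is the symmetric $(1,1)$-tensor field on $M$ given by $$\langle S_2(X),Y\rangle=\tfrac12|\tau(\varphi)|^2\langle X,Y\rangle+\langle d\varphi,\nabla\tau(\varphi)\rangle\langle X,Y\rangle-\langle d\varphi(X),\nabla_Y\tau(\varphi)\rangle-\langle d\varphi(Y),\nabla_X\tau(\varphi)\rangle,$$ where $\nabla\tau(\varphi)$ is taken with the pull-back of the Levi-Civita connection of $N$. Suppose that $\varphi$ is biconservative, i.e. $\operatorname{Div} S_2=0$, that it is CMC, i.e. $|H|$ is constant on $M$, and that the Gaussian curvature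 $K$ of $(M,g)$ satisfies $K\ge 0$ everywhere. Then $A_H$ is parallel, i.e. $\nabla A_H=0$, and $M$ is flat (that is, $K=0$ everywhere) or $\varphi$ is pseudoumbilical (that is, $A_H=|H|^2 I$ everywhere). -/

import Mathlib

open scoped Manifold ContDiff Bundle

noncomputable section

namespace Submfd

/-- The coordinate space `ℝⁿ`. -/
abbrev Coord (n : ℕ) : Type := EuclideanSpace ℝ (Fin n)

section Metric

variable {n : ℕ} {N : Type*} [TopologicalSpace N] [ChartedSpace (Coord n) N]
  [IsManifold (𝓡 n) ∞ N]

variable (n N) in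
/-- Smooth Riemannian metrics on an `n`-dimensional smooth manifold `N` (without boundary). -/
abbrev Metric : Type _ :=
  Bundle.ContMDiffRiemannianMetric (𝓡 n) ∞ (Coord n) (fun y : N ↦ TangentSpace (𝓡 n) y)

/-- The components, in the preferred chart around `y₀`, of a tangent vector at `y`
(meaningful for `y` in the domain of that chart). -/
def toCoord (y₀ y : N) : TangentSpace (𝓡 n) y →L[ℝ] Coord n :=
  (trivializationAt (Coord n) (TangentSpace (𝓡 n) : N → Type _) y₀).continuousLinearMapAt ℝ y

/-- The tangent vector at `y` with given components in the preferred chart around `y₀`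
(meaningful for `y` in the domain of that chart). -/
def ofCoord (y₀ y : N) : Coord n →L[ℝ] TangentSpace (𝓡 n) y :=
  (trivializationAt (Coord n) (TangentSpace (𝓡 n) : N → Type _) y₀).symmL ℝ y

/-- The coordinate vector field `∂ᵢ` at `y`, for the preferred chart around `y₀`. -/
def partialAt (y₀ y : N) (i : Fin n) : TangentSpace (𝓡 n) y :=
  ofCoord y₀ y (EuclideanSpace.single i 1)

/-- The matrix `gᵢⱼ = g(∂ᵢ, ∂ⱼ)` at `y`, for the preferred chart around `y₀`. -/
def gram (g : Metric n N) (y₀ y : N) : Matrix (Fin n) (Fin n) ℝ :=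
  Matrix.of fun i j ↦ g.inner y (partialAt y₀ y i) (partialAt y₀ y j)

/-- The partial derivative `∂ₖ gᵢⱼ` at `y₀`, in the preferred chart around `y₀`. -/
def gramDeriv (g : Metric n N) (y₀ : N) (k i j : Fin n) : ℝ :=
  fderiv ℝ (fun u : Coord n ↦ gram g y₀ ((extChartAt (𝓡 n) y₀).symm u) i j)
    (extChartAt (𝓡 n) y₀ y₀) (EuclideanSpace.single k 1)

/-- The Christoffel symbol `Γᵏᵢⱼ = ½ ∑ₗ gᵏˡ (∂ᵢ gⱼₗ + ∂ⱼ gᵢₗ - ∂ₗ gᵢⱼ)` of the metric `g` at `y₀`,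
in the preferred chart around `y₀`. -/
def christoffel (g : Metric n N) (y₀ : N) (i j k : Fin n) : ℝ :=
  (1 / 2) * ∑ l, (gram g y₀ y₀)⁻¹ k l *
    (gramDeriv g y₀ i j l + gramDeriv g y₀ j i l - gramDeriv g y₀ l i j)

/-- The metric trace `∑ᵢⱼ gⁱʲ b(∂ᵢ, ∂ⱼ)` of a bilinear map `b` on `T_y N`; it equals
`∑ᵢ b(eᵢ, eᵢ)` for every orthonormal basis `(eᵢ)` of `T_y N`. -/
def metricTrace (g : Metric n N) (y : N) {W : Type*} [AddCommGroup W] [Module ℝ W]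
    (b : TangentSpace (𝓡 n) y → TangentSpace (𝓡 n) y → W) : W :=
  ∑ i, ∑ j, (gram g y y)⁻¹ i j • b (partialAt y y i) (partialAt y y j)

/-- The vector `∑ᵢⱼ gⁱʲ α(∂ⱼ) ∂ᵢ` of `T_y N` that represents a linear form `α`:
`⟨sharp g y α, w⟩ = α w` for all `w`. -/
def sharp (g : Metric n N) (y : N) (α : TangentSpace (𝓡 n) y → ℝ) : TangentSpace (𝓡 n) y :=
  ∑ i, ∑ j, ((gram g y y)⁻¹ i j * α (partialAt y y j)) • partialAt y y i

end Metric

section Connection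

variable {m : ℕ} {M : Type*} [TopologicalSpace M] [ChartedSpace (Coord m) M]
  [IsManifold (𝓡 m) ∞ M]
  {n : ℕ} {N : Type*} [TopologicalSpace N] [ChartedSpace (Coord n) N]
  [IsManifold (𝓡 n) ∞ N]

/-- The pull-back `∇^φ` to `φ⁻¹(TN)` of the Levi-Civita connection of `(N, h)`:
for a section `V` of `φ⁻¹(TN)` and `v ∈ T_p M`, the `k`-th component of `∇^φ_v V` is
`v(Vᵏ) + ∑ᵢⱼ Γᵏᵢⱼ(φ(p)) (dφ(v))ⁱ Vʲ(p)` in the preferred chart around `φ(p)`. -/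
def covAlong (h : Metric n N) (φ : M → N) (V : ∀ p : M, TangentSpace (𝓡 n) (φ p)) (p : M)
    (v : TangentSpace (𝓡 m) p) : TangentSpace (𝓡 n) (φ p) :=
  ofCoord (φ p) (φ p)
    (mvfderiv (𝓡 m) (fun q : M ↦ toCoord (φ p) (φ q) (V q)) p v +
      WithLp.toLp 2 fun k ↦ ∑ i, ∑ j, christoffel h (φ p) i j k *
        toCoord (φ p) (φ p) (mfderiv (𝓡 m) (𝓡 n) φ p v) i * toCoord (φ p) (φ p) (V p) j)

/-- The Levi-Civita connection of `(M, g)`: `leviCivita g Y p v` is `∇_v Y` at `p`. -/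
def leviCivita (g : Metric m M) (Y : ∀ p : M, TangentSpace (𝓡 m) p) (p : M)
    (v : TangentSpace (𝓡 m) p) : TangentSpace (𝓡 m) p :=
  covAlong g (id : M → M) Y p v

/-- A vector field, smooth around `p`, that extends `w ∈ T_p M`
(it has constant components in the preferred chart around `p`). -/
def extendVec {p : M} (w : TangentSpace (𝓡 m) p) : ∀ q : M, TangentSpace (𝓡 m) q :=
  FiberBundle.extend (Coord m) w

/-- The curvature `R(X, Y)Z = ∇_X ∇_Y Z - ∇_Y ∇_X Z - ∇_[X,Y] Z`. -/
def curvature (g : Metric m M) (X Y Z : ∀ p : M, TangentSpace (𝓡 m) p) (p : M) :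
    TangentSpace (𝓡 m) p :=
  leviCivita g (fun q ↦ leviCivita g Z q (Y q)) p (X p)
    - leviCivita g (fun q ↦ leviCivita g Z q (X q)) p (Y p)
    - leviCivita g Z p (VectorField.mlieBracket (𝓡 m) X Y p)

/-- The covariant derivative `(∇_v T)(w) = ∇_v (T W) - T (∇_v W)`, `W` extending `w`,
of a field `T` of endomorphisms of the tangent spaces. -/
def covEnd (g : Metric m M) (T : ∀ p : M, TangentSpace (𝓡 m) p → TangentSpace (𝓡 m) p)
    (p : M) (v w : TangentSpace (𝓡 m) p) : TangentSpace (𝓡 m) p :=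
  leviCivita g (fun q ↦ T q (extendVec w q)) p v - T p (leviCivita g (extendVec w) p v)

/-- The divergence `Div T = trace ∇T` of a field `T` of endomorphisms. -/
def divEnd (g : Metric m M) (T : ∀ p : M, TangentSpace (𝓡 m) p → TangentSpace (𝓡 m) p)
    (p : M) : TangentSpace (𝓡 m) p :=
  metricTrace g p fun v w ↦ covEnd g T p v w

/-- `T` is parallel: `∇T = 0`. -/
def IsParallelEnd (g : Metric m M)
    (T : ∀ p : M, TangentSpace (𝓡 m) p → TangentSpace (𝓡 m) p) : Prop :=
  ∀ (p : M) (v w : TangentSpace (𝓡 m) p), covEnd g T p v w = 0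

/-- `φ : (M, g) → (N, h)` is a smooth Riemannian (isometric) immersion. -/
def IsRiemannianImmersion (g : Metric m M) (h : Metric n N) (φ : M → N) : Prop :=
  ContMDiff (𝓡 m) (𝓡 n) ∞ φ ∧
    ∀ (p : M) (v w : TangentSpace (𝓡 m) p),
      h.inner (φ p) (mfderiv (𝓡 m) (𝓡 n) φ p v) (mfderiv (𝓡 m) (𝓡 n) φ p w) = g.inner p v w

/-- The second fundamental form `B(v, w) = (∇dφ)(v, w) = ∇^φ_v (dφ W) - dφ(∇_v W)`,
`W` extending `w`. -/
def secondFundForm (g : Metric m M) (h : Metric n N) (φ : M → N) (p : M)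
    (v w : TangentSpace (𝓡 m) p) : TangentSpace (𝓡 n) (φ p) :=
  covAlong h φ (fun q ↦ mfderiv (𝓡 m) (𝓡 n) φ q (extendVec w q)) p v
    - mfderiv (𝓡 m) (𝓡 n) φ p (leviCivita g (extendVec w) p v)

/-- The tension field `τ(φ) = trace ∇dφ`. -/
def tension (g : Metric m M) (h : Metric n N) (φ : M → N) (p : M) : TangentSpace (𝓡 n) (φ p) :=
  metricTrace g p fun v w ↦ secondFundForm g h φ p v w

/-- The mean curvature vector field `H = (1/m) trace B`. -/
def meanCurv (g : Metric m M) (h : Metric n N) (φ : M → N) (p : M) : TangentSpace (𝓡 n) (φ p) :=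
  (1 / (m : ℝ)) • metricTrace g p fun v w ↦ secondFundForm g h φ p v w

/-- The squared length `|H|²`. -/
def meanCurvSq (g : Metric m M) (h : Metric n N) (φ : M → N) (p : M) : ℝ :=
  h.inner (φ p) (meanCurv g h φ p) (meanCurv g h φ p)

/-- The shape operator `A_H` in the direction of `H`: `⟨A_H v, w⟩ = ⟨B(v, w), H⟩`. -/
def shapeH (g : Metric m M) (h : Metric n N) (φ : M → N) (p : M) (v : TangentSpace (𝓡 m) p) :
    TangentSpace (𝓡 m) p :=
  sharp g p fun w ↦ h.inner (φ p) (secondFundForm g h φ p v w) (meanCurv g h φ p)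

/-- The stress-bienergy tensor:
`⟨S₂ v, w⟩ = ½|τ|²⟨v, w⟩ + ⟨dφ, ∇τ⟩⟨v, w⟩ - ⟨dφ v, ∇_w τ⟩ - ⟨dφ w, ∇_v τ⟩`, `τ = τ(φ)`. -/
def stressBienergy (g : Metric m M) (h : Metric n N) (φ : M → N) (p : M)
    (v : TangentSpace (𝓡 m) p) : TangentSpace (𝓡 m) p :=
  sharp g p fun w ↦
    (1 / 2) * h.inner (φ p) (tension g h φ p) (tension g h φ p) * g.inner p v w
      + (metricTrace g p fun a b ↦ h.inner (φ p) (mfderiv (𝓡 m) (𝓡 n) φ p a)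
          (covAlong h φ (tension g h φ) p b)) * g.inner p v w
      - h.inner (φ p) (mfderiv (𝓡 m) (𝓡 n) φ p v) (covAlong h φ (tension g h φ) p w)
      - h.inner (φ p) (mfderiv (𝓡 m) (𝓡 n) φ p w) (covAlong h φ (tension g h φ) p v)

/-- `φ` is biconservative: `Div S₂ = 0`. -/
def IsBiconservative (g : Metric m M) (h : Metric n N) (φ : M → N) : Prop :=
  ∀ p : M, divEnd g (stressBienergy g h φ) p = 0

/-- `φ` has constant mean curvature: `|H|` is constant. -/
def IsCMC (g : Metric m M) (h : Metric n N) (φ : M → N) : Prop :=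
  ∃ c : ℝ, ∀ p : M, √(meanCurvSq g h φ p) = c

/-- `φ` is pseudoumbilical: `A_H = |H|² I`. -/
def IsPseudoumbilical (g : Metric m M) (h : Metric n N) (φ : M → N) : Prop :=
  ∀ (p : M) (v : TangentSpace (𝓡 m) p), shapeH g h φ p v = meanCurvSq g h φ p • v

end Connection

section Surface

variable {M : Type*} [TopologicalSpace M] [ChartedSpace (Coord 2) M] [IsManifold (𝓡 2) ∞ M]

/-- The Gaussian curvature `K = ⟨R(X, Y)Y, X⟩ / (|X|²|Y|² - ⟨X, Y⟩²)` of a surface, where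
`X = ∂₁` and `Y = ∂₂` are the coordinate fields of the preferred chart around `p`. -/
def gaussCurv (g : Metric 2 M) (p : M) : ℝ :=
  let X := extendVec (partialAt p p (0 : Fin 2))
  let Y := extendVec (partialAt p p (1 : Fin 2))
  g.inner p (curvature g X Y Y p) (X p) /
    (g.inner p (X p) (X p) * g.inner p (Y p) (Y p) - g.inner p (X p) (Y p) ^ 2)

/-- The surface `(M, g)` is flat: `K = 0`. -/
def IsFlat (g : Metric 2 M) : Prop := ∀ p : M, gaussCurv g p = 0

end Surface

end Submfd

end

noncomputable section

namespace Submfd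

open scoped Topology
open Filter Set

set_option linter.unusedSectionVars false

/-! ### Charts, local smoothness of functions and sections, coordinate derivatives. -/

section Coordinates

variable {m : ℕ} {M : Type*} [TopologicalSpace M] [ChartedSpace (Coord m) M]
  [IsManifold (𝓡 m) ∞ M]
  {n : ℕ} {N : Type*} [TopologicalSpace N] [ChartedSpace (Coord n) N]
  [IsManifold (𝓡 n) ∞ N]
  {F : Type*} [NormedAddCommGroup F] [NormedSpace ℝ F]

/-! The ambient manifold enters only through one identity. For an isometric immersion `τ = 2H` is
normal, so differentiating `⟨dφ X, τ⟩ = 0` turns the tangential part of `∇τ` into the second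
fundamental form, and the stress-bienergy tensor becomes `4 A_H - 2|H|² I` (`stressBienergy_eq`). If
`|H|` is constant, the second term is parallel, so biconservativity says `Div A_H = 0`. What remains
is intrinsic: a self-adjoint field `A` of constant trace `2κ` and zero divergence on a compact
connected surface with `K ≥ 0` (`parallel_and_flat_or_umbilical`).

In an orthonormal frame with connection form `ω`, the trace-free part of `A` has entries `a, b, b,
-a`, and `Div A = 0` is a Cauchy–Riemann system for `(a, b)` twisted by `ω` (`div_eq`); morally, a
Hopf differential is holomorphic. Put `u = a² + b²` and `θ = (a db - b da)/u`. Where `u > 0`, the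
system gives `*d log u = -2θ - 4ω`. Since `θ` is closed and `dω = -K dA`, it follows that `Δ log u =
4K` (`divergence_log_umbilicity`).

Let `u` attain its maximum. If the maximum is zero, `A = κ I`. If it is positive, `log u` is
subharmonic near every maximum point because `K ≥ 0`, and Hopf's strong maximum principle
(`eventually_eq_of_elliptic_nonneg`) makes `u` locally constant there. The set of maximum points is
then clopen, hence all of `M`. With `u` a positive constant, the equation gives `K = 0`, and `du =
0` together with the Cauchy–Riemann system gives `∇A = 0`. Zeros of `u` need no analysis, since the
equation is only used near maximum points.

The covariant derivative is defined in the preferred chart of the point where it is evaluated, so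
the chart moves with the point. Much of the first half of the argument transfers it to a fixed
chart. -/

lemma toCoord_ofCoord {y₀ y : N} (hy : y ∈ (chartAt (Coord n) y₀).source) (c : Coord n) :
    toCoord y₀ y (ofCoord y₀ y c) = c :=
  Bundle.Trivialization.continuousLinearMapAt_symmL _ hy c

lemma ofCoord_toCoord {y₀ y : N} (hy : y ∈ (chartAt (Coord n) y₀).source)
    (v : TangentSpace (𝓡 n) y) : ofCoord y₀ y (toCoord y₀ y v) = v :=
  Bundle.Trivialization.symmL_continuousLinearMapAt _ hy v

lemma ofCoord_eq_sum (y₀ y : N) (c : Coord n) :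
    ofCoord y₀ y c = ∑ i, c i • partialAt y₀ y i := by
  have hc : c = ∑ i, c i • EuclideanSpace.single i (1 : ℝ) := by
    ext j
    simp [Finset.sum_apply, Pi.single_apply]
  conv_lhs => rw [hc]
  simp only [map_sum, map_smul, partialAt]

lemma sum_toCoord_smul_partialAt {y₀ y : N} (hy : y ∈ (chartAt (Coord n) y₀).source)
    (v : TangentSpace (𝓡 n) y) : ∑ i, toCoord y₀ y v i • partialAt y₀ y i = v := by
  rw [← ofCoord_eq_sum, ofCoord_toCoord hy]

lemma toCoord_eq_mfderiv {y₀ y : N} (hy : y ∈ (chartAt (Coord n) y₀).source) :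
    toCoord y₀ y = mfderiv (𝓡 n) 𝓘(ℝ, Coord n) (extChartAt (𝓡 n) y₀) y :=
  TangentBundle.continuousLinearMapAt_trivializationAt hy

lemma ofCoord_eq_mfderiv {y₀ y : N} (hy : y ∈ (chartAt (Coord n) y₀).source) :
    ofCoord y₀ y = mfderiv 𝓘(ℝ, Coord n) (𝓡 n) (extChartAt (𝓡 n) y₀).symm
      (extChartAt (𝓡 n) y₀ y) := by
  have := TangentBundle.symmL_trivializationAt (I := 𝓡 n) hy
  rw [ModelWithCorners.range_eq_univ, mfderivWithin_univ] at this
  exact this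

lemma extendVec_eq {p q : M} (w : TangentSpace (𝓡 m) p)
    (hq : q ∈ (chartAt (Coord m) p).source) :
    extendVec w q = ofCoord p q (toCoord p p w) := by
  have h1 : toCoord p p w = (trivializationAt (Coord m) (TangentSpace (𝓡 m) : M → Type _) p
      ⟨p, w⟩).2 :=
    Bundle.Trivialization.continuousLinearMapAt_apply_of_mem (R := ℝ) _
      (mem_chart_source (Coord m) p) w
  rw [h1]
  exact (Bundle.Trivialization.symmL_apply (R := ℝ) _ hq _).symm

@[simp] lemma extendVec_self {p : M} (w : TangentSpace (𝓡 m) p) : extendVec w p = w :=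
  FiberBundle.extend_apply_self (F := Coord m) w

lemma chart_source_mem_nhds {p₀ p : M} (hp : p ∈ (chartAt (Coord m) p₀).source) :
    (chartAt (Coord m) p₀).source ∈ 𝓝 p :=
  (chartAt (Coord m) p₀).open_source.mem_nhds hp

variable (m) in
/-- The vector-valued function `f` is smooth on a neighbourhood of `p`. -/
def SmoothNear (f : M → F) (p : M) : Prop :=
  ∀ᶠ q in 𝓝 p, ContMDiffAt (𝓡 m) 𝓘(ℝ, F) ∞ f q

variable (m) in
/-- The section `V` of `φ⁻¹(TN)` is smooth on a neighbourhood of `p`. -/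
def SmoothAlong (φ : M → N) (V : ∀ p : M, TangentSpace (𝓡 n) (φ p)) (p : M) : Prop :=
  ∀ᶠ q in 𝓝 p, ContMDiffAt (𝓡 m) ((𝓡 n).prod 𝓘(ℝ, Coord n)) ∞
    (fun q ↦ (⟨φ q, V q⟩ : TangentBundle (𝓡 n) N)) q

/-- The chart centre `y₀` is independent of `q`; this lets smoothness on a neighbourhood be tested
on components in a single chart. -/
lemma contMDiffAt_along_iff {φ : M → N} {V : ∀ p : M, TangentSpace (𝓡 n) (φ p)} {q : M} {y₀ : N}
    (hq : φ q ∈ (chartAt (Coord n) y₀).source) :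
    ContMDiffAt (𝓡 m) ((𝓡 n).prod 𝓘(ℝ, Coord n)) ∞
      (fun q ↦ (⟨φ q, V q⟩ : TangentBundle (𝓡 n) N)) q ↔
    ContMDiffAt (𝓡 m) (𝓡 n) ∞ φ q ∧
      ContMDiffAt (𝓡 m) 𝓘(ℝ, Coord n) ∞ (fun q ↦ toCoord y₀ (φ q) (V q)) q := by
  rw [Bundle.Trivialization.contMDiffAt_iff
    (e := trivializationAt (Coord n) (TangentSpace (𝓡 n) : N → Type _) y₀)
    (by rw [Bundle.Trivialization.mem_source]; exact hq)]
  refine and_congr_right fun hφ ↦ ?_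
  have hev : ∀ᶠ q' in 𝓝 q, φ q' ∈ (chartAt (Coord n) y₀).source :=
    hφ.continuousAt.eventually (chart_source_mem_nhds hq)
  have : (fun q ↦ toCoord y₀ (φ q) (V q)) =ᶠ[𝓝 q] fun x ↦
      ((trivializationAt (Coord n) (TangentSpace (𝓡 n) : N → Type _) y₀) ⟨φ x, V x⟩).2 := by
    filter_upwards [hev] with q' hq'
    exact Bundle.Trivialization.continuousLinearMapAt_apply_of_mem (R := ℝ) _ hq' _
  exact ⟨fun h ↦ h.congr_of_eventuallyEq this, fun h ↦ h.congr_of_eventuallyEq this.symm⟩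

namespace SmoothNear

variable {f f' : M → F} {p : M}

lemma self (hf : SmoothNear m f p) : ContMDiffAt (𝓡 m) 𝓘(ℝ, F) ∞ f p := hf.self_of_nhds

lemma mdiff (hf : SmoothNear m f p) : MDifferentiableAt (𝓡 m) 𝓘(ℝ, F) f p :=
  hf.self.mdifferentiableAt (by simp)

/-- This stability is why the predicate asks for a neighbourhood: being `C^∞` at a point only
provides, for each finite order, a neighbourhood depending on that order. -/
lemma eventually (hf : SmoothNear m f p) : ∀ᶠ q in 𝓝 p, SmoothNear m f q :=
  eventually_eventually_nhds.2 hf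

lemma congr (hf : SmoothNear m f p) (h : f' =ᶠ[𝓝 p] f) : SmoothNear m f' p := by
  filter_upwards [hf, h.eventuallyEq_nhds] with q h1 h2
  exact h1.congr_of_eventuallyEq h2

lemma const (c : F) : SmoothNear m (fun _ : M ↦ c) p := .of_forall fun _ ↦ contMDiffAt_const

lemma add (hf : SmoothNear m f p) (hf' : SmoothNear m f' p) : SmoothNear m (fun q ↦ f q + f' q) p := by
  filter_upwards [hf, hf'] with q h1 h2 using h1.add h2

lemma sub (hf : SmoothNear m f p) (hf' : SmoothNear m f' p) : SmoothNear m (fun q ↦ f q - f' q) p := by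
  filter_upwards [hf, hf'] with q h1 h2 using h1.sub h2

lemma neg (hf : SmoothNear m f p) : SmoothNear m (fun q ↦ - f q) p := by
  filter_upwards [hf] with q h1 using h1.neg

lemma smul {a : M → ℝ} (ha : SmoothNear m a p) (hf : SmoothNear m f p) :
    SmoothNear m (fun q ↦ a q • f q) p := by
  filter_upwards [ha, hf] with q h1 h2 using h1.smul h2

lemma mul {a b : M → ℝ} (ha : SmoothNear m a p) (hb : SmoothNear m b p) :
    SmoothNear m (fun q ↦ a q * b q) p := ha.smul hb

lemma sum {ι : Type*} (s : Finset ι) {f : ι → M → F} (hf : ∀ i ∈ s, SmoothNear m (f i) p) :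
    SmoothNear m (fun q ↦ ∑ i ∈ s, f i q) p := by
  have := (eventually_all_finset s).2 hf
  filter_upwards [this] with q hq
  exact contMDiffAt_finsetSum hq

lemma prod {ι : Type*} (s : Finset ι) {f : ι → M → ℝ} (hf : ∀ i ∈ s, SmoothNear m (f i) p) :
    SmoothNear m (fun q ↦ ∏ i ∈ s, f i q) p := by
  have := (eventually_all_finset s).2 hf
  filter_upwards [this] with q hq
  exact contMDiffAt_finsetProd hq

lemma comp_contDiffAt {F' : Type*} [NormedAddCommGroup F'] [NormedSpace ℝ F'] {G : F → F'}
    (hG : ∀ᶠ x in 𝓝 (f p), ContDiffAt ℝ ∞ G x) (hf : SmoothNear m f p) :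
    SmoothNear m (fun q ↦ G (f q)) p := by
  filter_upwards [hf, hf.self.continuousAt.eventually hG] with q h1 h2
  exact h2.contMDiffAt.comp q h1

lemma inv {a : M → ℝ} (ha : SmoothNear m a p) (h0 : a p ≠ 0) : SmoothNear m (fun q ↦ (a q)⁻¹) p :=
  ha.comp_contDiffAt ((eventually_ne_nhds h0).mono fun _ hx ↦ contDiffAt_inv ℝ hx)

lemma div {a b : M → ℝ} (ha : SmoothNear m a p) (hb : SmoothNear m b p) (h0 : b p ≠ 0) :
    SmoothNear m (fun q ↦ a q / b q) p := by
  simpa only [div_eq_mul_inv] using ha.mul (hb.inv h0)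

lemma sqrt {a : M → ℝ} (ha : SmoothNear m a p) (h0 : a p ≠ 0) : SmoothNear m (fun q ↦ √(a q)) p :=
  ha.comp_contDiffAt ((eventually_ne_nhds h0).mono fun _ hx ↦ Real.contDiffAt_sqrt hx)

lemma log {a : M → ℝ} (ha : SmoothNear m a p) (h0 : a p ≠ 0) :
    SmoothNear m (fun q ↦ Real.log (a q)) p :=
  ha.comp_contDiffAt ((eventually_ne_nhds h0).mono fun _ hx ↦ Real.contDiffAt_log.2 hx)

lemma coord {f : M → Coord n} (hf : SmoothNear m f p) (i : Fin n) : SmoothNear m (fun q ↦ f q i) p :=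
  hf.comp_contDiffAt (G := fun x : Coord n ↦ x i) (.of_forall fun x ↦ by fun_prop)

lemma toLp {f : M → Fin n → ℝ} (hf : ∀ i, SmoothNear m (fun q ↦ f q i) p) :
    SmoothNear m (fun q ↦ (WithLp.toLp 2 (f q) : Coord n)) p := by
  have h2 : (fun q ↦ (WithLp.toLp 2 (f q) : Coord n)) =
      fun q ↦ ∑ i, f q i • EuclideanSpace.single i (1 : ℝ) := by
    ext q j
    simp [Finset.sum_apply, Pi.single_apply]
  rw [h2]
  exact sum _ fun i _ ↦ (hf i).smul (const _)

end SmoothNear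

namespace SmoothAlong

variable {φ : M → N} {V W : ∀ p : M, TangentSpace (𝓡 n) (φ p)} {p : M}

lemma eventually (hV : SmoothAlong m φ V p) : ∀ᶠ q in 𝓝 p, SmoothAlong m φ V q :=
  eventually_eventually_nhds.2 hV

lemma congr (hV : SmoothAlong m φ V p) (h : ∀ᶠ q in 𝓝 p, W q = V q) : SmoothAlong m φ W p := by
  filter_upwards [hV, h.eventually_nhds] with q h1 h2
  refine h1.congr_of_eventuallyEq ?_
  filter_upwards [h2] with q' h3
  rw [h3]

lemma base (hV : SmoothAlong m φ V p) : ∀ᶠ q in 𝓝 p, ContMDiffAt (𝓡 m) (𝓡 n) ∞ φ q := by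
  filter_upwards [hV] with q hq
  exact ((contMDiffAt_along_iff (mem_chart_source _ _)).1 hq).1

lemma base_mem (hV : SmoothAlong m φ V p) {y₀ : N} (hp : φ p ∈ (chartAt (Coord n) y₀).source) :
    ∀ᶠ q in 𝓝 p, φ q ∈ (chartAt (Coord n) y₀).source :=
  hV.base.self_of_nhds.continuousAt.eventually (chart_source_mem_nhds hp)

lemma toCoord (hV : SmoothAlong m φ V p) {y₀ : N} (hp : φ p ∈ (chartAt (Coord n) y₀).source) :
    SmoothNear m (fun q ↦ toCoord y₀ (φ q) (V q)) p := by
  filter_upwards [hV, hV.base_mem hp] with q h1 h2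
  exact ((contMDiffAt_along_iff h2).1 h1).2

lemma of_toCoord {y₀ : N} (hφ : ∀ᶠ q in 𝓝 p, ContMDiffAt (𝓡 m) (𝓡 n) ∞ φ q)
    (hp : φ p ∈ (chartAt (Coord n) y₀).source)
    (h : SmoothNear m (fun q ↦ Submfd.toCoord y₀ (φ q) (V q)) p) : SmoothAlong m φ V p := by
  filter_upwards [hφ, h, hφ.self_of_nhds.continuousAt.eventually (chart_source_mem_nhds hp)]
    with q h1 h2 h3
  exact (contMDiffAt_along_iff h3).2 ⟨h1, h2⟩

lemma add (hV : SmoothAlong m φ V p) (hW : SmoothAlong m φ W p) :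
    SmoothAlong m φ (fun q ↦ V q + W q) p := by
  refine of_toCoord hV.base (mem_chart_source _ _) ?_
  simpa only [map_add] using
    (hV.toCoord (mem_chart_source _ _)).add (hW.toCoord (mem_chart_source _ _))

lemma smul {f : M → ℝ} (hf : SmoothNear m f p) (hV : SmoothAlong m φ V p) :
    SmoothAlong m φ (fun q ↦ f q • V q) p := by
  refine of_toCoord hV.base (mem_chart_source _ _) ?_
  simpa only [map_smul] using hf.smul (hV.toCoord (mem_chart_source _ _))

lemma sub (hV : SmoothAlong m φ V p) (hW : SmoothAlong m φ W p) :
    SmoothAlong m φ (fun q ↦ V q - W q) p := by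
  refine of_toCoord hV.base (mem_chart_source _ _) ?_
  simpa only [map_sub] using
    (hV.toCoord (mem_chart_source _ _)).sub (hW.toCoord (mem_chart_source _ _))

lemma sum {ι : Type*} (hφ : ∀ᶠ q in 𝓝 p, ContMDiffAt (𝓡 m) (𝓡 n) ∞ φ q) (s : Finset ι)
    {V : ι → ∀ p : M, TangentSpace (𝓡 n) (φ p)} (hV : ∀ i ∈ s, SmoothAlong m φ (V i) p) :
    SmoothAlong m φ (fun q ↦ ∑ i ∈ s, V i q) p := by
  refine of_toCoord hφ (mem_chart_source _ _) ?_
  simpa only [map_sum] using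
    SmoothNear.sum s fun i hi ↦ (hV i hi).toCoord (mem_chart_source _ _)

lemma inner (h : Metric n N) (hV : SmoothAlong m φ V p) (hW : SmoothAlong m φ W p) :
    SmoothNear m (fun q ↦ h.inner (φ q) (V q) (W q)) p := by
  filter_upwards [hV, hW] with q h1 h2
  have hφ := ((contMDiffAt_along_iff (mem_chart_source _ _)).1 h1).1
  have h3 : ContMDiffAt (𝓡 m) ((𝓡 n).prod 𝓘(ℝ, Coord n →L[ℝ] Coord n →L[ℝ] ℝ)) ∞
      (fun q ↦ Bundle.TotalSpace.mk' (Coord n →L[ℝ] Coord n →L[ℝ] ℝ)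
        (E := fun y : N ↦ TangentSpace (𝓡 n) y →L[ℝ] TangentSpace (𝓡 n) y →L[ℝ] ℝ)
        (φ q) (h.inner (φ q))) q :=
    h.contMDiff.contMDiffAt.comp q hφ
  have h4 := h3.clm_bundle_apply₂ (E₃ := fun y : N ↦ ℝ) (F₃ := ℝ) h1 h2
  rw [Bundle.contMDiffAt_totalSpace] at h4
  exact h4.2

end SmoothAlong

lemma smoothAlong_ofCoord {φ : M → N} {p : M} {y₀ : N} {c : M → Coord n}
    (hφ : ∀ᶠ q in 𝓝 p, ContMDiffAt (𝓡 m) (𝓡 n) ∞ φ q)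
    (hp : φ p ∈ (chartAt (Coord n) y₀).source) (hc : SmoothNear m c p) :
    SmoothAlong m φ (fun q ↦ ofCoord y₀ (φ q) (c q)) p := by
  refine .of_toCoord hφ hp (hc.congr ?_)
  filter_upwards [hφ.self_of_nhds.continuousAt.eventually (chart_source_mem_nhds hp)] with q hq
  exact toCoord_ofCoord hq _

lemma smoothAlong_partialAt {p₀ p : M} (hp : p ∈ (chartAt (Coord m) p₀).source) (i : Fin m) :
    SmoothAlong m (id : M → M) (fun q ↦ partialAt p₀ q i) p :=
  smoothAlong_ofCoord (.of_forall fun _ ↦ contMDiffAt_id) hp (.const _)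

lemma smoothAlong_extendVec {p : M} (w : TangentSpace (𝓡 m) p) :
    SmoothAlong m (id : M → M) (extendVec w) p := by
  refine (smoothAlong_ofCoord (y₀ := p) (φ := (id : M → M)) (p := p)
    (.of_forall fun _ ↦ contMDiffAt_id) (mem_chart_source _ _) (.const (toCoord p p w))).congr ?_
  filter_upwards [chart_source_mem_nhds (mem_chart_source (Coord m) p)] with q hq
  exact extendVec_eq w hq

lemma SmoothAlong.comp {m' : ℕ} {M' : Type*} [TopologicalSpace M'] [ChartedSpace (Coord m') M']
    [IsManifold (𝓡 m') ∞ M'] {φ : M → N} {ψ : M' → M} {p : M'}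
    {V : ∀ p : M, TangentSpace (𝓡 n) (φ p)} (hV : SmoothAlong m φ V (ψ p))
    (hψ : ∀ᶠ q in 𝓝 p, ContMDiffAt (𝓡 m') (𝓡 m) ∞ ψ q) :
    SmoothAlong m' (fun q ↦ φ (ψ q)) (fun q ↦ V (ψ q)) p := by
  filter_upwards [hψ, hψ.self_of_nhds.continuousAt.eventually hV] with q h1 h2
  exact h2.comp q h1

/-- The image of a smooth vector field under the differential of a smooth map is smooth. -/
lemma SmoothAlong.mfderiv {φ : M → N} (hφ : ContMDiff (𝓡 m) (𝓡 n) ∞ φ) {p : M}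
    {X : ∀ p : M, TangentSpace (𝓡 m) p} (hX : SmoothAlong m (id : M → M) X p) :
    SmoothAlong m φ (fun q ↦ mfderiv (𝓡 m) (𝓡 n) φ q (X q)) p := by
  filter_upwards [hX] with q h1
  have := (hφ.contMDiff_tangentMap (m := ∞) (by simp)).contMDiffAt (x := (⟨q, X q⟩ :
    TangentBundle (𝓡 m) M))
  exact this.comp q h1

lemma mvfderiv_congr {f f' : M → F} {p : M} (h : f =ᶠ[𝓝 p] f') :
    mvfderiv (𝓡 m) f p = mvfderiv (𝓡 m) f' p := by
  ext v
  exact congrArg (fun L : TangentSpace (𝓡 m) p →L[ℝ] F ↦ L v) h.mfderiv_eq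

lemma extChartAt_symm_apply {p₀ q : M} (hq : q ∈ (chartAt (Coord m) p₀).source) :
    (extChartAt (𝓡 m) p₀).symm (extChartAt (𝓡 m) p₀ q) = q :=
  (extChartAt (𝓡 m) p₀).left_inv (by rwa [extChartAt_source])

lemma eventually_extChartAt_apply {p₀ q : M} (hq : q ∈ (chartAt (Coord m) p₀).source) :
    ∀ᶠ u in 𝓝 (extChartAt (𝓡 m) p₀ q), (extChartAt (𝓡 m) p₀).symm u ∈
      (chartAt (Coord m) p₀).source ∧ extChartAt (𝓡 m) p₀ ((extChartAt (𝓡 m) p₀).symm u) = u := by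
  filter_upwards [extChartAt_target_mem_nhds' (I := 𝓡 m) (x := p₀)
    ((extChartAt (𝓡 m) p₀).map_source (by rwa [extChartAt_source]))] with u hu
  exact ⟨by simpa [extChartAt_source] using (extChartAt (𝓡 m) p₀).map_target hu,
    (extChartAt (𝓡 m) p₀).right_inv hu⟩

lemma tendsto_extChartAt_symm {p₀ q : M} (hq : q ∈ (chartAt (Coord m) p₀).source) :
    Tendsto (extChartAt (𝓡 m) p₀).symm (𝓝 (extChartAt (𝓡 m) p₀ q)) (𝓝 q) := by
  have := continuousAt_extChartAt_symm' (I := 𝓡 m) (x := p₀) (x' := q)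
    (by rwa [extChartAt_source])
  rwa [ContinuousAt, extChartAt_symm_apply hq] at this

lemma tendsto_extChartAt {p₀ q : M} (hq : q ∈ (chartAt (Coord m) p₀).source) :
    Tendsto (extChartAt (𝓡 m) p₀) (𝓝 q) (𝓝 (extChartAt (𝓡 m) p₀ q)) :=
  continuousAt_extChartAt' (by rwa [extChartAt_source])

lemma contMDiffAt_extChartAt_of_mem {p₀ q : M} (hq : q ∈ (chartAt (Coord m) p₀).source) :
    ContMDiffAt (𝓡 m) 𝓘(ℝ, Coord m) ∞ (extChartAt (𝓡 m) p₀) q :=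
  contMDiffAt_extChartAt' hq

lemma mdifferentiableAt_extChartAt_symm_of_mem {p₀ q : M}
    (hq : q ∈ (chartAt (Coord m) p₀).source) :
    MDifferentiableAt 𝓘(ℝ, Coord m) (𝓡 m) (extChartAt (𝓡 m) p₀).symm (extChartAt (𝓡 m) p₀ q) := by
  have := mdifferentiableWithinAt_extChartAt_symm (I := 𝓡 m) (x := p₀)
    ((extChartAt (𝓡 m) p₀).map_source (by rwa [extChartAt_source]))
  rwa [ModelWithCorners.range_eq_univ, mdifferentiableWithinAt_univ] at this

/-- Chain rule for `f` composed with the inverse chart, whose differential is `ofCoord`. It reduces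
derivatives on the manifold to Fréchet derivatives in a fixed chart. -/
lemma mvfderiv_ofCoord {f : M → F} {p₀ q : M} (hq : q ∈ (chartAt (Coord m) p₀).source)
    (hf : MDifferentiableAt (𝓡 m) 𝓘(ℝ, F) f q) (c : Coord m) :
    mvfderiv (𝓡 m) f q (ofCoord p₀ q c) =
      fderiv ℝ (fun u ↦ f ((extChartAt (𝓡 m) p₀).symm u)) (extChartAt (𝓡 m) p₀ q) c := by
  have h1 := mfderiv_comp_of_eq (I := 𝓘(ℝ, Coord m)) hf
    (mdifferentiableAt_extChartAt_symm_of_mem hq) (extChartAt_symm_apply hq)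
  rw [mfderiv_eq_fderiv] at h1
  rw [ofCoord_eq_mfderiv hq]
  have h2 := congrArg (fun x ↦ (show Coord m →L[ℝ] F from mfderiv (𝓡 m) 𝓘(ℝ, F) f x))
    (extChartAt_symm_apply hq)
  have h3 : fderiv ℝ (f ∘ (extChartAt (𝓡 m) p₀).symm) (extChartAt (𝓡 m) p₀ q) =
      (show Coord m →L[ℝ] F from mfderiv (𝓡 m) 𝓘(ℝ, F) f q).comp
        (show Coord m →L[ℝ] Coord m from mfderiv 𝓘(ℝ, Coord m) (𝓡 m) (extChartAt (𝓡 m) p₀).symm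
          (extChartAt (𝓡 m) p₀ q)) :=
    h1.trans (congrArg (fun L : Coord m →L[ℝ] F ↦ L.comp (show Coord m →L[ℝ] Coord m from
      mfderiv 𝓘(ℝ, Coord m) (𝓡 m) (extChartAt (𝓡 m) p₀).symm (extChartAt (𝓡 m) p₀ q))) h2)
  exact (congrArg (fun L : Coord m →L[ℝ] F ↦ L c) h3).symm

lemma SmoothNear.contDiffAt {f : M → F} {p₀ q : M} (hq : q ∈ (chartAt (Coord m) p₀).source)
    (hf : ContMDiffAt (𝓡 m) 𝓘(ℝ, F) ∞ f q) :
    ContDiffAt ℝ ∞ (fun u ↦ f ((extChartAt (𝓡 m) p₀).symm u)) (extChartAt (𝓡 m) p₀ q) := by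
  rw [contMDiffAt_iff_source_of_mem_source hq, ModelWithCorners.range_eq_univ,
    contMDiffWithinAt_univ] at hf
  exact hf.contDiffAt


lemma mvfderiv_eq_fderiv {f : M → F} {p₀ q : M} (hq : q ∈ (chartAt (Coord m) p₀).source)
    (hf : MDifferentiableAt (𝓡 m) 𝓘(ℝ, F) f q) (v : TangentSpace (𝓡 m) q) :
    mvfderiv (𝓡 m) f q v =
      fderiv ℝ (fun u ↦ f ((extChartAt (𝓡 m) p₀).symm u)) (extChartAt (𝓡 m) p₀ q)
        (toCoord p₀ q v) := by
  rw [← mvfderiv_ofCoord hq hf, ofCoord_toCoord hq]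

lemma SmoothNear.eventually_contDiffAt {f : M → F} {p₀ q : M}
    (hq : q ∈ (chartAt (Coord m) p₀).source) (hf : SmoothNear m f q) :
    ∀ᶠ u in 𝓝 (extChartAt (𝓡 m) p₀ q),
      ContDiffAt ℝ ∞ (fun u ↦ f ((extChartAt (𝓡 m) p₀).symm u)) u := by
  filter_upwards [eventually_extChartAt_apply hq, (tendsto_extChartAt_symm hq).eventually hf]
    with u h1 h2
  have := SmoothNear.contDiffAt h1.1 h2
  rwa [h1.2] at this

/-- The derivative of a smooth function along a smooth vector field is smooth. -/
lemma SmoothNear.mvfderiv {f : M → F} {p : M} (hf : SmoothNear m f p)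
    {X : ∀ p : M, TangentSpace (𝓡 m) p} (hX : SmoothAlong m (id : M → M) X p) :
    SmoothNear m (fun q ↦ mvfderiv (𝓡 m) f q (X q)) p := by
  have hp := mem_chart_source (Coord m) p
  have h1 : SmoothNear m (fun q ↦ fderiv ℝ (fun u ↦ f ((extChartAt (𝓡 m) p).symm u))
      (extChartAt (𝓡 m) p q)) p := by
    refine SmoothNear.comp_contDiffAt (f := extChartAt (𝓡 m) p) (G := fun x ↦
      fderiv ℝ (fun u ↦ f ((extChartAt (𝓡 m) p).symm u)) x) ?_ ?_
    · exact (hf.eventually_contDiffAt hp).mono fun u hu ↦ hu.fderiv_right (by simp)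
    · filter_upwards [chart_source_mem_nhds hp] with q hq using contMDiffAt_extChartAt_of_mem hq
  have h2 := hX.toCoord (y₀ := p) hp
  have h3 : SmoothNear m (fun q ↦ fderiv ℝ (fun u ↦ f ((extChartAt (𝓡 m) p).symm u))
      (extChartAt (𝓡 m) p q) (Submfd.toCoord p q (X q))) p := by
    filter_upwards [h1, h2] with q h1 h2
    exact h1.clm_apply h2
  refine h3.congr ?_
  filter_upwards [chart_source_mem_nhds hp, hf.eventually] with q hq hfq
  exact mvfderiv_eq_fderiv hq hfq.mdiff _

/-- Derivatives along the coordinate fields of a chart commute. -/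
lemma mvfderiv_partialAt_comm {f : M → F} {p₀ q : M} (hq : q ∈ (chartAt (Coord m) p₀).source)
    (hf : SmoothNear m f q) (i j : Fin m) :
    mvfderiv (𝓡 m) (fun q' ↦ mvfderiv (𝓡 m) f q' (partialAt p₀ q' i)) q (partialAt p₀ q j) =
      mvfderiv (𝓡 m) (fun q' ↦ mvfderiv (𝓡 m) f q' (partialAt p₀ q' j)) q (partialAt p₀ q i) := by
  -- In the chart the coordinate fields are constant, so both iterated derivatives are values of the
  -- second Fréchet derivative, which is symmetric.
  have key : ∀ i j, mvfderiv (𝓡 m) (fun q' ↦ mvfderiv (𝓡 m) f q' (partialAt p₀ q' i)) q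
      (partialAt p₀ q j) = fderiv ℝ (fderiv ℝ (fun u ↦ f ((extChartAt (𝓡 m) p₀).symm u)))
        (extChartAt (𝓡 m) p₀ q) (EuclideanSpace.single j 1) (EuclideanSpace.single i 1) := by
    intro i j
    have h1 := (hf.mvfderiv (smoothAlong_partialAt hq i)).mdiff
    have h2 := (hf.eventually_contDiffAt hq).self_of_nhds
    have h3 : (fun u ↦ mvfderiv (𝓡 m) f ((extChartAt (𝓡 m) p₀).symm u)
        (partialAt p₀ ((extChartAt (𝓡 m) p₀).symm u) i)) =ᶠ[𝓝 (extChartAt (𝓡 m) p₀ q)]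
        fun u ↦ fderiv ℝ (fun u ↦ f ((extChartAt (𝓡 m) p₀).symm u)) u
          (EuclideanSpace.single i 1) := by
      filter_upwards [eventually_extChartAt_apply hq,
        (tendsto_extChartAt_symm hq).eventually hf.eventually] with u h3 h4
      rw [partialAt, mvfderiv_ofCoord h3.1 h4.mdiff, h3.2]
    rw [partialAt, mvfderiv_ofCoord hq h1, h3.fderiv_eq, fderiv_clm_apply
      ((h2.fderiv_right (m := ∞) (by simp)).differentiableAt (by simp))
      (differentiableAt_const _)]
    simp
  rw [key, key]
  have h2 := (hf.eventually_contDiffAt hq).self_of_nhds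
  exact (h2.isSymmSndFDerivAt (by simpa using ENat.LEInfty.out)).eq _ _

end Coordinates

/-! ### Algebraic rules and metric compatibility of the pull-back connection. -/

section Connection

variable {m : ℕ} {M : Type*} [TopologicalSpace M] [ChartedSpace (Coord m) M]
  [IsManifold (𝓡 m) ∞ M]
  {n : ℕ} {N : Type*} [TopologicalSpace N] [ChartedSpace (Coord n) N]
  [IsManifold (𝓡 n) ∞ N]
  {F : Type*} [NormedAddCommGroup F] [NormedSpace ℝ F]

lemma mvfderiv_fun_sum {ι : Type*} (s : Finset ι) {f : ι → M → F} {p : M}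
    (hf : ∀ i ∈ s, SmoothNear m (f i) p) (v : TangentSpace (𝓡 m) p) :
    mvfderiv (𝓡 m) (fun q ↦ ∑ i ∈ s, f i q) p v = ∑ i ∈ s, mvfderiv (𝓡 m) (f i) p v := by
  classical
  induction s using Finset.induction_on with
  | empty => simp [mvfderiv_const]
  | insert i s hi ih =>
    simp only [Finset.sum_insert hi]
    rw [mvfderiv_fun_add (hf i (Finset.mem_insert_self _ _)).mdiff
      (SmoothNear.sum s fun j hj ↦ hf j (Finset.mem_insert_of_mem hj)).mdiff, add_apply,
      ih fun j hj ↦ hf j (Finset.mem_insert_of_mem hj)]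

lemma mvfderiv_mul_apply {f f' : M → ℝ} {p : M} (hf : SmoothNear m f p) (hf' : SmoothNear m f' p)
    (v : TangentSpace (𝓡 m) p) :
    mvfderiv (𝓡 m) (fun q ↦ f q * f' q) p v =
      f p * mvfderiv (𝓡 m) f' p v + f' p * mvfderiv (𝓡 m) f p v := by
  rw [mvfderiv_fun_mul hf.mdiff hf'.mdiff]
  rfl

lemma mvfderiv_coord_apply {f : M → Coord n} {p : M} (hf : SmoothNear m f p)
    (v : TangentSpace (𝓡 m) p) (i : Fin n) :
    mvfderiv (𝓡 m) (fun q ↦ f q i) p v = mvfderiv (𝓡 m) f p v i := by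
  have hp := mem_chart_source (Coord m) p
  have h1 := (hf.eventually_contDiffAt hp).self_of_nhds.differentiableAt (by simp)
  have h2 := ((EuclideanSpace.proj i : Coord n →L[ℝ] ℝ).hasFDerivAt.comp _
    h1.hasFDerivAt).fderiv
  rw [mvfderiv_eq_fderiv hp (hf.coord i).mdiff, mvfderiv_eq_fderiv hp hf.mdiff]
  exact congrArg (fun L : Coord m →L[ℝ] ℝ ↦ L (toCoord p p v)) h2

lemma gram_symm (h : Metric n N) (y₀ y : N) (i j : Fin n) : gram h y₀ y i j = gram h y₀ y j i :=
  h.symm _ _ _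

lemma inner_eq_sum_gram (h : Metric n N) {y₀ y : N} (hy : y ∈ (chartAt (Coord n) y₀).source)
    (v w : TangentSpace (𝓡 n) y) :
    h.inner y v w = ∑ i, ∑ j, gram h y₀ y i j * (toCoord y₀ y v i * toCoord y₀ y w j) := by
  conv_lhs => rw [← sum_toCoord_smul_partialAt hy v, ← sum_toCoord_smul_partialAt hy w]
  simp only [map_sum, map_smul, sum_apply, smul_apply,
    smul_eq_mul, gram, Matrix.of_apply, Finset.mul_sum]
  rw [Finset.sum_comm]
  refine Finset.sum_congr rfl fun i _ ↦ Finset.sum_congr rfl fun j _ ↦ by ring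

lemma partialAt_linearIndep {y₀ y : N} (hy : y ∈ (chartAt (Coord n) y₀).source) (c : Fin n → ℝ)
    (hc : ∑ i, c i • partialAt y₀ y i = 0) : c = 0 := by
  have h1 := toCoord_ofCoord hy (WithLp.toLp 2 c)
  rw [ofCoord_eq_sum] at h1
  have h2 : ∑ i, (WithLp.toLp 2 c : Coord n) i • partialAt y₀ y i = 0 := hc
  rw [h2, map_zero] at h1
  ext i
  exact (congrArg (fun u : Coord n ↦ u i) h1).symm

/-- A kernel vector of the Gram matrix gives a tangent vector of length zero, which must vanish
although the coordinate fields are independent. -/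
lemma gram_det_ne_zero (h : Metric n N) {y₀ y : N} (hy : y ∈ (chartAt (Coord n) y₀).source) :
    (gram h y₀ y).det ≠ 0 := by
  intro h0
  obtain ⟨c, hc0, hc⟩ := Matrix.exists_mulVec_eq_zero_iff.2 h0
  set u := ∑ i, c i • partialAt y₀ y i with hu
  have h1 : h.inner y u u = 0 := by
    have : h.inner y u u = ∑ i, c i * (gram h y₀ y).mulVec c i := by
      simp only [hu, map_sum, map_smul, sum_apply, smul_apply,
        smul_eq_mul, gram, Matrix.of_apply, Finset.mul_sum, Matrix.mulVec, dotProduct]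
      rw [Finset.sum_comm]
      refine Finset.sum_congr rfl fun i _ ↦ Finset.sum_congr rfl fun j _ ↦ by ring
    rw [this, hc]
    simp
  have h2 : u = 0 := by
    by_contra hne
    exact (h.pos y u hne).ne' h1
  exact hc0 (partialAt_linearIndep hy c h2)

lemma gram_mul_inv (h : Metric n N) {y₀ y : N} (hy : y ∈ (chartAt (Coord n) y₀).source) :
    gram h y₀ y * (gram h y₀ y)⁻¹ = 1 :=
  Matrix.mul_nonsing_inv _ (isUnit_iff_ne_zero.2 (gram_det_ne_zero h hy))

lemma gramDeriv_symm (h : Metric n N) (y₀ : N) (k i j : Fin n) :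
    gramDeriv h y₀ k i j = gramDeriv h y₀ k j i := by
  simp only [gramDeriv, gram_symm h y₀ _ i j]

lemma christoffel_symm (h : Metric n N) (y₀ : N) (i j k : Fin n) :
    christoffel h y₀ i j k = christoffel h y₀ j i k := by
  simp only [christoffel, gramDeriv_symm h y₀ _ i j]
  congr 1
  exact Finset.sum_congr rfl fun l _ ↦ by ring

/-- The Christoffel symbols of the first kind. -/
lemma sum_gram_mul_christoffel (h : Metric n N) (y₀ : N) (i j l : Fin n) :
    ∑ k, gram h y₀ y₀ l k * christoffel h y₀ i j k =
      (1 / 2) * (gramDeriv h y₀ i j l + gramDeriv h y₀ j i l - gramDeriv h y₀ l i j) := by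
  have h1 := gram_mul_inv h (mem_chart_source (Coord n) y₀)
  set b : Fin n → ℝ := fun l ↦
    gramDeriv h y₀ i j l + gramDeriv h y₀ j i l - gramDeriv h y₀ l i j with hb
  have h2 : (gram h y₀ y₀).mulVec ((gram h y₀ y₀)⁻¹.mulVec b) = b := by
    rw [Matrix.mulVec_mulVec, h1, Matrix.one_mulVec]
  have h3 := congrFun h2 l
  simp only [Matrix.mulVec, dotProduct] at h3
  change _ = (1 / 2) * b l
  rw [← h3, Finset.mul_sum]
  refine Finset.sum_congr rfl fun k _ ↦ ?_
  simp only [christoffel, hb]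
  ring

/-- Contracting with the metric lowers the upper Christoffel index, so no inverse Gram matrix is
left. -/
lemma sum_gram_mul_sum_christoffel (h : Metric n N) (y₀ : N) (x a b : Fin n → ℝ) :
    ∑ i, ∑ j, gram h y₀ y₀ i j * ((∑ s, ∑ t, christoffel h y₀ s t i * x s * a t) * b j) =
      ∑ s, ∑ t, ∑ j, (1 / 2) * (gramDeriv h y₀ s t j + gramDeriv h y₀ t s j -
        gramDeriv h y₀ j s t) * (x s * a t * b j) := by
  simp only [← sum_gram_mul_christoffel, Finset.sum_mul, Finset.mul_sum]
  rw [Finset.sum_comm, Finset.sum_congr rfl fun j _ ↦ Finset.sum_comm, Finset.sum_comm]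
  refine Finset.sum_congr rfl fun s _ ↦ ?_
  rw [Finset.sum_congr rfl fun j _ ↦ Finset.sum_comm, Finset.sum_comm]
  refine Finset.sum_congr rfl fun t _ ↦ Finset.sum_congr rfl fun j _ ↦
    Finset.sum_congr rfl fun i _ ↦ ?_
  rw [gram_symm h y₀ y₀ j i]
  ring

variable {h : Metric n N} {φ : M → N} {V W : ∀ p : M, TangentSpace (𝓡 n) (φ p)} {p : M}

lemma toCoord_covAlong (v : TangentSpace (𝓡 m) p) :
    toCoord (φ p) (φ p) (covAlong h φ V p v) =
      mvfderiv (𝓡 m) (fun q : M ↦ toCoord (φ p) (φ q) (V q)) p v +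
      WithLp.toLp 2 fun k ↦ ∑ i, ∑ j, christoffel h (φ p) i j k *
        toCoord (φ p) (φ p) (mfderiv (𝓡 m) (𝓡 n) φ p v) i * toCoord (φ p) (φ p) (V p) j :=
  toCoord_ofCoord (mem_chart_source _ _) _

lemma toCoord_injective {y₀ y : N} (hy : y ∈ (chartAt (Coord n) y₀).source) :
    Function.Injective (toCoord (n := n) y₀ y) :=
  Function.LeftInverse.injective (ofCoord_toCoord hy)

lemma covAlong_congr (hVW : ∀ᶠ q in 𝓝 p, V q = W q) (v : TangentSpace (𝓡 m) p) :
    covAlong h φ V p v = covAlong h φ W p v := by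
  simp only [covAlong, hVW.self_of_nhds]
  rw [mvfderiv_congr (f' := fun q : M ↦ toCoord (φ p) (φ q) (W q))]
  filter_upwards [hVW] with q hq
  rw [hq]

lemma covAlong_add_vec (v w : TangentSpace (𝓡 m) p) :
    covAlong h φ V p (v + w) = covAlong h φ V p v + covAlong h φ V p w := by
  apply toCoord_injective (mem_chart_source _ (φ p))
  rw [map_add]
  simp only [toCoord_covAlong, map_add]
  ext k
  simp only [PiLp.add_apply, mul_add, add_mul, Finset.sum_add_distrib]
  ring

lemma covAlong_smul_vec (c : ℝ) (v : TangentSpace (𝓡 m) p) :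
    covAlong h φ V p (c • v) = c • covAlong h φ V p v := by
  apply toCoord_injective (mem_chart_source _ (φ p))
  rw [map_smul]
  simp only [toCoord_covAlong, map_smul]
  ext k
  simp only [PiLp.add_apply, PiLp.smul_apply, smul_eq_mul, mul_add, Finset.mul_sum]
  congr 1
  exact Finset.sum_congr rfl fun i _ ↦ Finset.sum_congr rfl fun j _ ↦ by ring

lemma covAlong_sum_vec {ι : Type*} (s : Finset ι) (v : ι → TangentSpace (𝓡 m) p) :
    covAlong h φ V p (∑ i ∈ s, v i) = ∑ i ∈ s, covAlong h φ V p (v i) :=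
  map_sum (⟨⟨covAlong h φ V p, by
    simpa using covAlong_smul_vec (h := h) (V := V) 0 (0 : TangentSpace (𝓡 m) p)⟩,
    covAlong_add_vec⟩ : TangentSpace (𝓡 m) p →+ TangentSpace (𝓡 n) (φ p)) v s

lemma covAlong_add (hV : SmoothAlong m φ V p) (hW : SmoothAlong m φ W p)
    (v : TangentSpace (𝓡 m) p) :
    covAlong h φ (fun q ↦ V q + W q) p v = covAlong h φ V p v + covAlong h φ W p v := by
  apply toCoord_injective (mem_chart_source _ (φ p))
  rw [map_add]
  simp only [toCoord_covAlong, map_add]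
  rw [mvfderiv_fun_add (hV.toCoord (mem_chart_source _ _)).mdiff
    (hW.toCoord (mem_chart_source _ _)).mdiff]
  ext k
  simp only [PiLp.add_apply, mul_add, Finset.sum_add_distrib, add_apply]
  ring

lemma covAlong_smul {f : M → ℝ} (hf : SmoothNear m f p) (hV : SmoothAlong m φ V p)
    (v : TangentSpace (𝓡 m) p) :
    covAlong h φ (fun q ↦ f q • V q) p v =
      f p • covAlong h φ V p v + mvfderiv (𝓡 m) f p v • V p := by
  apply toCoord_injective (mem_chart_source _ (φ p))
  rw [map_add, map_smul, map_smul]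
  simp only [toCoord_covAlong, map_smul]
  rw [mvfderiv_fun_smul hf.mdiff (hV.toCoord (mem_chart_source _ _)).mdiff]
  ext k
  simp only [PiLp.add_apply, PiLp.smul_apply, smul_eq_mul, mul_add, add_apply, smul_apply,
    ContinuousLinearMap.smulRight_apply, Finset.mul_sum]
  have : ∀ i j, christoffel h (φ p) i j k *
      toCoord (φ p) (φ p) (mfderiv (𝓡 m) (𝓡 n) φ p v) i * (f p * toCoord (φ p) (φ p) (V p) j) =
      f p * (christoffel h (φ p) i j k *
      toCoord (φ p) (φ p) (mfderiv (𝓡 m) (𝓡 n) φ p v) i * toCoord (φ p) (φ p) (V p) j) := by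
    intros; ring
  simp only [this]
  ring

lemma covAlong_zero (v : TangentSpace (𝓡 m) p) : covAlong h φ (fun _ ↦ 0) p v = 0 := by
  apply toCoord_injective (mem_chart_source _ (φ p))
  simp only [toCoord_covAlong, map_zero, mvfderiv_const]
  ext k
  simp

lemma covAlong_sub (hV : SmoothAlong m φ V p) (hW : SmoothAlong m φ W p)
    (v : TangentSpace (𝓡 m) p) :
    covAlong h φ (fun q ↦ V q - W q) p v = covAlong h φ V p v - covAlong h φ W p v := by
  rw [eq_sub_iff_add_eq, ← covAlong_add (hV.sub hW) hW]
  simp only [sub_add_cancel]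

lemma covAlong_const_smul (c : ℝ) (hV : SmoothAlong m φ V p) (v : TangentSpace (𝓡 m) p) :
    covAlong h φ (fun q ↦ c • V q) p v = c • covAlong h φ V p v := by
  rw [covAlong_smul (.const c) hV, mvfderiv_const]
  simp

lemma covAlong_sum {ι : Type*} (hφ : ∀ᶠ q in 𝓝 p, ContMDiffAt (𝓡 m) (𝓡 n) ∞ φ q) (s : Finset ι)
    {V : ι → ∀ p : M, TangentSpace (𝓡 n) (φ p)} (hV : ∀ i ∈ s, SmoothAlong m φ (V i) p)
    (v : TangentSpace (𝓡 m) p) :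
    covAlong h φ (fun q ↦ ∑ i ∈ s, V i q) p v = ∑ i ∈ s, covAlong h φ (V i) p v := by
  classical
  induction s using Finset.induction_on with
  | empty => simpa using covAlong_zero v
  | insert i s hi ih =>
    simp only [Finset.sum_insert hi]
    rw [covAlong_add (hV i (Finset.mem_insert_self _ _))
      (.sum hφ s fun j hj ↦ hV j (Finset.mem_insert_of_mem hj)),
      ih fun j hj ↦ hV j (Finset.mem_insert_of_mem hj)]

lemma mvfderiv_gram (hφ : MDifferentiableAt (𝓡 m) (𝓡 n) φ p) (i j : Fin n)
    (v : TangentSpace (𝓡 m) p) :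
    mvfderiv (𝓡 m) (fun q ↦ gram h (φ p) (φ q) i j) p v =
      ∑ k, gramDeriv h (φ p) k i j * toCoord (φ p) (φ p) (mfderiv (𝓡 m) (𝓡 n) φ p v) k := by
  have hy := mem_chart_source (Coord n) (φ p)
  have hg : SmoothNear n (fun y ↦ gram h (φ p) y i j) (φ p) :=
    (smoothAlong_partialAt hy i).inner h (smoothAlong_partialAt hy j)
  have h1 := mvfderiv_comp_apply p hg.mdiff hφ v
  refine h1.trans ?_
  rw [mvfderiv_eq_fderiv hy hg.mdiff]
  set c := toCoord (φ p) (φ p) (mfderiv (𝓡 m) (𝓡 n) φ p v)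
  have hc : c = ∑ i, c i • EuclideanSpace.single i (1 : ℝ) := by
    ext j
    simp [Finset.sum_apply, Pi.single_apply]
  conv_lhs => rw [hc]
  simp only [map_sum, map_smul, smul_eq_mul, gramDeriv]
  exact Finset.sum_congr rfl fun i _ ↦ mul_comm _ _

/-- The pull-back connection is compatible with the metric. -/
theorem mvfderiv_inner (hV : SmoothAlong m φ V p) (hW : SmoothAlong m φ W p)
    (v : TangentSpace (𝓡 m) p) :
    mvfderiv (𝓡 m) (fun q ↦ h.inner (φ q) (V q) (W q)) p v =
      h.inner (φ p) (covAlong h φ V p v) (W p) + h.inner (φ p) (V p) (covAlong h φ W p v) := by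
  have hy := mem_chart_source (Coord n) (φ p)
  have hφ : MDifferentiableAt (𝓡 m) (𝓡 n) φ p :=
    hV.base.self_of_nhds.mdifferentiableAt (by simp)
  have hVc := hV.toCoord hy
  have hWc := hW.toCoord hy
  have hG : ∀ i j, SmoothNear m (fun q ↦ gram h (φ p) (φ q) i j) p := fun i j ↦
    (smoothAlong_ofCoord hV.base hy (.const _)).inner h (smoothAlong_ofCoord hV.base hy (.const _))
  rw [mvfderiv_congr (f' := fun q ↦ ∑ i, ∑ j, gram h (φ p) (φ q) i j *
    (toCoord (φ p) (φ q) (V q) i * toCoord (φ p) (φ q) (W q) j))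
    ((hV.base_mem hy).mono fun q hq ↦ inner_eq_sum_gram h hq _ _),
    mvfderiv_fun_sum _ fun i _ ↦ .sum _ fun j _ ↦ (hG i j).mul ((hVc.coord i).mul (hWc.coord j))]
  have h1 : ∀ i ∈ Finset.univ, mvfderiv (𝓡 m) (fun q ↦ ∑ j, gram h (φ p) (φ q) i j *
      (toCoord (φ p) (φ q) (V q) i * toCoord (φ p) (φ q) (W q) j)) p v =
      ∑ j, (gram h (φ p) (φ p) i j * (toCoord (φ p) (φ p) (V p) i *
        mvfderiv (𝓡 m) (fun q ↦ toCoord (φ p) (φ q) (W q)) p v j +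
        toCoord (φ p) (φ p) (W p) j *
        mvfderiv (𝓡 m) (fun q ↦ toCoord (φ p) (φ q) (V q)) p v i) +
        (toCoord (φ p) (φ p) (V p) i * toCoord (φ p) (φ p) (W p) j) *
          ∑ k, gramDeriv h (φ p) k i j *
            toCoord (φ p) (φ p) (mfderiv (𝓡 m) (𝓡 n) φ p v) k) := by
    intro i _
    rw [mvfderiv_fun_sum _ fun j _ ↦ (hG i j).mul ((hVc.coord i).mul (hWc.coord j))]
    refine Finset.sum_congr rfl fun j _ ↦ ?_
    rw [mvfderiv_mul_apply (hG i j) ((hVc.coord i).mul (hWc.coord j)),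
      mvfderiv_mul_apply (hVc.coord i) (hWc.coord j), mvfderiv_gram hφ,
      mvfderiv_coord_apply hVc, mvfderiv_coord_apply hWc]
  rw [Finset.sum_congr rfl h1, inner_eq_sum_gram h hy, inner_eq_sum_gram h hy,
    toCoord_covAlong, toCoord_covAlong]
  set x := toCoord (φ p) (φ p) (mfderiv (𝓡 m) (𝓡 n) φ p v)
  set a := toCoord (φ p) (φ p) (V p)
  set b := toCoord (φ p) (φ p) (W p)
  set a' := mvfderiv (𝓡 m) (fun q ↦ toCoord (φ p) (φ q) (V q)) p v
  set b' := mvfderiv (𝓡 m) (fun q ↦ toCoord (φ p) (φ q) (W q)) p v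
  have e1 := sum_gram_mul_sum_christoffel h (φ p) x a b
  have e2 := sum_gram_mul_sum_christoffel h (φ p) x b a
  have e3 : ∀ c d : Fin n → ℝ, ∑ i, ∑ j, gram h (φ p) (φ p) i j * (c i * d j) =
      ∑ i, ∑ j, gram h (φ p) (φ p) i j * (d i * c j) := fun c d ↦ by
    rw [Finset.sum_comm]
    refine Finset.sum_congr rfl fun i _ ↦ Finset.sum_congr rfl fun j _ ↦ ?_
    rw [gram_symm h (φ p) (φ p) j i]
    ring
  have e4 : ∑ i, ∑ j, (a i * b j) * ∑ k, gramDeriv h (φ p) k i j * x k =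
      ∑ s, ∑ t, ∑ j, gramDeriv h (φ p) s t j * (x s * a t * b j) := by
    simp only [Finset.mul_sum]
    rw [Finset.sum_congr rfl fun i _ ↦ Finset.sum_comm, Finset.sum_comm]
    refine Finset.sum_congr rfl fun s _ ↦ Finset.sum_congr rfl fun t _ ↦
      Finset.sum_congr rfl fun j _ ↦ by ring
  have e5 : ∑ s, ∑ t, ∑ j, (1 / 2) * (gramDeriv h (φ p) s t j + gramDeriv h (φ p) t s j -
        gramDeriv h (φ p) j s t) * (x s * b t * a j) =
      ∑ s, ∑ t, ∑ j, (1 / 2) * (gramDeriv h (φ p) s t j + gramDeriv h (φ p) j s t -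
        gramDeriv h (φ p) t s j) * (x s * a t * b j) := by
    refine Finset.sum_congr rfl fun s _ ↦ ?_
    rw [Finset.sum_comm]
    refine Finset.sum_congr rfl fun t _ ↦ Finset.sum_congr rfl fun j _ ↦ ?_
    rw [gramDeriv_symm h (φ p) s j t]
    ring
  -- The heart of compatibility: adding the first-kind symbols with the last two indices exchanged
  -- leaves only `∂ₛ gₜⱼ`.
  have e6 : ∑ s, ∑ t, ∑ j, gramDeriv h (φ p) s t j * (x s * a t * b j) =
      (∑ s, ∑ t, ∑ j, (1 / 2) * (gramDeriv h (φ p) s t j + gramDeriv h (φ p) t s j -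
        gramDeriv h (φ p) j s t) * (x s * a t * b j)) +
      ∑ s, ∑ t, ∑ j, (1 / 2) * (gramDeriv h (φ p) s t j + gramDeriv h (φ p) j s t -
        gramDeriv h (φ p) t s j) * (x s * a t * b j) := by
    simp only [← Finset.sum_add_distrib]
    refine Finset.sum_congr rfl fun s _ ↦ Finset.sum_congr rfl fun t _ ↦
      Finset.sum_congr rfl fun j _ ↦ by ring
  have e7 := e3 a fun k ↦ ∑ s, ∑ t, christoffel h (φ p) s t k * x s * b t
  simp only [PiLp.add_apply, mul_add, add_mul, Finset.sum_add_distrib]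
  rw [e7, e1, e2, e5, e4, e6]
  have e8 : ∑ i, ∑ j, gram h (φ p) (φ p) i j * (b j * a' i) =
      ∑ i, ∑ j, gram h (φ p) (φ p) i j * (a' i * b j) := by simp only [mul_comm]
  rw [e8]
  ring

end Connection

/-! ### Torsion-freeness, Koszul's formula, smoothness of covariant derivatives. -/

section Connection

variable {m : ℕ} {M : Type*} [TopologicalSpace M] [ChartedSpace (Coord m) M]
  [IsManifold (𝓡 m) ∞ M]
  {n : ℕ} {N : Type*} [TopologicalSpace N] [ChartedSpace (Coord n) N]
  [IsManifold (𝓡 n) ∞ N]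
  {F : Type*} [NormedAddCommGroup F] [NormedSpace ℝ F]
  {h : Metric n N} {φ : M → N} {V W : ∀ p : M, TangentSpace (𝓡 n) (φ p)} {p : M}

lemma toCoord_mfderiv {y₀ : N} {q : M} (hq : φ q ∈ (chartAt (Coord n) y₀).source)
    (hφ : MDifferentiableAt (𝓡 m) (𝓡 n) φ q) (v : TangentSpace (𝓡 m) q) :
    toCoord y₀ (φ q) (mfderiv (𝓡 m) (𝓡 n) φ q v) =
      mvfderiv (𝓡 m) (fun q ↦ extChartAt (𝓡 n) y₀ (φ q)) q v := by
  rw [toCoord_eq_mfderiv hq]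
  exact (mfderiv_comp_apply q (mdifferentiableAt_extChartAt hq) hφ v).symm

/-- The pull-back connection is torsion-free. -/
theorem covAlong_mfderiv_partialAt_comm (hφ : ContMDiff (𝓡 m) (𝓡 n) ∞ φ) {p₀ : M}
    (hp : p ∈ (chartAt (Coord m) p₀).source) (i j : Fin m) :
    covAlong h φ (fun q ↦ mfderiv (𝓡 m) (𝓡 n) φ q (partialAt p₀ q i)) p (partialAt p₀ p j) =
      covAlong h φ (fun q ↦ mfderiv (𝓡 m) (𝓡 n) φ q (partialAt p₀ q j)) p (partialAt p₀ p i) := by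
  have hy := mem_chart_source (Coord n) (φ p)
  have hd : ∀ q, MDifferentiableAt (𝓡 m) (𝓡 n) φ q := hφ.mdifferentiable (by simp)
  have hF : SmoothNear m (fun q ↦ extChartAt (𝓡 n) (φ p) (φ q)) p := by
    filter_upwards [hφ.continuous.continuousAt.eventually (chart_source_mem_nhds hy)] with q hq
    exact (contMDiffAt_extChartAt_of_mem hq).comp q hφ.contMDiffAt
  -- The components of `dφ(∂ᵢ)` are the derivatives `∂ᵢ` of `φ` read in a target chart. The
  -- derivative terms then agree by symmetry of second derivatives, the others by symmetry of the
  -- Christoffel symbols.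
  have key : ∀ i, (fun q ↦ toCoord (φ p) (φ q) (mfderiv (𝓡 m) (𝓡 n) φ q (partialAt p₀ q i)))
      =ᶠ[𝓝 p] fun q ↦ mvfderiv (𝓡 m) (fun q ↦ extChartAt (𝓡 n) (φ p) (φ q)) q
        (partialAt p₀ q i) := fun i ↦ by
    filter_upwards [hφ.continuous.continuousAt.eventually (chart_source_mem_nhds hy)] with q hq
    exact toCoord_mfderiv hq (hd q) _
  apply toCoord_injective hy
  rw [toCoord_covAlong, toCoord_covAlong, mvfderiv_congr (key i), mvfderiv_congr (key j),
    mvfderiv_partialAt_comm hp hF i j]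
  congr 2
  ext k
  rw [Finset.sum_comm]
  refine Finset.sum_congr rfl fun s _ ↦ Finset.sum_congr rfl fun t _ ↦ ?_
  rw [christoffel_symm h (φ p) t s k]
  ring

/-- The Levi-Civita connection is torsion-free. -/
theorem leviCivita_partialAt_comm (g : Metric m M) {p₀ : M}
    (hp : p ∈ (chartAt (Coord m) p₀).source) (i j : Fin m) :
    leviCivita g (fun q ↦ partialAt p₀ q i) p (partialAt p₀ p j) =
      leviCivita g (fun q ↦ partialAt p₀ q j) p (partialAt p₀ p i) := by
  have := covAlong_mfderiv_partialAt_comm (h := g) (φ := (id : M → M)) contMDiff_id hp i j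
  simp only [mfderiv_id] at this
  exact this

/-- For a section pulled back from `N` the pull-back connection is the Levi-Civita connection of
`N`. Applied to coordinate fields, it moves smoothness questions from the map `φ` to `N` itself. -/
lemma covAlong_comp {E : ∀ y : N, TangentSpace (𝓡 n) y} (hE : SmoothAlong n (id : N → N) E (φ p))
    (hφ : MDifferentiableAt (𝓡 m) (𝓡 n) φ p) (v : TangentSpace (𝓡 m) p) :
    covAlong h φ (fun q ↦ E (φ q)) p v = leviCivita h E (φ p) (mfderiv (𝓡 m) (𝓡 n) φ p v) := by
  have hy := mem_chart_source (Coord n) (φ p)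
  apply toCoord_injective hy
  have h1 := toCoord_covAlong (h := h) (φ := (id : N → N)) (V := E)
    (mfderiv (𝓡 m) (𝓡 n) φ p v : TangentSpace (𝓡 n) (φ p))
  refine (toCoord_covAlong v).trans (Eq.trans ?_ h1.symm)
  have h2 : mvfderiv (𝓡 m) (fun q ↦ toCoord (φ p) (φ q) (E (φ q))) p v =
      mvfderiv (𝓡 n) (fun y ↦ toCoord (φ p) y (E y)) (φ p) (mfderiv (𝓡 m) (𝓡 n) φ p v) :=
    mfderiv_comp_apply (g := fun y ↦ toCoord (φ p) y (E y)) p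
      (hE.toCoord (y₀ := φ p) hy).mdiff hφ v
  rw [h2]
  simp only [id, mfderiv_id]
  rfl

lemma leviCivita_sum_smul (g : Metric m M) (Y : ∀ p : M, TangentSpace (𝓡 m) p) {ι : Type*}
    (s : Finset ι) (c : ι → ℝ) (v : ι → TangentSpace (𝓡 m) p) :
    leviCivita g Y p (∑ i ∈ s, c i • v i) = ∑ i ∈ s, c i • leviCivita g Y p (v i) := by
  have h1 := covAlong_sum_vec (h := g) (φ := (id : M → M)) (V := Y) s fun i ↦ c i • v i
  simp only [covAlong_smul_vec] at h1
  exact h1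

/-- Cramer's rule: the entries of the inverse are polynomials in the entries of `G` divided by the
determinant. -/
lemma SmoothNear.matrix_inv {ι : Type*} [Fintype ι] [DecidableEq ι] {G : M → Matrix ι ι ℝ}
    (hG : ∀ i j, SmoothNear m (fun q ↦ G q i j) p) (h0 : (G p).det ≠ 0) (i j : ι) :
    SmoothNear m (fun q ↦ (G q)⁻¹ i j) p := by
  have hdet : ∀ {G : M → Matrix ι ι ℝ} (_ : ∀ i j, SmoothNear m (fun q ↦ G q i j) p),
      SmoothNear m (fun q ↦ (G q).det) p := fun hG ↦ by
    simp only [Matrix.det_apply, Units.smul_def, zsmul_eq_mul]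
    exact .sum _ fun σ _ ↦ .mul (.const _) (.prod _ fun i _ ↦ hG _ _)
  have hadj : SmoothNear m (fun q ↦ (G q).adjugate i j) p := by
    simp only [Matrix.adjugate_apply]
    refine hdet fun k l ↦ ?_
    simp only [Matrix.updateRow_apply]
    split_ifs
    · exact .const _
    · exact hG _ _
  refine (((hdet hG).inv h0).mul hadj).congr (.of_forall fun q ↦ ?_)
  simp [Matrix.inv_def, Ring.inverse_eq_inv']

lemma toCoord_eq_sum_inner (h : Metric n N) {y₀ y : N} (hy : y ∈ (chartAt (Coord n) y₀).source)
    (v : TangentSpace (𝓡 n) y) (i : Fin n) :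
    toCoord y₀ y v i = ∑ j, (gram h y₀ y)⁻¹ i j * h.inner y v (partialAt y₀ y j) := by
  have h1 : (fun j ↦ h.inner y v (partialAt y₀ y j)) =
      (gram h y₀ y).mulVec fun i ↦ toCoord y₀ y v i := by
    ext j
    conv_lhs => rw [← sum_toCoord_smul_partialAt hy v]
    simp only [map_sum, map_smul, sum_apply, smul_apply, smul_eq_mul, Matrix.mulVec, dotProduct]
    exact Finset.sum_congr rfl fun i _ ↦ by rw [gram_symm]; exact mul_comm _ _
  have h2 := congrFun (congrArg ((gram h y₀ y)⁻¹.mulVec) h1) i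
  rw [Matrix.mulVec_mulVec, Matrix.nonsing_inv_mul _
    (isUnit_iff_ne_zero.2 (gram_det_ne_zero h hy)), Matrix.one_mulVec] at h2
  exact h2.symm

/-- A section is smooth if its inner products with the coordinate fields are. -/
lemma SmoothAlong.of_inner (h : Metric n N) {y₀ : N}
    (hφ : ∀ᶠ q in 𝓝 p, ContMDiffAt (𝓡 m) (𝓡 n) ∞ φ q)
    (hp : φ p ∈ (chartAt (Coord n) y₀).source)
    (hV : ∀ j, SmoothNear m (fun q ↦ h.inner (φ q) (V q) (partialAt y₀ (φ q) j)) p) :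
    SmoothAlong m φ V p := by
  refine .of_toCoord hφ hp ?_
  have hG : ∀ i j, SmoothNear m (fun q ↦ gram h y₀ (φ q) i j) p := fun i j ↦
    (smoothAlong_ofCoord hφ hp (.const _)).inner h (smoothAlong_ofCoord hφ hp (.const _))
  have h1 : SmoothNear m (fun q ↦ (WithLp.toLp 2 fun i ↦ ∑ j, (gram h y₀ (φ q))⁻¹ i j *
      h.inner (φ q) (V q) (partialAt y₀ (φ q) j) : Coord n)) p :=
    .toLp fun i ↦ .sum _ fun j _ ↦ (SmoothNear.matrix_inv hG (gram_det_ne_zero h hp) i j).mul (hV j)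
  refine h1.congr ?_
  filter_upwards [hφ.self_of_nhds.continuousAt.eventually (chart_source_mem_nhds hp)] with q hq
  ext i
  exact toCoord_eq_sum_inner h hq _ i

lemma leviCivita_inner (g : Metric m M) {X Y : ∀ p : M, TangentSpace (𝓡 m) p}
    (hX : SmoothAlong m (id : M → M) X p) (hY : SmoothAlong m (id : M → M) Y p)
    (v : TangentSpace (𝓡 m) p) :
    mvfderiv (𝓡 m) (fun q ↦ g.inner q (X q) (Y q)) p v =
      g.inner p (leviCivita g X p v) (Y p) + g.inner p (X p) (leviCivita g Y p v) :=
  mvfderiv_inner (h := g) hX hY v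

/-- Koszul's formula for coordinate fields. -/
lemma koszul (g : Metric m M) {p₀ : M} (hp : p ∈ (chartAt (Coord m) p₀).source) (i j k : Fin m) :
    g.inner p (leviCivita g (fun q ↦ partialAt p₀ q i) p (partialAt p₀ p j)) (partialAt p₀ p k) =
      (1 / 2) * (mvfderiv (𝓡 m) (fun q ↦ gram g p₀ q i k) p (partialAt p₀ p j) +
        mvfderiv (𝓡 m) (fun q ↦ gram g p₀ q j k) p (partialAt p₀ p i) -
        mvfderiv (𝓡 m) (fun q ↦ gram g p₀ q i j) p (partialAt p₀ p k)) := by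
  have key : ∀ a b c : Fin m, mvfderiv (𝓡 m) (fun q ↦ gram g p₀ q a b) p (partialAt p₀ p c) =
      g.inner p (leviCivita g (fun q ↦ partialAt p₀ q a) p (partialAt p₀ p c)) (partialAt p₀ p b) +
      g.inner p (leviCivita g (fun q ↦ partialAt p₀ q b) p (partialAt p₀ p c)) (partialAt p₀ p a) :=
    fun a b c ↦ (leviCivita_inner g (smoothAlong_partialAt hp a) (smoothAlong_partialAt hp b)
      (partialAt p₀ p c)).trans (congrArg _ (g.symm _ _ _))
  rw [key, key, key, leviCivita_partialAt_comm g hp i k, leviCivita_partialAt_comm g hp j i,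
    leviCivita_partialAt_comm g hp j k]
  ring

/-- Smoothness cannot be read off the definition, whose chart varies with `q`. Koszul's formula
expresses the inner products with coordinate fields through derivatives of the Gram matrix in the
fixed chart at `p₀`. -/
lemma smoothAlong_leviCivita_partialAt (g : Metric m M) {p₀ : M}
    (hp : p ∈ (chartAt (Coord m) p₀).source) (i j : Fin m) :
    SmoothAlong m (id : M → M)
      (fun q ↦ leviCivita g (fun q ↦ partialAt p₀ q i) q (partialAt p₀ q j)) p := by
  refine .of_inner g (y₀ := p₀) (.of_forall fun _ ↦ contMDiffAt_id) hp fun k ↦ ?_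
  have hG : ∀ a b c, SmoothNear m (fun q ↦ mvfderiv (𝓡 m) (fun q ↦ gram g p₀ q a b) q
      (partialAt p₀ q c)) p := fun a b c ↦
    ((smoothAlong_partialAt hp a).inner g (smoothAlong_partialAt hp b)).mvfderiv
      (smoothAlong_partialAt hp c)
  refine ((SmoothNear.const (1 / 2 : ℝ)).mul
    (((hG i k j).add (hG j k i)).sub (hG i j k))).congr ?_
  filter_upwards [chart_source_mem_nhds hp] with q hq
  exact koszul g hq i j k

/-- The covariant derivative of a smooth section along a smooth vector field is smooth. -/
theorem smoothAlong_covAlong (hφ : ContMDiff (𝓡 m) (𝓡 n) ∞ φ) (hV : SmoothAlong m φ V p)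
    {X : ∀ p : M, TangentSpace (𝓡 m) p} (hX : SmoothAlong m (id : M → M) X p) :
    SmoothAlong m φ (fun q ↦ covAlong h φ V q (X q)) p := by
  have hφ' : ∀ p : M, ∀ᶠ q in 𝓝 p, ContMDiffAt (𝓡 m) (𝓡 n) ∞ φ q := fun p ↦
    .of_forall fun q ↦ hφ.contMDiffAt
  have hd : ∀ q, MDifferentiableAt (𝓡 m) (𝓡 n) φ q := hφ.mdifferentiable (by simp)
  have hy := mem_chart_source (Coord n) (φ p)
  have hc := hV.toCoord hy
  have hdX := (SmoothAlong.mfderiv hφ hX).toCoord hy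
  have hE : ∀ i, SmoothAlong m φ (fun q ↦ partialAt (φ p) (φ q) i) p := fun i ↦
    smoothAlong_ofCoord (hφ' p) hy (.const _)
  -- This is the Leibniz expansion of `∇_X V` in the coordinate frame of the fixed chart at `φ p`;
  -- every ingredient is smooth.
  have h1 : SmoothAlong m φ (fun q ↦ ∑ i, ((toCoord (φ p) (φ q) (V q) i) •
      (∑ j, toCoord (φ p) (φ q) (mfderiv (𝓡 m) (𝓡 n) φ q (X q)) j •
        leviCivita h (fun y ↦ partialAt (φ p) y i) (φ q) (partialAt (φ p) (φ q) j)) +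
      mvfderiv (𝓡 m) (fun q ↦ toCoord (φ p) (φ q) (V q) i) q (X q) •
        partialAt (φ p) (φ q) i)) p :=
    .sum (hφ' p) _ fun i _ ↦ .add (.smul (hc.coord i) (.sum (hφ' p) _ fun j _ ↦
      .smul (hdX.coord j) ((smoothAlong_leviCivita_partialAt h hy i j).comp (hφ' p))))
      (.smul ((hc.coord i).mvfderiv hX) (hE i))
  refine h1.congr ?_
  filter_upwards [hφ.continuous.continuousAt.eventually (chart_source_mem_nhds hy),
    hc.eventually, hφ.continuous.continuousAt.eventually_mem
      (chart_source_mem_nhds hy) |>.eventually_nhds] with q hq hcq hev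
  have h2 : ∀ i, SmoothAlong m φ (fun q ↦ partialAt (φ p) (φ q) i) q := fun i ↦
    smoothAlong_ofCoord (hφ' q) hq (.const _)
  rw [covAlong_congr (W := fun q ↦ ∑ i, toCoord (φ p) (φ q) (V q) i • partialAt (φ p) (φ q) i)
    (hev.mono fun q' hq' ↦ (sum_toCoord_smul_partialAt hq' _).symm),
    covAlong_sum (hφ' q) _ fun i _ ↦ (h2 i).smul (hcq.coord i)]
  refine Finset.sum_congr rfl fun i _ ↦ ?_
  rw [covAlong_smul (hcq.coord i) (h2 i),
    covAlong_comp (smoothAlong_partialAt hq i) (hd q)]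
  rw [← leviCivita_sum_smul, sum_toCoord_smul_partialAt hq]

lemma smoothAlong_leviCivita {g : Metric m M} {X Y : ∀ p : M, TangentSpace (𝓡 m) p}
    (hY : SmoothAlong m (id : M → M) Y p) (hX : SmoothAlong m (id : M → M) X p) :
    SmoothAlong m (id : M → M) (fun q ↦ leviCivita g Y q (X q)) p :=
  smoothAlong_covAlong (h := g) contMDiff_id hY hX

end Connection

/-! ### Tensoriality, musical isomorphism, metric traces. -/

section Tensorial

variable {m : ℕ} {M : Type*} [TopologicalSpace M] [ChartedSpace (Coord m) M]
  [IsManifold (𝓡 m) ∞ M]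
  {n : ℕ} {N : Type*} [TopologicalSpace N] [ChartedSpace (Coord n) N]
  [IsManifold (𝓡 n) ∞ N]
  {h : Metric n N} {φ : M → N} {p : M} {g : Metric m M}

lemma leviCivita_congr {Y W : ∀ p : M, TangentSpace (𝓡 m) p} (hYW : ∀ᶠ q in 𝓝 p, Y q = W q)
    (v : TangentSpace (𝓡 m) p) : leviCivita g Y p v = leviCivita g W p v :=
  covAlong_congr (h := g) (φ := (id : M → M)) hYW v

lemma leviCivita_add {Y W : ∀ p : M, TangentSpace (𝓡 m) p} (hY : SmoothAlong m (id : M → M) Y p)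
    (hW : SmoothAlong m (id : M → M) W p) (v : TangentSpace (𝓡 m) p) :
    leviCivita g (fun q ↦ Y q + W q) p v = leviCivita g Y p v + leviCivita g W p v :=
  covAlong_add (h := g) hY hW v

lemma leviCivita_sub {Y W : ∀ p : M, TangentSpace (𝓡 m) p} (hY : SmoothAlong m (id : M → M) Y p)
    (hW : SmoothAlong m (id : M → M) W p) (v : TangentSpace (𝓡 m) p) :
    leviCivita g (fun q ↦ Y q - W q) p v = leviCivita g Y p v - leviCivita g W p v :=
  covAlong_sub (h := g) hY hW v

lemma leviCivita_smul {f : M → ℝ} (hf : SmoothNear m f p) {Y : ∀ p : M, TangentSpace (𝓡 m) p}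
    (hY : SmoothAlong m (id : M → M) Y p) (v : TangentSpace (𝓡 m) p) :
    leviCivita g (fun q ↦ f q • Y q) p v =
      f p • leviCivita g Y p v + mvfderiv (𝓡 m) f p v • Y p :=
  covAlong_smul (h := g) hf hY v

lemma leviCivita_const_smul (c : ℝ) {Y : ∀ p : M, TangentSpace (𝓡 m) p}
    (hY : SmoothAlong m (id : M → M) Y p) (v : TangentSpace (𝓡 m) p) :
    leviCivita g (fun q ↦ c • Y q) p v = c • leviCivita g Y p v :=
  covAlong_const_smul (h := g) c hY v

lemma leviCivita_sum {ι : Type*} (s : Finset ι) {Y : ι → ∀ p : M, TangentSpace (𝓡 m) p}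
    (hY : ∀ i ∈ s, SmoothAlong m (id : M → M) (Y i) p) (v : TangentSpace (𝓡 m) p) :
    leviCivita g (fun q ↦ ∑ i ∈ s, Y i q) p v = ∑ i ∈ s, leviCivita g (Y i) p v :=
  covAlong_sum (h := g) (.of_forall fun _ ↦ contMDiffAt_id) s hY v

lemma leviCivita_add_vec (Y : ∀ p : M, TangentSpace (𝓡 m) p) (v w : TangentSpace (𝓡 m) p) :
    leviCivita g Y p (v + w) = leviCivita g Y p v + leviCivita g Y p w :=
  covAlong_add_vec (h := g) (φ := (id : M → M)) v w

lemma leviCivita_smul_vec (Y : ∀ p : M, TangentSpace (𝓡 m) p) (c : ℝ)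
    (v : TangentSpace (𝓡 m) p) :
    leviCivita g Y p (c • v) = c • leviCivita g Y p v :=
  covAlong_smul_vec (h := g) (φ := (id : M → M)) c v

/-- The covariant derivative of a field of linear maps `T_q M → T_{φ q} N` is tensorial. -/
lemma covHom_tensorial (T : ∀ q : M, TangentSpace (𝓡 m) q →ₗ[ℝ] TangentSpace (𝓡 n) (φ q))
    (hT : ∀ X : ∀ p : M, TangentSpace (𝓡 m) p, SmoothAlong m (id : M → M) X p →
      SmoothAlong m φ (fun q ↦ T q (X q)) p)
    {Y W : ∀ p : M, TangentSpace (𝓡 m) p} (hY : SmoothAlong m (id : M → M) Y p)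
    (hW : SmoothAlong m (id : M → M) W p) (hYW : Y p = W p) (v : TangentSpace (𝓡 m) p) :
    covAlong h φ (fun q ↦ T q (Y q)) p v - T p (leviCivita g Y p v) =
      covAlong h φ (fun q ↦ T q (W q)) p v - T p (leviCivita g W p v) := by
  have hp := mem_chart_source (Coord m) p
  have hφ := (hT Y hY).base
  have hd : SmoothNear m (fun q ↦ toCoord p q (Y q - W q)) p := (hY.sub hW).toCoord (y₀ := p) hp
  have hE : ∀ i, SmoothAlong m (id : M → M) (fun q ↦ partialAt p q i) p := smoothAlong_partialAt hp
  have hev : ∀ᶠ q in 𝓝 p, Y q - W q = ∑ i, toCoord p q (Y q - W q) i • partialAt p q i := by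
    filter_upwards [chart_source_mem_nhds hp] with q hq
    exact (sum_toCoord_smul_partialAt hq _).symm
  have h0 : ∀ i, toCoord p p (Y p - W p) i = 0 := fun i ↦ by simp [hYW]
  -- The coefficients of `Y - W` vanish at `p`, so by Leibniz only their derivatives survive, and
  -- these enter both sides in the same way.
  have h1 : covAlong h φ (fun q ↦ T q (Y q - W q)) p v = T p (leviCivita g (fun q ↦ Y q - W q) p v) := by
    rw [leviCivita_congr hev, leviCivita_sum _ fun i _ ↦ (hE i).smul (hd.coord i),
      covAlong_congr (W := fun q ↦ ∑ i, toCoord p q (Y q - W q) i • T q (partialAt p q i))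
        (hev.mono fun q hq ↦ by
          conv_lhs => rw [hq]
          simp only [map_sum, map_smul]),
      covAlong_sum hφ _ fun i _ ↦ (hT _ (hE i)).smul (hd.coord i), map_sum]
    refine Finset.sum_congr rfl fun i _ ↦ ?_
    rw [covAlong_smul (hd.coord i) (hT _ (hE i)), leviCivita_smul (hd.coord i) (hE i), h0]
    simp
  simp only [map_sub] at h1
  rw [covAlong_sub (hT Y hY) (hT W hW), leviCivita_sub hY hW, map_sub] at h1
  rw [sub_eq_sub_iff_sub_eq_sub]
  exact h1

lemma inner_ext (g : Metric m M) {u u' : TangentSpace (𝓡 m) p}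
    (huu : ∀ w, g.inner p u w = g.inner p u' w) : u = u' := by
  by_contra hne
  have := g.pos p (u - u') (sub_ne_zero.2 hne)
  simp only [map_sub, sub_apply, huu, sub_self, lt_irrefl] at this

lemma sharp_inner (g : Metric m M) {α : TangentSpace (𝓡 m) p → ℝ} (hα : IsLinearMap ℝ α)
    (w : TangentSpace (𝓡 m) p) : g.inner p (sharp g p α) w = α w := by
  have hp := mem_chart_source (Coord m) p
  have key : ∀ k, g.inner p (sharp g p α) (partialAt p p k) = α (partialAt p p k) := by
    intro k
    have h1 : (gram g p p).mulVec ((gram g p p)⁻¹.mulVec fun j ↦ α (partialAt p p j)) =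
        fun j ↦ α (partialAt p p j) := by
      rw [Matrix.mulVec_mulVec, gram_mul_inv g hp, Matrix.one_mulVec]
    refine Eq.trans ?_ (congrFun h1 k)
    simp only [sharp, map_sum, map_smul, sum_apply, smul_apply, smul_eq_mul, Matrix.mulVec,
      dotProduct, Finset.mul_sum]
    refine Finset.sum_congr rfl fun i _ ↦ Finset.sum_congr rfl fun j _ ↦ ?_
    rw [gram_symm]
    exact mul_comm _ _
  have h2 := sum_toCoord_smul_partialAt hp w
  rw [← h2, map_sum, show α (∑ i, toCoord p p w i • partialAt p p i) =
    hα.mk' α (∑ i, toCoord p p w i • partialAt p p i) from rfl, map_sum]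
  refine Finset.sum_congr rfl fun i _ ↦ ?_
  rw [map_smul, map_smul, key]
  rfl

/-- The metric trace in terms of an orthonormal basis. -/
lemma metricTrace_eq_sum (g : Metric m M) {W : Type*} [AddCommGroup W] [Module ℝ W]
    (b : TangentSpace (𝓡 m) p →ₗ[ℝ] TangentSpace (𝓡 m) p →ₗ[ℝ] W)
    {e : Fin m → TangentSpace (𝓡 m) p}
    (he : ∀ i j, g.inner p (e i) (e j) = if i = j then 1 else 0) :
    metricTrace g p (fun v w ↦ b v w) = ∑ i, b (e i) (e i) := by
  have hp := mem_chart_source (Coord m) p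
  set P : Matrix (Fin m) (Fin m) ℝ := Matrix.of fun i a ↦ toCoord p p (e i) a with hP
  -- Orthonormality of `e` in coordinates; it identifies the inverse Gram matrix with `Pᵀ P`, and
  -- the trace formula is then a change of basis.
  have h1 : P * gram g p p * P.transpose = 1 := by
    ext i j
    rw [Matrix.one_apply, ← he i j, inner_eq_sum_gram g hp, Matrix.mul_assoc, Matrix.mul_apply]
    refine Finset.sum_congr rfl fun a _ ↦ ?_
    rw [Matrix.mul_apply, Finset.mul_sum]
    refine Finset.sum_congr rfl fun c _ ↦ ?_
    simp only [hP, Matrix.of_apply, Matrix.transpose_apply]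
    ring
  have h2 : (gram g p p)⁻¹ = P.transpose * P := by
    refine Matrix.inv_eq_left_inv ?_
    rw [Matrix.mul_assoc]
    rw [mul_eq_one_comm] at h1
    exact h1
  have h3 : ∀ i, b (e i) (e i) = ∑ a, ∑ c, (P i a * P i c) • b (partialAt p p a) (partialAt p p c) := by
    intro i
    conv_lhs => rw [← sum_toCoord_smul_partialAt hp (e i)]
    simp only [map_sum, map_smul, LinearMap.sum_apply, LinearMap.smul_apply, Finset.smul_sum,
      smul_smul]
    rw [Finset.sum_comm]
    refine Finset.sum_congr rfl fun a _ ↦ Finset.sum_congr rfl fun c _ ↦ ?_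
    rw [mul_comm]
    rfl
  simp only [h3, metricTrace, h2, Matrix.mul_apply, Matrix.transpose_apply, Finset.sum_smul]
  rw [Finset.sum_congr rfl fun a _ ↦ Finset.sum_comm, Finset.sum_comm]

end Tensorial

/-! ### The second fundamental form and the shape operator. -/

section Immersion

variable {m : ℕ} {M : Type*} [TopologicalSpace M] [ChartedSpace (Coord m) M]
  [IsManifold (𝓡 m) ∞ M]
  {n : ℕ} {N : Type*} [TopologicalSpace N] [ChartedSpace (Coord n) N]
  [IsManifold (𝓡 n) ∞ N]
  {g : Metric m M} {h : Metric n N} {φ : M → N} {p : M}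

/-- By tensoriality the extension built into the definition may be replaced by any smooth one;
frames and coordinate fields are used below. -/
lemma secondFundForm_eq (hφ : ContMDiff (𝓡 m) (𝓡 n) ∞ φ) {Y : ∀ p : M, TangentSpace (𝓡 m) p}
    (hY : SmoothAlong m (id : M → M) Y p) (v : TangentSpace (𝓡 m) p) :
    secondFundForm g h φ p v (Y p) =
      covAlong h φ (fun q ↦ mfderiv (𝓡 m) (𝓡 n) φ q (Y q)) p v
        - mfderiv (𝓡 m) (𝓡 n) φ p (leviCivita g Y p v) :=
  covHom_tensorial (fun q ↦ (mfderiv (𝓡 m) (𝓡 n) φ q).toLinearMap)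
    (fun _ hX ↦ SmoothAlong.mfderiv hφ hX) (smoothAlong_extendVec (Y p)) hY (extendVec_self _) v

lemma secondFundForm_add_left (v v' w : TangentSpace (𝓡 m) p) :
    secondFundForm g h φ p (v + v') w =
      secondFundForm g h φ p v w + secondFundForm g h φ p v' w := by
  simp only [secondFundForm, covAlong_add_vec, leviCivita_add_vec, map_add]
  abel

lemma secondFundForm_smul_left (c : ℝ) (v w : TangentSpace (𝓡 m) p) :
    secondFundForm g h φ p (c • v) w = c • secondFundForm g h φ p v w := by
  simp only [secondFundForm, covAlong_smul_vec, leviCivita_smul_vec, map_smul, smul_sub]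

lemma secondFundForm_add_right (hφ : ContMDiff (𝓡 m) (𝓡 n) ∞ φ) (v w w' : TangentSpace (𝓡 m) p) :
    secondFundForm g h φ p v (w + w') =
      secondFundForm g h φ p v w + secondFundForm g h φ p v w' := by
  have hw := smoothAlong_extendVec w
  have hw' := smoothAlong_extendVec w'
  have h1 := secondFundForm_eq (g := g) (h := h) hφ (hw.add hw') v
  simp only [extendVec_self, map_add] at h1
  rw [h1, covAlong_add (SmoothAlong.mfderiv hφ hw) (SmoothAlong.mfderiv hφ hw'),
    leviCivita_add hw hw', map_add]
  simp only [secondFundForm]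
  abel

lemma secondFundForm_smul_right (hφ : ContMDiff (𝓡 m) (𝓡 n) ∞ φ) (c : ℝ)
    (v w : TangentSpace (𝓡 m) p) :
    secondFundForm g h φ p v (c • w) = c • secondFundForm g h φ p v w := by
  have hw := smoothAlong_extendVec w
  have h1 := secondFundForm_eq (g := g) (h := h) hφ (SmoothAlong.smul (.const c) hw) v
  simp only [extendVec_self, map_smul] at h1
  rw [h1, covAlong_const_smul c (SmoothAlong.mfderiv hφ hw), leviCivita_const_smul c hw, map_smul,
    ← smul_sub]
  rfl

variable (g h) in
/-- The second fundamental form as a bilinear map. -/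
def secondFundFormₗ (hφ : ContMDiff (𝓡 m) (𝓡 n) ∞ φ) (p : M) :
    TangentSpace (𝓡 m) p →ₗ[ℝ] TangentSpace (𝓡 m) p →ₗ[ℝ] TangentSpace (𝓡 n) (φ p) :=
  LinearMap.mk₂ ℝ (secondFundForm g h φ p) secondFundForm_add_left secondFundForm_smul_left
    (secondFundForm_add_right hφ) fun c v w ↦ secondFundForm_smul_right hφ c v w

@[simp] lemma secondFundFormₗ_apply (hφ : ContMDiff (𝓡 m) (𝓡 n) ∞ φ) (v w : TangentSpace (𝓡 m) p) :
    secondFundFormₗ g h hφ p v w = secondFundForm g h φ p v w := rfl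

/-- On coordinate fields both terms of the definition are symmetric because both connections are
torsion-free; bilinearity does the rest. -/
lemma secondFundForm_symm (hφ : ContMDiff (𝓡 m) (𝓡 n) ∞ φ) (v w : TangentSpace (𝓡 m) p) :
    secondFundForm g h φ p v w = secondFundForm g h φ p w v := by
  have hp := mem_chart_source (Coord m) p
  have key : ∀ i j, secondFundForm g h φ p (partialAt p p j) (partialAt p p i) =
      secondFundForm g h φ p (partialAt p p i) (partialAt p p j) := fun i j ↦ by
    rw [secondFundForm_eq (Y := fun q ↦ partialAt p q i) hφ (smoothAlong_partialAt hp i),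
      secondFundForm_eq (Y := fun q ↦ partialAt p q j) hφ (smoothAlong_partialAt hp j),
      covAlong_mfderiv_partialAt_comm hφ hp, leviCivita_partialAt_comm g hp]
  rw [← sum_toCoord_smul_partialAt hp v, ← sum_toCoord_smul_partialAt hp w,
    ← secondFundFormₗ_apply hφ, ← secondFundFormₗ_apply hφ]
  simp only [map_sum, map_smul, LinearMap.sum_apply, LinearMap.smul_apply, Finset.smul_sum]
  rw [Finset.sum_comm]
  refine Finset.sum_congr rfl fun i _ ↦ Finset.sum_congr rfl fun j _ ↦ ?_
  rw [smul_comm, secondFundFormₗ_apply, secondFundFormₗ_apply, key]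

lemma smoothAlong_secondFundForm (hφ : ContMDiff (𝓡 m) (𝓡 n) ∞ φ)
    {X Y : ∀ p : M, TangentSpace (𝓡 m) p} (hX : SmoothAlong m (id : M → M) X p)
    (hY : SmoothAlong m (id : M → M) Y p) :
    SmoothAlong m φ (fun q ↦ secondFundForm g h φ q (X q) (Y q)) p := by
  refine ((smoothAlong_covAlong (h := h) hφ (SmoothAlong.mfderiv hφ hY) hX).sub
    (SmoothAlong.mfderiv hφ (smoothAlong_leviCivita (g := g) hY hX))).congr ?_
  filter_upwards [hY.eventually] with q hq
  exact secondFundForm_eq hφ hq _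

lemma covAlong_mfderiv (hφ : ContMDiff (𝓡 m) (𝓡 n) ∞ φ) {Y : ∀ p : M, TangentSpace (𝓡 m) p}
    (hY : SmoothAlong m (id : M → M) Y p) (v : TangentSpace (𝓡 m) p) :
    covAlong h φ (fun q ↦ mfderiv (𝓡 m) (𝓡 n) φ q (Y q)) p v = secondFundForm g h φ p v (Y p) +
        mfderiv (𝓡 m) (𝓡 n) φ p (leviCivita g Y p v) := by
  rw [secondFundForm_eq hφ hY, sub_add_cancel]

/-- The second fundamental form of a Riemannian immersion is normal. -/
lemma secondFundForm_normal (hφ : IsRiemannianImmersion g h φ) (v w u : TangentSpace (𝓡 m) p) :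
    h.inner (φ p) (secondFundForm g h φ p v w) (mfderiv (𝓡 m) (𝓡 n) φ p u) = 0 := by
  -- Differentiating `⟨dφ W, dφ U⟩ = ⟨W, U⟩` shows that `⟨B(v, w), dφ u⟩` is skew in `w, u`. It is
  -- also symmetric in `v, w`, and such a trilinear form is zero.
  have skew : ∀ v w u : TangentSpace (𝓡 m) p,
      h.inner (φ p) (secondFundForm g h φ p v w) (mfderiv (𝓡 m) (𝓡 n) φ p u) +
        h.inner (φ p) (secondFundForm g h φ p v u) (mfderiv (𝓡 m) (𝓡 n) φ p w) = 0 := by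
    intro v w u
    have hw := smoothAlong_extendVec w
    have hu := smoothAlong_extendVec u
    have h1 := mvfderiv_inner (h := h) (SmoothAlong.mfderiv hφ.1 hw) (SmoothAlong.mfderiv hφ.1 hu) v
    simp only [hφ.2] at h1
    rw [leviCivita_inner g hw hu, covAlong_mfderiv (g := g) hφ.1 hw,
      covAlong_mfderiv (g := g) hφ.1 hu] at h1
    simp only [map_add, add_apply, hφ.2, extendVec_self] at h1
    rw [h.symm _ (mfderiv (𝓡 m) (𝓡 n) φ p w)] at h1
    linarith
  have e1 := skew v w u
  have e2 := skew u v w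
  have e3 := skew w u v
  rw [secondFundForm_symm hφ.1 u v] at e2
  rw [secondFundForm_symm hφ.1 w u] at e3
  rw [secondFundForm_symm hφ.1 w v] at e3
  linarith

lemma tension_eq_sum (hφ : ContMDiff (𝓡 m) (𝓡 n) ∞ φ) {e : Fin m → TangentSpace (𝓡 m) p}
    (he : ∀ i j, g.inner p (e i) (e j) = if i = j then 1 else 0) :
    tension g h φ p = ∑ i, secondFundForm g h φ p (e i) (e i) :=
  metricTrace_eq_sum g (secondFundFormₗ g h hφ p) he

lemma meanCurv_eq_smul_tension : meanCurv g h φ p = (1 / (m : ℝ)) • tension g h φ p := rfl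

lemma tension_normal (hφ : IsRiemannianImmersion g h φ) (u : TangentSpace (𝓡 m) p) :
    h.inner (φ p) (tension g h φ p) (mfderiv (𝓡 m) (𝓡 n) φ p u) = 0 := by
  simp only [tension, metricTrace, map_sum, map_smul, sum_apply, smul_apply,
    secondFundForm_normal hφ, smul_zero, Finset.sum_const_zero]

lemma shapeH_inner (hφ : ContMDiff (𝓡 m) (𝓡 n) ∞ φ) (v w : TangentSpace (𝓡 m) p) :
    g.inner p (shapeH g h φ p v) w =
      h.inner (φ p) (secondFundForm g h φ p v w) (meanCurv g h φ p) := by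
  refine sharp_inner g ⟨fun w w' ↦ ?_, fun c w ↦ ?_⟩ w
  · rw [secondFundForm_add_right hφ, map_add, add_apply]
  · rw [secondFundForm_smul_right hφ, map_smul, smul_apply]

variable (g h) in
/-- The shape operator in the direction of `H` as a linear map. -/
def shapeHₗ (hφ : ContMDiff (𝓡 m) (𝓡 n) ∞ φ) (p : M) :
    TangentSpace (𝓡 m) p →ₗ[ℝ] TangentSpace (𝓡 m) p where
  toFun := shapeH g h φ p
  map_add' v v' := inner_ext g fun w ↦ by
    rw [map_add, add_apply, shapeH_inner hφ, shapeH_inner hφ, shapeH_inner hφ,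
      secondFundForm_add_left, map_add, add_apply]
  map_smul' c v := inner_ext g fun w ↦ by
    rw [map_smul, smul_apply, shapeH_inner hφ, shapeH_inner hφ,
      secondFundForm_smul_left, map_smul, smul_apply]
    rfl

lemma shapeH_selfAdjoint (hφ : ContMDiff (𝓡 m) (𝓡 n) ∞ φ) (v w : TangentSpace (𝓡 m) p) :
    g.inner p (shapeH g h φ p v) w = g.inner p v (shapeH g h φ p w) := by
  rw [g.symm _ v, shapeH_inner hφ, shapeH_inner hφ, secondFundForm_symm hφ]

end Immersion

/-! ### Adapted orthonormal frames on a surface. -/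

section Surface

variable {M : Type*} [TopologicalSpace M] [ChartedSpace (Coord 2) M] [IsManifold (𝓡 2) ∞ M]
  {n : ℕ} {N : Type*} [TopologicalSpace N] [ChartedSpace (Coord n) N]
  [IsManifold (𝓡 n) ∞ N]
  {g : Metric 2 M} {h : Metric n N} {φ : M → N} {p : M}

/-- A local orthonormal frame of a surface, adapted to the coordinate fields of a chart:
`∂₀ = P e₀` and `∂₁ = Q e₀ + R e₁`. -/
structure AdaptedFrame (g : Metric 2 M) (p₀ p : M) where
  /-- The fields of the frame. -/
  e : Fin 2 → ∀ q : M, TangentSpace (𝓡 2) q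
  /-- The length of `∂₀`. -/
  P : M → ℝ
  /-- The first component of `∂₁`. -/
  Q : M → ℝ
  /-- The second component of `∂₁`. -/
  R : M → ℝ
  smooth_e : ∀ i, SmoothAlong 2 (id : M → M) (e i) p
  smooth_P : SmoothNear 2 P p
  smooth_Q : SmoothNear 2 Q p
  smooth_R : SmoothNear 2 R p
  orthonormal : ∀ᶠ q in 𝓝 p, ∀ i j, g.inner q (e i q) (e j q) = if i = j then 1 else 0
  P_pos : ∀ᶠ q in 𝓝 p, 0 < P q
  R_pos : ∀ᶠ q in 𝓝 p, 0 < R q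
  partial_zero : ∀ᶠ q in 𝓝 p, partialAt p₀ q 0 = P q • e 0 q
  partial_one : ∀ᶠ q in 𝓝 p, partialAt p₀ q 1 = Q q • e 0 q + R q • e 1 q

/-- Gram–Schmidt on `∂₀, ∂₁`, keeping the triangular coefficients. They give the area density `P R`,
and later the coefficients of the Laplacian. -/
lemma exists_adaptedFrame (g : Metric 2 M) {p₀ p : M}
    (hp : p ∈ (chartAt (Coord 2) p₀).source) : Nonempty (AdaptedFrame g p₀ p) := by
  have hs : ∀ i j, SmoothNear 2 (fun q ↦ gram g p₀ q i j) p := fun i j ↦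
    (smoothAlong_partialAt hp i).inner g (smoothAlong_partialAt hp j)
  have hpos : ∀ q ∈ (chartAt (Coord 2) p₀).source, ∀ c : Fin 2 → ℝ, c ≠ 0 →
      ∑ i, c i • partialAt p₀ q i ≠ 0 := fun q hq c hc h0 ↦ hc (partialAt_linearIndep hq c h0)
  have hE : ∀ q ∈ (chartAt (Coord 2) p₀).source, 0 < gram g p₀ q 0 0 := fun q hq ↦ by
    refine g.pos q _ ?_
    have := hpos q hq ![1, 0] (fun h ↦ one_ne_zero (congrFun h 0))
    simpa using this
  set P : M → ℝ := fun q ↦ √(gram g p₀ q 0 0) with hP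
  set Q : M → ℝ := fun q ↦ gram g p₀ q 0 1 / P q with hQ
  have hPpos : ∀ q ∈ (chartAt (Coord 2) p₀).source, 0 < P q := fun q hq ↦ Real.sqrt_pos.2 (hE q hq)
  have hPP : ∀ q ∈ (chartAt (Coord 2) p₀).source, gram g p₀ q 0 0 = P q * P q := fun q hq ↦
    (Real.mul_self_sqrt (hE q hq).le).symm
  have hPQ : ∀ q ∈ (chartAt (Coord 2) p₀).source, gram g p₀ q 0 1 = P q * Q q := fun q hq ↦ by
    rw [hQ]
    have := (hPpos q hq).ne'
    field_simp
  have hsP : SmoothNear 2 P p := (hs 0 0).sqrt (hE p hp).ne'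
  have hsQ : SmoothNear 2 Q p := (hs 0 1).div hsP (hPpos p hp).ne'
  set e0 : ∀ q : M, TangentSpace (𝓡 2) q := fun q ↦ (P q)⁻¹ • partialAt p₀ q 0 with he0
  set f : ∀ q : M, TangentSpace (𝓡 2) q := fun q ↦ partialAt p₀ q 1 - Q q • e0 q with hf
  have hse0 : SmoothAlong 2 (id : M → M) e0 p :=
    .smul (hsP.inv (hPpos p hp).ne') (smoothAlong_partialAt hp 0)
  have hsf : SmoothAlong 2 (id : M → M) f p := (smoothAlong_partialAt hp 1).sub (.smul hsQ hse0)
  have hfpos : ∀ q ∈ (chartAt (Coord 2) p₀).source, 0 < g.inner q (f q) (f q) := fun q hq ↦ by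
    refine g.pos q _ ?_
    have := hpos q hq ![-(Q q * (P q)⁻¹), 1] (fun h ↦ one_ne_zero (congrFun h 1))
    simp only [Fin.sum_univ_two, Matrix.cons_val_zero, Matrix.cons_val_one, neg_smul,
      one_smul] at this
    simpa only [hf, he0, smul_smul, sub_eq_neg_add] using this
  set R : M → ℝ := fun q ↦ √(g.inner q (f q) (f q)) with hR
  have hRpos : ∀ q ∈ (chartAt (Coord 2) p₀).source, 0 < R q := fun q hq ↦
    Real.sqrt_pos.2 (hfpos q hq)
  have hsR : SmoothNear 2 R p := (hsf.inner g hsf).sqrt (hfpos p hp).ne'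
  have hsrc : ∀ᶠ q in 𝓝 p, q ∈ (chartAt (Coord 2) p₀).source := chart_source_mem_nhds hp
  have h00 : ∀ q ∈ (chartAt (Coord 2) p₀).source, g.inner q (e0 q) (e0 q) = 1 := fun q hq ↦ by
    have h1 : g.inner q (e0 q) (e0 q) = (P q)⁻¹ * ((P q)⁻¹ * gram g p₀ q 0 0) := by
      simp only [he0, map_smul, smul_apply, smul_eq_mul]; rfl
    rw [h1, hPP q hq]
    have := (hPpos q hq).ne'
    field_simp
  have h0f : ∀ q ∈ (chartAt (Coord 2) p₀).source, g.inner q (e0 q) (f q) = 0 := fun q hq ↦ by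
    have h1 : g.inner q (e0 q) (partialAt p₀ q 1) = (P q)⁻¹ * gram g p₀ q 0 1 := by
      simp only [he0, map_smul, smul_apply, smul_eq_mul]; rfl
    have h2 : g.inner q (e0 q) (f q) =
        g.inner q (e0 q) (partialAt p₀ q 1) - Q q * g.inner q (e0 q) (e0 q) :=
      ((g.inner q (e0 q)).map_sub _ _).trans
        (congrArg _ ((g.inner q (e0 q)).map_smul (Q q) (e0 q)))
    rw [h2, h00 q hq, h1, hPQ q hq]
    have := (hPpos q hq).ne'
    field_simp
    simp
  refine ⟨⟨![e0, fun q ↦ (R q)⁻¹ • f q], P, Q, R, ?_, hsP, hsQ, hsR, ?_, hsrc.mono hPpos,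
    hsrc.mono hRpos, ?_, ?_⟩⟩
  · intro i
    fin_cases i
    · exact hse0
    · exact .smul (hsR.inv (hRpos p hp).ne') hsf
  · filter_upwards [hsrc] with q hq
    have h01 : g.inner q (e0 q) ((R q)⁻¹ • f q) = 0 := by rw [map_smul, h0f q hq, smul_zero]
    have h11 : g.inner q ((R q)⁻¹ • f q) ((R q)⁻¹ • f q) = 1 := by
      have h2 : g.inner q (f q) (f q) = R q * R q := (Real.mul_self_sqrt (hfpos q hq).le).symm
      rw [map_smul, map_smul, smul_apply, h2]
      have := (hRpos q hq).ne'
      simp only [smul_eq_mul]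
      field_simp
    intro i j
    fin_cases i <;> fin_cases j
    · exact h00 q hq
    · exact h01
    · exact (g.symm _ _ _).trans h01
    · exact h11
  · filter_upwards [hsrc] with q hq
    exact (smul_inv_smul₀ (hPpos q hq).ne' _).symm
  · filter_upwards [hsrc] with q hq
    change _ = Q q • e0 q + R q • (R q)⁻¹ • f q
    rw [smul_inv_smul₀ (hRpos q hq).ne']
    simp only [hf]
    abel

end Surface

/-! ### From biconservativity to a divergence-free shape operator. -/

section StressBienergy

variable {M : Type*} [TopologicalSpace M] [ChartedSpace (Coord 2) M] [IsManifold (𝓡 2) ∞ M]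
  {n : ℕ} {N : Type*} [TopologicalSpace N] [ChartedSpace (Coord n) N]
  [IsManifold (𝓡 n) ∞ N]
  {g : Metric 2 M} {h : Metric n N} {φ : M → N} {p : M}

lemma smoothAlong_tension (hφ : ContMDiff (𝓡 2) (𝓡 n) ∞ φ) :
    SmoothAlong 2 φ (tension g h φ) p := by
  obtain ⟨fr⟩ := exists_adaptedFrame g (mem_chart_source (Coord 2) p)
  have h1 : SmoothAlong 2 φ (fun q ↦ ∑ i, secondFundForm g h φ q (fr.e i q) (fr.e i q)) p :=
    .sum (.of_forall fun _ ↦ hφ.contMDiffAt) _ fun i _ ↦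
      smoothAlong_secondFundForm hφ (fr.smooth_e i) (fr.smooth_e i)
  refine h1.congr ?_
  filter_upwards [fr.orthonormal] with q hq
  exact tension_eq_sum hφ hq

lemma tension_eq_smul_meanCurv : tension g h φ p = (2 : ℝ) • meanCurv g h φ p := by
  rw [meanCurv_eq_smul_tension, smul_smul]
  norm_num

lemma smoothAlong_shapeH (hφ : ContMDiff (𝓡 2) (𝓡 n) ∞ φ)
    {X : ∀ p : M, TangentSpace (𝓡 2) p} (hX : SmoothAlong 2 (id : M → M) X p) :
    SmoothAlong 2 (id : M → M) (fun q ↦ shapeH g h φ q (X q)) p := by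
  have hp := mem_chart_source (Coord 2) p
  refine .of_inner g (y₀ := p) (.of_forall fun _ ↦ contMDiffAt_id) hp fun j ↦ ?_
  have h1 : SmoothAlong 2 φ (meanCurv g h φ) p := .smul (.const _) (smoothAlong_tension hφ)
  have h2 := (smoothAlong_secondFundForm (g := g) (h := h) hφ hX
    (smoothAlong_partialAt hp j)).inner h h1
  exact h2.congr (.of_forall fun q ↦ shapeH_inner hφ _ _)

lemma shapeH_trace (hφ : ContMDiff (𝓡 2) (𝓡 n) ∞ φ) {e : Fin 2 → TangentSpace (𝓡 2) p}
    (he : ∀ i j, g.inner p (e i) (e j) = if i = j then 1 else 0) :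
    g.inner p (shapeH g h φ p (e 0)) (e 0) + g.inner p (shapeH g h φ p (e 1)) (e 1) =
      2 * meanCurvSq g h φ p := by
  have h1 := tension_eq_sum (h := h) hφ he
  rw [tension_eq_smul_meanCurv, Fin.sum_univ_two] at h1
  have h2 := congrArg (fun u ↦ h.inner (φ p) u (meanCurv g h φ p)) h1
  simp only [map_add, map_smul, add_apply, smul_apply, smul_eq_mul] at h2
  rw [shapeH_inner hφ, shapeH_inner hφ, meanCurvSq, h2]

/-- Differentiate `⟨dφ V, τ⟩ = 0` and use that `τ` is normal to discard the tangential part of `∇(dφ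
V)`. -/
lemma inner_mfderiv_covAlong_tension (hφ : IsRiemannianImmersion g h φ)
    (v w : TangentSpace (𝓡 2) p) :
    h.inner (φ p) (mfderiv (𝓡 2) (𝓡 n) φ p v) (covAlong h φ (tension g h φ) p w) =
      - h.inner (φ p) (secondFundForm g h φ p v w) (tension g h φ p) := by
  have hv := smoothAlong_extendVec v
  have h1 := mvfderiv_inner (h := h) (SmoothAlong.mfderiv hφ.1 hv)
    (smoothAlong_tension (g := g) (h := h) (p := p) hφ.1) w
  have h2 : ∀ q, h.inner (φ q) (mfderiv (𝓡 2) (𝓡 n) φ q (extendVec v q)) (tension g h φ q) = 0 :=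
    fun q ↦ (h.symm _ _ _).trans (tension_normal hφ _)
  simp only [h2, mvfderiv_const] at h1
  rw [covAlong_mfderiv (g := g) hφ.1 hv] at h1
  simp only [map_add, add_apply, extendVec_self] at h1
  rw [h.symm _ (mfderiv (𝓡 2) (𝓡 n) φ p (leviCivita g (extendVec v) p w)), tension_normal hφ,
    secondFundForm_symm hφ.1] at h1
  simp only [zero_apply] at h1
  linarith

/-- The stress-bienergy tensor of a Riemannian immersion of a surface. -/
lemma stressBienergy_eq (hφ : IsRiemannianImmersion g h φ) (v : TangentSpace (𝓡 2) p) :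
    stressBienergy g h φ p v =
      (4 : ℝ) • shapeH g h φ p v - (2 * meanCurvSq g h φ p) • v := by
  have hB := fun v w ↦ inner_mfderiv_covAlong_tension (p := p) hφ v w
  have hτ : h.inner (φ p) (tension g h φ p) (tension g h φ p) = 4 * meanCurvSq g h φ p := by
    simp only [tension_eq_smul_meanCurv, map_smul, smul_apply, smul_eq_mul, meanCurvSq]
    ring
  -- Thus `⟨dφ, ∇τ⟩ = -|τ|²`, and the coefficient of the identity in `S₂` is `½|τ|² - |τ|² =
  -- -2|H|²`.
  have htr : (metricTrace g p fun a b ↦ h.inner (φ p) (mfderiv (𝓡 2) (𝓡 n) φ p a)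
      (covAlong h φ (tension g h φ) p b)) = - (4 * meanCurvSq g h φ p) := by
    have e : ∀ u, h.inner (φ p) (tension g h φ p) u = metricTrace g p fun a b ↦
        h.inner (φ p) (secondFundForm g h φ p a b) u := fun u ↦ by
      simp only [tension, metricTrace, map_sum, map_smul, sum_apply, smul_apply]
    rw [← hτ, e]
    simp only [hB, metricTrace, smul_neg, Finset.sum_neg_distrib]
  refine inner_ext g fun w ↦ ?_
  refine (sharp_inner g ⟨fun w w' ↦ ?_, fun c w ↦ ?_⟩ w).trans ?_
  · simp only [map_add, add_apply, covAlong_add_vec]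
    ring
  · simp only [map_smul, smul_apply, smul_eq_mul, covAlong_smul_vec]
    ring
  · rw [htr, hτ, hB, hB, map_sub, sub_apply, map_smul, map_smul, smul_apply, smul_apply, shapeH_inner hφ.1,
      secondFundForm_symm hφ.1 w v, tension_eq_smul_meanCurv, map_smul]
    simp only [smul_eq_mul]
    ring

/-- Constancy of `|H|²` makes the multiple of the identity in `S₂` parallel. -/
lemma covEnd_stressBienergy (hφ : IsRiemannianImmersion g h φ) {κ : ℝ}
    (hκ : ∀ q, meanCurvSq g h φ q = κ) (v w : TangentSpace (𝓡 2) p) :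
    covEnd g (stressBienergy g h φ) p v w = (4 : ℝ) • covEnd g (shapeH g h φ) p v w := by
  have hw := smoothAlong_extendVec w
  simp only [covEnd, stressBienergy_eq hφ, hκ]
  rw [leviCivita_sub (.smul (.const _) (smoothAlong_shapeH hφ.1 hw)) (.smul (.const _) hw),
    leviCivita_const_smul _ (smoothAlong_shapeH hφ.1 hw), leviCivita_const_smul _ hw, smul_sub]
  abel

lemma divEnd_shapeH (hφ : IsRiemannianImmersion g h φ) {κ : ℝ}
    (hκ : ∀ q, meanCurvSq g h φ q = κ) (hbic : IsBiconservative g h φ) (p : M) :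
    divEnd g (shapeH g h φ) p = 0 := by
  have h1 := hbic p
  have h2 : divEnd g (stressBienergy g h φ) p = (4 : ℝ) • divEnd g (shapeH g h φ) p := by
    simp only [divEnd, metricTrace, covEnd_stressBienergy hφ hκ, Finset.smul_sum]
    refine Finset.sum_congr rfl fun i _ ↦ Finset.sum_congr rfl fun j _ ↦ smul_comm _ _ _
  rw [h2] at h1
  exact (smul_eq_zero.1 h1).resolve_left four_ne_zero

end StressBienergy

/-! ### Covariant derivative and divergence of a smooth field of endomorphisms. -/

section Endomorphism

variable {m : ℕ} {M : Type*} [TopologicalSpace M] [ChartedSpace (Coord m) M]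
  [IsManifold (𝓡 m) ∞ M] {g : Metric m M} {p : M}
  {A : ∀ q : M, TangentSpace (𝓡 m) q →ₗ[ℝ] TangentSpace (𝓡 m) q}

lemma covEnd_eq (hA : ∀ X : ∀ p : M, TangentSpace (𝓡 m) p, SmoothAlong m (id : M → M) X p →
      SmoothAlong m (id : M → M) (fun q ↦ A q (X q)) p)
    {Y : ∀ p : M, TangentSpace (𝓡 m) p} (hY : SmoothAlong m (id : M → M) Y p)
    (v : TangentSpace (𝓡 m) p) :
    covEnd g (fun q ↦ A q) p v (Y p) =
      leviCivita g (fun q ↦ A q (Y q)) p v - A p (leviCivita g Y p v) :=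
  covHom_tensorial (h := g) (φ := (id : M → M)) A hA (smoothAlong_extendVec (Y p)) hY
    (extendVec_self _) v

variable (g) in
/-- The covariant derivative of a smooth field of endomorphisms as a bilinear map. -/
def covEndₗ (hA : ∀ X : ∀ p : M, TangentSpace (𝓡 m) p, SmoothAlong m (id : M → M) X p →
      SmoothAlong m (id : M → M) (fun q ↦ A q (X q)) p) :
    TangentSpace (𝓡 m) p →ₗ[ℝ] TangentSpace (𝓡 m) p →ₗ[ℝ] TangentSpace (𝓡 m) p :=
  LinearMap.mk₂ ℝ (covEnd g (fun q ↦ A q) p)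
    (fun v v' w ↦ by simp only [covEnd, leviCivita_add_vec, map_add]; abel)
    (fun c v w ↦ by simp only [covEnd, leviCivita_smul_vec, map_smul, smul_sub])
    (fun v w w' ↦ by
      have hw := smoothAlong_extendVec w
      have hw' := smoothAlong_extendVec w'
      have h1 := covEnd_eq (g := g) hA (hw.add hw') v
      simp only [extendVec_self, map_add] at h1
      rw [h1, leviCivita_add (hA _ hw) (hA _ hw'), leviCivita_add hw hw', map_add]
      simp only [covEnd]
      abel)
    (fun c v w ↦ by
      have hw := smoothAlong_extendVec w
      have h1 := covEnd_eq (g := g) hA (SmoothAlong.smul (.const c) hw) v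
      simp only [extendVec_self, map_smul] at h1
      rw [h1, leviCivita_const_smul c (hA _ hw), leviCivita_const_smul c hw, map_smul, ← smul_sub]
      rfl)

@[simp] lemma covEndₗ_apply (hA : ∀ X : ∀ p : M, TangentSpace (𝓡 m) p,
      SmoothAlong m (id : M → M) X p → SmoothAlong m (id : M → M) (fun q ↦ A q (X q)) p)
    (v w : TangentSpace (𝓡 m) p) : covEndₗ g hA v w = covEnd g (fun q ↦ A q) p v w := rfl

lemma divEnd_eq_sum (hA : ∀ X : ∀ p : M, TangentSpace (𝓡 m) p, SmoothAlong m (id : M → M) X p →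
      SmoothAlong m (id : M → M) (fun q ↦ A q (X q)) p) {e : Fin m → TangentSpace (𝓡 m) p}
    (he : ∀ i j, g.inner p (e i) (e j) = if i = j then 1 else 0) :
    divEnd g (fun q ↦ A q) p = ∑ i, covEnd g (fun q ↦ A q) p (e i) (e i) :=
  metricTrace_eq_sum g (covEndₗ g hA) he

end Endomorphism

/-! ### Hopf's strong maximum principle in the plane. -/

section MaximumPrinciple

/-- Restrict to the line through `z` in direction `ξ`. A positive second derivative would make `0` a
local minimum as well as a local maximum; the restriction would be locally constant, with second
derivative zero. -/
lemma fderiv_fderiv_nonpos_of_isLocalMax {E : Type*} [NormedAddCommGroup E] [NormedSpace ℝ E]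
    {f : E → ℝ} {z : E} (hf : ContDiffAt ℝ 2 f z) (hmax : IsLocalMax f z) (ξ : E) :
    fderiv ℝ (fderiv ℝ f) z ξ ξ ≤ 0 := by
  set ℓ : ℝ → E := fun t ↦ z + t • ξ with hℓ
  have hℓ' : ∀ t, HasDerivAt ℓ ξ t := fun t ↦ by
    have h := ((hasDerivAt_id t).smul_const ξ).const_add z
    rwa [one_smul] at h
  have hℓ0 : ℓ 0 = z := by simp [hℓ]
  have htend : Tendsto ℓ (𝓝 0) (𝓝 z) := by
    have := (hℓ' 0).continuousAt.tendsto
    rwa [hℓ0] at this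
  have hdiff : ∀ᶠ x in 𝓝 z, DifferentiableAt ℝ f x :=
    (hf.eventually (by simp)).mono fun x hx ↦ hx.differentiableAt (by simp)
  have h1 : deriv (fun t ↦ f (ℓ t)) =ᶠ[𝓝 0] fun t ↦ fderiv ℝ f (ℓ t) ξ := by
    filter_upwards [htend.eventually hdiff] with t ht
    exact (ht.hasFDerivAt.comp_hasDerivAt t (hℓ' t)).deriv
  have hf2 : DifferentiableAt ℝ (fderiv ℝ f) (ℓ 0) := by
    rw [hℓ0]
    exact (hf.fderiv_right (m := 1) (by norm_num)).differentiableAt (by simp)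
  have h2 : deriv (deriv fun t ↦ f (ℓ t)) 0 = fderiv ℝ (fderiv ℝ f) z ξ ξ := by
    rw [h1.deriv_eq]
    have := (hf2.hasFDerivAt.comp_hasDerivAt (0 : ℝ) (hℓ' 0)).clm_apply (hasDerivAt_const 0 ξ)
    rw [hℓ0] at this
    simpa using this.deriv
  have hmax' : IsLocalMax (fun t ↦ f (ℓ t)) 0 := by
    have : ∀ᶠ t in 𝓝 (0 : ℝ), f (ℓ t) ≤ f z := htend.eventually hmax
    simpa [IsLocalMax, IsMaxFilter, hℓ0] using this
  by_contra! hpos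
  have hcont : ContinuousAt (fun t ↦ f (ℓ t)) 0 := by
    have : DifferentiableAt ℝ f (ℓ 0) := by rw [hℓ0]; exact hdiff.self_of_nhds
    exact this.continuousAt.comp (hℓ' 0).continuousAt
  have hmin : IsLocalMin (fun t ↦ f (ℓ t)) 0 :=
    isLocalMin_of_deriv_deriv_pos (by rw [h2]; exact hpos) hmax'.deriv_eq_zero hcont
  have hconst : (fun t ↦ f (ℓ t)) =ᶠ[𝓝 0] fun _ ↦ f (ℓ 0) := by
    filter_upwards [hmax', hmin] with t h3 h4 using le_antisymm h3 h4
  have h3 : deriv (deriv fun t ↦ f (ℓ t)) 0 = 0 := by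
    rw [hconst.deriv.deriv_eq]
    simp
  rw [h2] at h3
  exact hpos.ne' h3

/-- The partial derivative of a function on the coordinate plane. -/
def pd (i : Fin 2) (f : Coord 2 → ℝ) (x : Coord 2) : ℝ := fderiv ℝ f x (EuclideanSpace.single i 1)

lemma pd_pd_eq {f : Coord 2 → ℝ} {x : Coord 2} (hf : ContDiffAt ℝ 2 f x) (i j : Fin 2) :
    pd i (pd j f) x = fderiv ℝ (fderiv ℝ f) x (EuclideanSpace.single i 1)
      (EuclideanSpace.single j 1) := by
  have h2 : DifferentiableAt ℝ (fderiv ℝ f) x :=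
    (hf.fderiv_right (m := 1) (by norm_num)).differentiableAt (by simp)
  unfold pd
  rw [fderiv_clm_apply h2 (differentiableAt_const _)]
  simp

lemma pd_comm {f : Coord 2 → ℝ} {x : Coord 2} (hf : ContDiffAt ℝ 2 f x) (i j : Fin 2) :
    pd i (pd j f) x = pd j (pd i f) x := by
  rw [pd_pd_eq hf, pd_pd_eq hf]
  exact (hf.isSymmSndFDerivAt (by simp)).eq _ _

/-- Completing the square: `a` times the expression is the Hessian in direction `a∂₀ + b∂₁` plus `ac
- b²` times the Hessian in direction `∂₁`. -/
lemma elliptic_nonpos_of_isLocalMax {f : Coord 2 → ℝ} {z : Coord 2} (hf : ContDiffAt ℝ 2 f z)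
    (hmax : IsLocalMax f z) {a b c : ℝ} (ha : 0 < a) (hac : 0 < a * c - b ^ 2) :
    a * pd 0 (pd 0 f) z + 2 * b * pd 0 (pd 1 f) z + c * pd 1 (pd 1 f) z ≤ 0 := by
  have h1 := fderiv_fderiv_nonpos_of_isLocalMax hf hmax (EuclideanSpace.single 1 1)
  have h2 := fderiv_fderiv_nonpos_of_isLocalMax hf hmax
    (a • EuclideanSpace.single 0 1 + b • EuclideanSpace.single 1 1)
  have hsym := pd_comm hf 0 1
  simp only [map_add, map_smul, add_apply, smul_apply, smul_eq_mul, ← pd_pd_eq hf] at h1 h2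
  rw [← hsym] at h2
  have h3 : a * (a * pd 0 (pd 0 f) z + 2 * b * pd 0 (pd 1 f) z + c * pd 1 (pd 1 f) z) ≤ 0 := by
    nlinarith
  exact nonpos_of_mul_nonpos_right h3 ha

variable (α : ℝ) (q : Coord 2)

/-- Hopf's barrier function. -/
def barrier (x : Coord 2) : ℝ := Real.exp (-α * ((x 0 - q 0) ^ 2 + (x 1 - q 1) ^ 2))

lemma contDiff_barrier : ContDiff ℝ 2 (barrier α q) := by
  unfold barrier
  fun_prop

lemma contDiff_coord_sub (i : Fin 2) : ContDiff ℝ 2 fun x : Coord 2 ↦ x i - q i := by fun_prop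

lemma pd_coord_sub (i j : Fin 2) (x : Coord 2) :
    pd i (fun x ↦ x j - q j) x = if i = j then 1 else 0 := by
  have h1 : HasFDerivAt (fun x : Coord 2 ↦ x j - q j) (EuclideanSpace.proj j : Coord 2 →L[ℝ] ℝ) x :=
    (EuclideanSpace.proj j : Coord 2 →L[ℝ] ℝ).hasFDerivAt.sub_const _
  rw [pd, h1.fderiv]
  simp [eq_comm]

lemma pd_mul {f f' : Coord 2 → ℝ} {x : Coord 2} (hf : DifferentiableAt ℝ f x)
    (hf' : DifferentiableAt ℝ f' x) (i : Fin 2) :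
    pd i (fun x ↦ f x * f' x) x = f x * pd i f' x + f' x * pd i f x := by
  unfold pd
  rw [fderiv_fun_mul hf hf']
  simp

lemma pd_add {f f' : Coord 2 → ℝ} {x : Coord 2} (hf : DifferentiableAt ℝ f x)
    (hf' : DifferentiableAt ℝ f' x) (i : Fin 2) :
    pd i (fun x ↦ f x + f' x) x = pd i f x + pd i f' x := by
  unfold pd
  rw [fderiv_fun_add hf hf']
  simp

lemma pd_const_mul {f : Coord 2 → ℝ} {x : Coord 2} (hf : DifferentiableAt ℝ f x) (c : ℝ)
    (i : Fin 2) : pd i (fun x ↦ c * f x) x = c * pd i f x := by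
  unfold pd
  rw [fderiv_const_mul hf]
  simp

lemma pd_barrier (i : Fin 2) (x : Coord 2) :
    pd i (barrier α q) x = -2 * α * ((x i - q i) * barrier α q x) := by
  have hs : ∀ j, DifferentiableAt ℝ (fun x : Coord 2 ↦ x j - q j) x := fun j ↦
    (contDiff_coord_sub q j).contDiffAt.differentiableAt (by simp)
  have h1 : DifferentiableAt ℝ (fun x : Coord 2 ↦
      -α * ((x 0 - q 0) * (x 0 - q 0) + (x 1 - q 1) * (x 1 - q 1))) x := by fun_prop
  have h2 : pd i (fun x : Coord 2 ↦
      -α * ((x 0 - q 0) * (x 0 - q 0) + (x 1 - q 1) * (x 1 - q 1))) x = -2 * α * (x i - q i) := by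
    rw [pd_const_mul (by fun_prop), pd_add (by fun_prop) (by fun_prop), pd_mul (hs 0) (hs 0),
      pd_mul (hs 1) (hs 1), pd_coord_sub, pd_coord_sub]
    fin_cases i <;> simp <;> ring
  have h3 : barrier α q = fun x ↦ Real.exp (-α * ((x 0 - q 0) * (x 0 - q 0) +
      (x 1 - q 1) * (x 1 - q 1))) := by
    ext x
    simp only [barrier, sq]
  have h4 : pd i (barrier α q) x = barrier α q x * pd i (fun x : Coord 2 ↦
      -α * ((x 0 - q 0) * (x 0 - q 0) + (x 1 - q 1) * (x 1 - q 1))) x := by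
    rw [h3]
    unfold pd
    rw [fderiv_exp h1]
    simp
  rw [h4, h2]
  ring

lemma pd_pd_barrier (i j : Fin 2) (x : Coord 2) :
    pd i (pd j (barrier α q)) x = (4 * α ^ 2 * ((x i - q i) * (x j - q j)) -
      2 * α * if i = j then 1 else 0) * barrier α q x := by
  have hb : DifferentiableAt ℝ (barrier α q) x :=
    (contDiff_barrier α q).contDiffAt.differentiableAt (by simp)
  have hs : DifferentiableAt ℝ (fun x : Coord 2 ↦ x j - q j) x :=
    (contDiff_coord_sub q j).contDiffAt.differentiableAt (by simp)
  rw [show pd j (barrier α q) = fun x ↦ -2 * α * ((x j - q j) * barrier α q x) from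
    funext (pd_barrier α q j), pd_const_mul (hs.fun_mul hb), pd_mul hs hb, pd_barrier, pd_coord_sub]
  ring

/-- Hopf's barrier is a strict subsolution away from its centre, if `α` is large. -/
lemma exists_barrier_pos {a b c d e : Coord 2 → ℝ} {K : Set (Coord 2)} (hK : IsCompact K)
    (q : Coord 2) (hq : q ∉ K) (ha : ContinuousOn a K) (hb : ContinuousOn b K)
    (hc : ContinuousOn c K) (hd : ContinuousOn d K) (he : ContinuousOn e K)
    (hell : ∀ x ∈ K, 0 < a x ∧ 0 < a x * c x - b x ^ 2) :
    ∃ α : ℝ, 0 < α ∧ ∀ x ∈ K, 0 < a x * pd 0 (pd 0 (barrier α q)) x +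
      2 * b x * pd 0 (pd 1 (barrier α q)) x + c x * pd 1 (pd 1 (barrier α q)) x +
      d x * pd 0 (barrier α q) x + e x * pd 1 (barrier α q) x := by
  rcases K.eq_empty_or_nonempty with rfl | hne
  · exact ⟨1, one_pos, by simp⟩
  have hs : ∀ i, ContinuousOn (fun x : Coord 2 ↦ x i - q i) K := fun i ↦
    (contDiff_coord_sub q i).continuous.continuousOn
  -- The operator applied to the barrier equals `2α · barrier · (2α · lam - mu)`; ellipticity makes
  -- `lam` positive away from `q`.
  set lam : Coord 2 → ℝ := fun x ↦ a x * (x 0 - q 0) ^ 2 +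
    2 * b x * ((x 0 - q 0) * (x 1 - q 1)) + c x * (x 1 - q 1) ^ 2 with hlam
  set mu : Coord 2 → ℝ := fun x ↦ a x + c x + d x * (x 0 - q 0) + e x * (x 1 - q 1) with hmu
  have hlamc : ContinuousOn lam K := ((ha.mul ((hs 0).pow 2)).add
    ((continuousOn_const.mul hb).mul ((hs 0).mul (hs 1)))).add (hc.mul ((hs 1).pow 2))
  have hmuc : ContinuousOn mu K := ((ha.add hc).add (hd.mul (hs 0))).add (he.mul (hs 1))
  have hlampos : ∀ x ∈ K, 0 < lam x := by
    intro x hx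
    obtain ⟨h1, h2⟩ := hell x hx
    have h3 : a x * lam x = (a x * (x 0 - q 0) + b x * (x 1 - q 1)) ^ 2 +
        (a x * c x - b x ^ 2) * (x 1 - q 1) ^ 2 := by
      simp only [hlam]
      ring
    refine pos_of_mul_pos_right ?_ h1.le
    rw [h3]
    rcases eq_or_ne (x 1 - q 1) 0 with h4 | h4
    · have h5 : x 0 - q 0 ≠ 0 := fun h5 ↦ hq <| by
        have : q = x := by
          ext j
          fin_cases j
          · exact (sub_eq_zero.1 h5).symm
          · exact (sub_eq_zero.1 h4).symm
        rwa [this]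
      rw [h4]
      have h6 := mul_ne_zero h1.ne' h5
      have h7 : 0 < (a x * (x 0 - q 0)) ^ 2 := by positivity
      simpa using h7
    · have h5 := mul_pos h2 (by positivity : 0 < (x 1 - q 1) ^ 2)
      linarith [sq_nonneg (a x * (x 0 - q 0) + b x * (x 1 - q 1))]
  obtain ⟨x₁, hx₁, hmin⟩ := hK.exists_isMinOn hne hlamc
  obtain ⟨x₂, hx₂, hmax⟩ := hK.exists_isMaxOn hne hmuc
  have hl := hlampos x₁ hx₁
  -- This `α` gives `2α · min lam = |max mu| + 1`, which exceeds `mu` on all of `K`.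
  refine ⟨(|mu x₂| + 1) / (2 * lam x₁), by positivity, fun x hx ↦ ?_⟩
  set α := (|mu x₂| + 1) / (2 * lam x₁) with hα
  have hαpos : 0 < α := by positivity
  have h1 : 2 * α * lam x₁ = |mu x₂| + 1 := by
    rw [hα]
    field_simp
  have h2 : 2 * α * lam x₁ ≤ 2 * α * lam x := mul_le_mul_of_nonneg_left (hmin hx) (by positivity)
  have h3 : mu x ≤ mu x₂ := hmax hx
  have h4 := le_abs_self (mu x₂)
  have h5 : 0 < 2 * α * barrier α q x * (2 * α * lam x - mu x) :=
    mul_pos (mul_pos (by positivity) (Real.exp_pos _)) (by linarith)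
  refine h5.trans_eq ?_
  simp only [pd_pd_barrier, pd_barrier, hlam, hmu]
  simp
  ring

/-- Hopf's strong maximum principle in the plane, local form. -/
theorem eventually_eq_of_elliptic_nonneg {w a b c d e : Coord 2 → ℝ} {x₀ : Coord 2}
    (hw : ∀ᶠ x in 𝓝 x₀, ContDiffAt ℝ 2 w x) (ha : ∀ᶠ x in 𝓝 x₀, ContinuousAt a x)
    (hb : ∀ᶠ x in 𝓝 x₀, ContinuousAt b x) (hc : ∀ᶠ x in 𝓝 x₀, ContinuousAt c x)
    (hd : ∀ᶠ x in 𝓝 x₀, ContinuousAt d x) (he : ∀ᶠ x in 𝓝 x₀, ContinuousAt e x)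
    (hell : ∀ᶠ x in 𝓝 x₀, 0 < a x ∧ 0 < a x * c x - b x ^ 2)
    (hL : ∀ᶠ x in 𝓝 x₀, 0 ≤ a x * pd 0 (pd 0 w) x + 2 * b x * pd 0 (pd 1 w) x +
      c x * pd 1 (pd 1 w) x + d x * pd 0 w x + e x * pd 1 w x)
    (hmax : ∀ᶠ x in 𝓝 x₀, w x ≤ w x₀) : ∀ᶠ x in 𝓝 x₀, w x = w x₀ := by
  have hall := hw.and (ha.and (hb.and (hc.and (hd.and (he.and (hell.and (hL.and hmax)))))))
  obtain ⟨r, hr, hball⟩ := Metric.nhds_basis_closedBall.mem_iff.1 hall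
  by_contra hnot
  obtain ⟨q₁, hq₁, hwq₁⟩ : ∃ q ∈ Metric.ball x₀ (r / 4), w q ≠ w x₀ := by
    by_contra! hcon
    exact hnot (Filter.mem_of_superset (Metric.ball_mem_nhds x₀ (by positivity)) hcon)
  have hwc : ContinuousOn w (Metric.closedBall x₀ r) := fun x hx ↦
    (hball hx).1.continuousAt.continuousWithinAt
  have hFc : IsCompact (Metric.closedBall x₀ r ∩ w ⁻¹' {w x₀}) :=
    (isCompact_closedBall x₀ r).of_isClosed_subset
      (hwc.preimage_isClosed_of_isClosed Metric.isClosed_closedBall isClosed_singleton)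
      inter_subset_left
  -- The contact point `y` is chosen nearest to `q₁`, so the open ball of radius `ρ` about `q₁`
  -- contains no point where `w` takes its maximum. The radius `r / 4` above keeps the construction
  -- inside the good ball.
  obtain ⟨y, hyF, hymin⟩ := hFc.exists_isMinOn ⟨x₀, Metric.mem_closedBall_self hr.le, rfl⟩
    (continuous_id.dist continuous_const : Continuous fun x ↦ dist x q₁).continuousOn
  have hwy : w y = w x₀ := hyF.2
  set ρ := dist y q₁ with hρdef
  have hρpos : 0 < ρ := dist_pos.2 fun h ↦ hwq₁ (h ▸ hwy)
  have hρr : ρ < r / 4 := by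
    have h1 : ρ ≤ dist x₀ q₁ := hymin ⟨Metric.mem_closedBall_self hr.le, rfl⟩
    have h2 := Metric.mem_ball'.1 hq₁
    linarith
  have hlt : ∀ x, dist x q₁ < ρ → w x < w x₀ := by
    intro x hx
    have hxr : x ∈ Metric.closedBall x₀ r := by
      have := dist_triangle x q₁ x₀
      have h2 := Metric.mem_ball.1 hq₁
      rw [Metric.mem_closedBall]
      linarith
    refine lt_of_le_of_ne (hball hxr).2.2.2.2.2.2.2.2 fun h ↦ ?_
    have : ρ ≤ dist x q₁ := hymin ⟨hxr, h⟩
    linarith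
  -- The ball of radius `ρ / 2` about the midpoint is internally tangent at `y`, so its closure
  -- meets the contact set at `y` only.
  set q := midpoint ℝ y q₁ with hqdef
  have hqy : dist y q = ρ / 2 := by
    rw [hqdef, dist_left_midpoint, hρdef]
    norm_num
    ring
  have hin : ∀ x, dist x q ≤ ρ / 2 → x ≠ y → dist x q₁ < ρ := by
    intro x hx hxy
    by_contra! hge
    -- By the parallelogram law about the midpoint, `|x - q₁|² + |x - y|² = 2|x - q|² + 2|y - q|² ≤
    -- ρ²`, which is strict for `|x - q₁|` when `x ≠ y`.
    have h1 : q - q₁ = y - q := by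
      rw [hqdef, midpoint_eq_smul_add, invOf_eq_inv]
      module
    have h2 : x - q₁ = (x - q) + (y - q) := by rw [← h1]; abel
    have h3 : x - y = (x - q) - (y - q) := by abel
    have h4 := parallelogram_law_with_norm ℝ (x - q) (y - q)
    rw [← h2, ← h3, ← dist_eq_norm, ← dist_eq_norm, ← dist_eq_norm, ← dist_eq_norm, hqy] at h4
    have h5 : 0 < dist x y := dist_pos.2 hxy
    have h6 : 0 ≤ dist x q := dist_nonneg
    nlinarith
  -- Any radius below `ρ / 2` excludes the barrier's centre `q` from the closed ball about `y`.
  set s := ρ / 4 with hs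
  have hspos : 0 < s := by positivity
  have hKsub : Metric.closedBall y s ⊆ Metric.closedBall x₀ r := by
    intro x hx
    have h1 := dist_triangle x y q₁
    have h2 := dist_triangle x q₁ x₀
    have h3 := Metric.mem_closedBall.1 hx
    have h4 := Metric.mem_ball.1 hq₁
    rw [Metric.mem_closedBall]
    linarith
  have hqK : q ∉ Metric.closedBall y s := by
    rw [Metric.mem_closedBall, dist_comm, hqy]
    linarith
  have hKc := isCompact_closedBall y s
  obtain ⟨α, hα, hbar⟩ := exists_barrier_pos hKc q hqK
    (fun x hx ↦ (hball (hKsub hx)).2.1.continuousWithinAt)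
    (fun x hx ↦ (hball (hKsub hx)).2.2.1.continuousWithinAt)
    (fun x hx ↦ (hball (hKsub hx)).2.2.2.1.continuousWithinAt)
    (fun x hx ↦ (hball (hKsub hx)).2.2.2.2.1.continuousWithinAt)
    (fun x hx ↦ (hball (hKsub hx)).2.2.2.2.2.1.continuousWithinAt)
    (fun x hx ↦ (hball (hKsub hx)).2.2.2.2.2.2.1)
  have hbd : ∀ x, barrier α q x = Real.exp (-α * dist x q ^ 2) := fun x ↦ by
    rw [barrier, EuclideanSpace.dist_eq, Real.sq_sqrt (by positivity), Fin.sum_univ_two]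
    simp [Real.dist_eq, sq_abs]
  have hb1 : ∀ x, barrier α q x ≤ 1 := fun x ↦ by
    rw [hbd]
    exact Real.exp_le_one_iff.2 (by nlinarith [sq_nonneg (dist x q)])
  have hwK : ContinuousOn w (Metric.closedBall y s) := hwc.mono hKsub
  -- On this arc `w` stays below its maximum by a uniform gap, so adding `δ` times a barrier bounded
  -- by `1` cannot reach it.
  obtain ⟨δ, hδ, hgap⟩ : ∃ δ > 0, ∀ x ∈ Metric.sphere y s ∩ Metric.closedBall q (ρ / 2),
      w x + δ < w x₀ := by
    rcases (Metric.sphere y s ∩ Metric.closedBall q (ρ / 2)).eq_empty_or_nonempty with h0 | h0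
    · exact ⟨1, one_pos, by simp [h0]⟩
    · obtain ⟨x₁, hx₁, hm⟩ := ((isCompact_sphere y s).inter_right
        Metric.isClosed_closedBall).exists_isMaxOn h0
        (hwK.mono (inter_subset_left.trans Metric.sphere_subset_closedBall))
      have h1 : w x₁ < w x₀ := hlt _ (hin _ (Metric.mem_closedBall.1 hx₁.2) fun h ↦ by
        have h2 := Metric.mem_sphere.1 hx₁.1
        rw [h, dist_self] at h2
        exact hspos.ne h2)
      refine ⟨(w x₀ - w x₁) / 2, by linarith, fun x hx ↦ ?_⟩
      have : w x ≤ w x₁ := hm hx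
      linarith
  set f : Coord 2 → ℝ := fun x ↦ w x + δ * barrier α q x with hf
  have hfK : ContinuousOn f (Metric.closedBall y s) :=
    hwK.add (continuousOn_const.mul (contDiff_barrier α q).continuous.continuousOn)
  obtain ⟨z, hzK, hzmax⟩ := hKc.exists_isMaxOn ⟨y, Metric.mem_closedBall_self hspos.le⟩ hfK
  have hzy : f y ≤ f z := hzmax (Metric.mem_closedBall_self hspos.le)
  have hby : 0 < barrier α q y := Real.exp_pos _
  -- On the boundary circle `f < f y`: within distance `ρ / 2` of `q` by the gap `δ`, farther out
  -- because the barrier is smaller than at `y`.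
  have hzint : z ∈ Metric.ball y s := by
    rw [Metric.mem_ball]
    refine lt_of_le_of_ne (Metric.mem_closedBall.1 hzK) fun hzs ↦ ?_
    simp only [hf, hwy] at hzy
    rcases le_or_gt (dist z q) (ρ / 2) with h1 | h1
    · have h2 := hgap z ⟨hzs, h1⟩
      have h3 := hb1 z
      nlinarith
    · have h2 : barrier α q z < barrier α q y := by
        rw [hbd, hbd, hqy, Real.exp_lt_exp]
        have : (ρ / 2) ^ 2 < dist z q ^ 2 := by gcongr
        nlinarith
      have h3 := (hball (hKsub hzK)).2.2.2.2.2.2.2.2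
      nlinarith
  have hzloc : IsLocalMax f z := hzmax.isLocalMax
    (Filter.mem_of_superset (Metric.isOpen_ball.mem_nhds hzint) Metric.ball_subset_closedBall)
  obtain ⟨hwz, -, -, -, -, -, ⟨haz, hacz⟩, hLz, -⟩ := hball (hKsub hzK)
  have hbz : ContDiffAt ℝ 2 (fun x ↦ δ * barrier α q x) z :=
    contDiffAt_const.mul (contDiff_barrier α q).contDiffAt
  have hfz : ContDiffAt ℝ 2 f z := hwz.add hbz
  have h1 := elliptic_nonpos_of_isLocalMax hfz hzloc haz hacz
  have hp : ∀ i, pd i f =ᶠ[𝓝 z] fun x ↦ pd i w x + δ * pd i (barrier α q) x := fun i ↦ by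
    filter_upwards [hwz.eventually (by simp)] with x hx
    have hbx : DifferentiableAt ℝ (barrier α q) x :=
      (contDiff_barrier α q).contDiffAt.differentiableAt (by simp)
    rw [hf, pd_add (hx.differentiableAt (by simp)) (hbx.const_mul δ), pd_const_mul hbx]
  have hpw : ∀ {v : Coord 2 → ℝ}, ContDiffAt ℝ 2 v z → ∀ i, DifferentiableAt ℝ (pd i v) z :=
    fun hv i ↦ ((hv.fderiv_right (m := 1) (by norm_num)).differentiableAt
      (by simp)).clm_apply (differentiableAt_const _)
  have hpp : ∀ i j, pd i (pd j f) z = pd i (pd j w) z + δ * pd i (pd j (barrier α q)) z := by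
    intro i j
    have h2 : pd i (pd j f) z = pd i (fun x ↦ pd j w x + δ * pd j (barrier α q) x) z := by
      rw [pd, pd, (hp j).fderiv_eq]
    have h3 := hpw (contDiff_barrier α q).contDiffAt j
    rw [h2, pd_add (hpw hwz j) (h3.const_mul δ), pd_const_mul h3]
  -- At the interior maximum the gradient of `f` vanishes, so its full operator reduces to the
  -- second-order part, which is nonpositive; yet the operator is nonnegative on `w` and positive on
  -- the barrier.
  have hz0 : ∀ i, pd i w z + δ * pd i (barrier α q) z = 0 := fun i ↦ by
    have h2 : pd i f z = pd i w z + δ * pd i (barrier α q) z := (hp i).self_of_nhds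
    rw [← h2, pd, hzloc.fderiv_eq_zero]
    simp
  simp only [hpp] at h1
  have h2 := mul_pos hδ (hbar z hzK)
  have h3 := hz0 0
  have h4 := hz0 1
  have h5 : d z * (pd 0 w z + δ * pd 0 (barrier α q) z) = 0 := by rw [h3, mul_zero]
  have h6 : e z * (pd 1 w z + δ * pd 1 (barrier α q) z) = 0 := by rw [h4, mul_zero]
  linarith

end MaximumPrinciple

/-! ### Commuting coordinate fields. -/

section LieBracket
variable {m : ℕ} {M : Type*} [TopologicalSpace M] [ChartedSpace (Coord m) M]
  [IsManifold (𝓡 m) ∞ M] {p : M}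

lemma extendVec_partialAt {q : M} (i : Fin m) (hq : q ∈ (chartAt (Coord m) p).source) :
    extendVec (partialAt p p i) q = partialAt p q i := by
  rw [extendVec_eq _ hq, partialAt, toCoord_ofCoord (mem_chart_source _ _)]
  rfl

lemma lieBracketWithin_eq_zero_of_eventually_const {E : Type*} [NormedAddCommGroup E]
    [NormedSpace ℝ E] {V W : E → E} {x c d : E} {s : Set E} (hV : ∀ᶠ u in 𝓝 x, V u = c)
    (hW : ∀ᶠ u in 𝓝 x, W u = d) : VectorField.lieBracketWithin ℝ V W s x = 0 := by
  have h1 := Filter.EventuallyEq.lieBracketWithin_vectorField_eq_nhds (𝕜 := ℝ) (s := s)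
    (V := fun _ ↦ c) (W := fun _ ↦ d) hV hW
  rw [h1]
  simp [VectorField.lieBracketWithin_eq]

lemma mpullback_extChartAt_symm_partialAt (i : Fin m) :
    ∀ᶠ u in 𝓝 (extChartAt (𝓡 m) p p),
      VectorField.mpullbackWithin 𝓘(ℝ, Coord m) (𝓡 m) (extChartAt (𝓡 m) p).symm
        (extendVec (partialAt p p i)) (Set.range (𝓡 m)) u = EuclideanSpace.single i (1 : ℝ) := by
  filter_upwards [eventually_extChartAt_apply (mem_chart_source (Coord m) p)] with u hu
  have h1 := ofCoord_eq_mfderiv hu.1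
  rw [hu.2] at h1
  rw [VectorField.mpullbackWithin_apply, ModelWithCorners.range_eq_univ, mfderivWithin_univ, ← h1,
    extendVec_partialAt i hu.1, partialAt]
  have h2 : (ofCoord p ((extChartAt (𝓡 m) p).symm u)).inverse =
      toCoord p ((extChartAt (𝓡 m) p).symm u) :=
    ContinuousLinearMap.inverse_eq (by ext1 v; exact ofCoord_toCoord hu.1 v)
      (by ext1 c; exact toCoord_ofCoord hu.1 c)
  exact (DFunLike.congr_fun h2 _).trans (toCoord_ofCoord hu.1 _)

/-- Near the centre both fields pull back to constant fields in the chart, so the bracket term in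
the definition of the curvature drops out. -/
lemma mlieBracket_extendVec_partialAt (i j : Fin m) :
    VectorField.mlieBracket (𝓡 m) (extendVec (partialAt p p i)) (extendVec (partialAt p p j)) p =
      0 := by
  have h1 := lieBracketWithin_eq_zero_of_eventually_const
    (s := (extChartAt (𝓡 m) p).symm ⁻¹' univ ∩ Set.range (𝓡 m))
    (mpullback_extChartAt_symm_partialAt (p := p) i)
    (mpullback_extChartAt_symm_partialAt (p := p) j)
  exact (congrArg (mfderiv (𝓡 m) 𝓘(ℝ, Coord m) (extChartAt (𝓡 m) p) p).inverse h1).trans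
    (map_zero _)

end LieBracket
-- Orthonormal frames, the connection form and its structure equation.
section Frame

variable {M : Type*} [TopologicalSpace M] [ChartedSpace (Coord 2) M] [IsManifold (𝓡 2) ∞ M]
  {g : Metric 2 M} {p : M}

/-- `e` is a smooth local orthonormal frame around `p`. -/
structure IsFrame (g : Metric 2 M) (e : Fin 2 → ∀ q : M, TangentSpace (𝓡 2) q) (p : M) : Prop where
  smooth : ∀ i, SmoothAlong 2 (id : M → M) (e i) p
  orthonormal : ∀ᶠ q in 𝓝 p, ∀ i j, g.inner q (e i q) (e j q) = if i = j then 1 else 0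

lemma AdaptedFrame.isFrame {p₀ : M} (fr : AdaptedFrame g p₀ p) : IsFrame g fr.e p :=
  ⟨fr.smooth_e, fr.orthonormal⟩

/-- The metric trace of `(x, y) ↦ ⟨v, y⟩ x` is `v` when computed in coordinates, and the stated
expansion when computed in the orthonormal basis. -/
lemma eq_inner_smul_add {e : Fin 2 → TangentSpace (𝓡 2) p}
    (he : ∀ i j, g.inner p (e i) (e j) = if i = j then 1 else 0) (v : TangentSpace (𝓡 2) p) :
    v = g.inner p v (e 0) • e 0 + g.inner p v (e 1) • e 1 := by
  have hp := mem_chart_source (Coord 2) p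
  have h1 := metricTrace_eq_sum g
    (LinearMap.mk₂ ℝ (fun x y : TangentSpace (𝓡 2) p ↦ g.inner p v y • x)
      (fun _ _ _ ↦ smul_add _ _ _) (fun _ _ _ ↦ smul_comm _ _ _)
      (fun _ _ _ ↦ by rw [map_add, add_smul])
      (fun _ _ _ ↦ by rw [map_smul, smul_assoc])) he
  rw [Fin.sum_univ_two] at h1
  refine Eq.trans ?_ h1
  conv_lhs => rw [← sum_toCoord_smul_partialAt hp v]
  refine Finset.sum_congr rfl fun i _ ↦ ?_
  rw [toCoord_eq_sum_inner g hp, Finset.sum_smul]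
  exact Finset.sum_congr rfl fun j _ ↦ mul_smul _ _ _

/-- The connection form `ω(v) = ⟨∇_v e₀, e₁⟩` of a frame. -/
def connForm (g : Metric 2 M) (e : Fin 2 → ∀ q : M, TangentSpace (𝓡 2) q) (q : M)
    (v : TangentSpace (𝓡 2) q) : ℝ :=
  g.inner q (leviCivita g (e 0) q v) (e 1 q)

/-- The form `⟨(∇_v ∇e₀)(w) - (∇_w ∇e₀)(v), e₁⟩`. -/
def frameCurv (g : Metric 2 M) (e : Fin 2 → ∀ q : M, TangentSpace (𝓡 2) q) (q : M)
    (v w : TangentSpace (𝓡 2) q) : ℝ :=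
  g.inner q (covEnd g (fun q ↦ leviCivita g (e 0) q) q v w -
    covEnd g (fun q ↦ leviCivita g (e 0) q) q w v) (e 1 q)

lemma connForm_add {e : Fin 2 → ∀ q : M, TangentSpace (𝓡 2) q} (v w : TangentSpace (𝓡 2) p) :
    connForm g e p (v + w) = connForm g e p v + connForm g e p w := by
  simp only [connForm, leviCivita_add_vec, map_add, add_apply]

lemma connForm_smul {e : Fin 2 → ∀ q : M, TangentSpace (𝓡 2) q} (c : ℝ)
    (v : TangentSpace (𝓡 2) p) : connForm g e p (c • v) = c * connForm g e p v := by
  simp only [connForm, leviCivita_smul_vec, map_smul, smul_apply, smul_eq_mul]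

namespace IsFrame

variable {e : Fin 2 → ∀ q : M, TangentSpace (𝓡 2) q}

lemma eventually (he : IsFrame g e p) : ∀ᶠ q in 𝓝 p, IsFrame g e q := by
  filter_upwards [(he.smooth 0).eventually, (he.smooth 1).eventually,
    eventually_eventually_nhds.2 he.orthonormal] with q h0 h1 h2
  exact ⟨fun i ↦ by fin_cases i <;> assumption, h2⟩

lemma leviCivita_inner_add (he : IsFrame g e p) (i j : Fin 2) (v : TangentSpace (𝓡 2) p) :
    g.inner p (leviCivita g (e i) p v) (e j p) + g.inner p (leviCivita g (e j) p v) (e i p) = 0 := by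
  have h1 := leviCivita_inner g (he.smooth i) (he.smooth j) v
  rw [mvfderiv_congr (f' := fun _ ↦ if i = j then 1 else 0)
    (he.orthonormal.mono fun q hq ↦ hq i j), mvfderiv_const, g.symm _ (e i p)] at h1
  exact h1.symm

lemma leviCivita_zero (he : IsFrame g e p) (v : TangentSpace (𝓡 2) p) :
    leviCivita g (e 0) p v = connForm g e p v • e 1 p := by
  have h1 := he.leviCivita_inner_add 0 0 v
  rw [eq_inner_smul_add he.orthonormal.self_of_nhds (leviCivita g (e 0) p v),
    show g.inner p (leviCivita g (e 0) p v) (e 0 p) = 0 by linarith, zero_smul, zero_add]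
  rfl

lemma leviCivita_one (he : IsFrame g e p) (v : TangentSpace (𝓡 2) p) :
    leviCivita g (e 1) p v = (-connForm g e p v) • e 0 p := by
  have h1 := he.leviCivita_inner_add 1 1 v
  have h2 := he.leviCivita_inner_add 0 1 v
  rw [eq_inner_smul_add he.orthonormal.self_of_nhds (leviCivita g (e 1) p v),
    show g.inner p (leviCivita g (e 1) p v) (e 1 p) = 0 by linarith, zero_smul, add_zero,
    show g.inner p (leviCivita g (e 1) p v) (e 0 p) = -connForm g e p v from
      (neg_eq_of_add_eq_zero_right h2).symm]

lemma smooth_connForm (he : IsFrame g e p) {X : ∀ p : M, TangentSpace (𝓡 2) p}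
    (hX : SmoothAlong 2 (id : M → M) X p) : SmoothNear 2 (fun q ↦ connForm g e q (X q)) p :=
  (smoothAlong_leviCivita (he.smooth 0) hX).inner g (he.smooth 1)

variable (g e) in
/-- The field of endomorphisms `∇Z`. -/
def _root_.Submfd.nablaₗ (Z : ∀ q : M, TangentSpace (𝓡 2) q) (q : M) :
    TangentSpace (𝓡 2) q →ₗ[ℝ] TangentSpace (𝓡 2) q where
  toFun := leviCivita g Z q
  map_add' := leviCivita_add_vec Z
  map_smul' := leviCivita_smul_vec Z

lemma smooth_nablaₗ (he : IsFrame g e p) (X : ∀ p : M, TangentSpace (𝓡 2) p)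
    (hX : SmoothAlong 2 (id : M → M) X p) :
    SmoothAlong 2 (id : M → M) (fun q ↦ nablaₗ g (e 0) q (X q)) p :=
  smoothAlong_leviCivita (he.smooth 0) hX

lemma frameCurv_eq (he : IsFrame g e p) (x y : Fin 2 → ℝ) :
    frameCurv g e p (x 0 • e 0 p + x 1 • e 1 p) (y 0 • e 0 p + y 1 • e 1 p) =
      (x 0 * y 1 - x 1 * y 0) * frameCurv g e p (e 0 p) (e 1 p) := by
  have h1 : ∀ v w : TangentSpace (𝓡 2) p, frameCurv g e p v w =
      g.inner p (covEndₗ g he.smooth_nablaₗ v w - covEndₗ g he.smooth_nablaₗ w v) (e 1 p) :=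
    fun v w ↦ rfl
  simp only [h1, map_add, map_smul, LinearMap.add_apply, LinearMap.smul_apply, map_sub, sub_apply,
    add_apply, smul_apply, smul_eq_mul]
  ring

/-- The structure equation `dω = C`. -/
lemma mvfderiv_connForm (he : IsFrame g e p) {p₀ : M} (hp : p ∈ (chartAt (Coord 2) p₀).source)
    (i j : Fin 2) :
    mvfderiv (𝓡 2) (fun q ↦ connForm g e q (partialAt p₀ q j)) p (partialAt p₀ p i) -
      mvfderiv (𝓡 2) (fun q ↦ connForm g e q (partialAt p₀ q i)) p (partialAt p₀ p j) =
      frameCurv g e p (partialAt p₀ p i) (partialAt p₀ p j) := by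
  -- The last term is symmetric in `i, j` by torsion-freeness and the `e 0` term is orthogonal to `e
  -- 1`, so antisymmetrizing and pairing with `e 1` leaves `dω`.
  have key : ∀ i j, covEnd g (fun q ↦ leviCivita g (e 0) q) p (partialAt p₀ p i) (partialAt p₀ p j) =
      mvfderiv (𝓡 2) (fun q ↦ connForm g e q (partialAt p₀ q j)) p (partialAt p₀ p i) • e 1 p -
      (connForm g e p (partialAt p₀ p j) * connForm g e p (partialAt p₀ p i)) • e 0 p -
      leviCivita g (e 0) p (leviCivita g (fun q ↦ partialAt p₀ q j) p (partialAt p₀ p i)) := by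
    intro i j
    have hs := smoothAlong_partialAt hp j
    refine (covEnd_eq (g := g) (Y := fun q ↦ partialAt p₀ q j) he.smooth_nablaₗ hs _).trans ?_
    change leviCivita g (fun q ↦ leviCivita g (e 0) q (partialAt p₀ q j)) p _ - _ = _
    rw [leviCivita_congr (he.eventually.mono fun q hq ↦ hq.leviCivita_zero (partialAt p₀ q j)),
      leviCivita_smul (he.smooth_connForm hs) (he.smooth 1), he.leviCivita_one]
    rw [smul_smul, mul_neg, neg_smul, neg_add_eq_sub]
    rfl
  rw [frameCurv, key, key, leviCivita_partialAt_comm g hp i j]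
  have h10 := he.orthonormal.self_of_nhds 0 1
  have h11 := he.orthonormal.self_of_nhds 1 1
  simp only [Fin.isValue, zero_ne_one, if_true, if_false] at h10 h11
  simp only [map_sub, map_smul, sub_apply, smul_apply, smul_eq_mul, h10, h11]
  ring

end IsFrame

end Frame

/-! ### Gaussian curvature through the connection form. -/

section Curvature

variable {M : Type*} [TopologicalSpace M] [ChartedSpace (Coord 2) M] [IsManifold (𝓡 2) ∞ M]
  {g : Metric 2 M} {p : M} {e : Fin 2 → ∀ q : M, TangentSpace (𝓡 2) q}

namespace IsFrame

lemma leviCivita_eq (he : IsFrame g e p) {f₀ f₁ : M → ℝ} (h₀ : SmoothNear 2 f₀ p)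
    (h₁ : SmoothNear 2 f₁ p) (v : TangentSpace (𝓡 2) p) :
    leviCivita g (fun q ↦ f₀ q • e 0 q + f₁ q • e 1 q) p v =
      (mvfderiv (𝓡 2) f₀ p v - f₁ p * connForm g e p v) • e 0 p +
        (mvfderiv (𝓡 2) f₁ p v + f₀ p * connForm g e p v) • e 1 p := by
  rw [leviCivita_add (.smul h₀ (he.smooth 0)) (.smul h₁ (he.smooth 1)),
    leviCivita_smul h₀ (he.smooth 0), leviCivita_smul h₁ (he.smooth 1), he.leviCivita_zero,
    he.leviCivita_one]
  module

/-- In the frame, second derivatives of `f₀, f₁` and products with `ω` cancel under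
antisymmetrization. Curvature therefore acts as `dω` times the quarter turn `e 0 ↦ e 1`, `e 1 ↦ -e
0`. -/
lemma leviCivita_leviCivita_sub (he : IsFrame g e p) {p₀ : M}
    (hp : p ∈ (chartAt (Coord 2) p₀).source) {f₀ f₁ : M → ℝ} (h₀ : SmoothNear 2 f₀ p)
    (h₁ : SmoothNear 2 f₁ p) {Z : ∀ q : M, TangentSpace (𝓡 2) q}
    (hZ : ∀ᶠ q in 𝓝 p, Z q = f₀ q • e 0 q + f₁ q • e 1 q) (i j : Fin 2) :
    leviCivita g (fun q ↦ leviCivita g Z q (partialAt p₀ q j)) p (partialAt p₀ p i) -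
      leviCivita g (fun q ↦ leviCivita g Z q (partialAt p₀ q i)) p (partialAt p₀ p j) =
    frameCurv g e p (partialAt p₀ p i) (partialAt p₀ p j) • (f₀ p • e 1 p - f₁ p • e 0 p) := by
  have key : ∀ i j, leviCivita g (fun q ↦ leviCivita g Z q (partialAt p₀ q j)) p (partialAt p₀ p i) =
      (mvfderiv (𝓡 2) (fun q ↦ mvfderiv (𝓡 2) f₀ q (partialAt p₀ q j)) p (partialAt p₀ p i) -
        (f₁ p * mvfderiv (𝓡 2) (fun q ↦ connForm g e q (partialAt p₀ q j)) p (partialAt p₀ p i) +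
          connForm g e p (partialAt p₀ p j) * mvfderiv (𝓡 2) f₁ p (partialAt p₀ p i)) -
        (mvfderiv (𝓡 2) f₁ p (partialAt p₀ p j) + f₀ p * connForm g e p (partialAt p₀ p j)) *
          connForm g e p (partialAt p₀ p i)) • e 0 p +
      (mvfderiv (𝓡 2) (fun q ↦ mvfderiv (𝓡 2) f₁ q (partialAt p₀ q j)) p (partialAt p₀ p i) +
        (f₀ p * mvfderiv (𝓡 2) (fun q ↦ connForm g e q (partialAt p₀ q j)) p (partialAt p₀ p i) +
          connForm g e p (partialAt p₀ p j) * mvfderiv (𝓡 2) f₀ p (partialAt p₀ p i)) +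
        (mvfderiv (𝓡 2) f₀ p (partialAt p₀ p j) - f₁ p * connForm g e p (partialAt p₀ p j)) *
          connForm g e p (partialAt p₀ p i)) • e 1 p := by
    intro i j
    have hj := smoothAlong_partialAt hp j
    have hω := he.smooth_connForm hj
    rw [leviCivita_congr (by
      filter_upwards [he.eventually, h₀.eventually, h₁.eventually, hZ.eventually_nhds]
        with q h1 h2 h3 h4
      exact (leviCivita_congr h4 _).trans (h1.leviCivita_eq h2 h3 (partialAt p₀ q j))),
      he.leviCivita_eq ((h₀.mvfderiv hj).sub (h₁.mul hω)) ((h₁.mvfderiv hj).add (h₀.mul hω)),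
      mvfderiv_fun_sub (h₀.mvfderiv hj).mdiff (h₁.mul hω).mdiff,
      mvfderiv_fun_add (h₁.mvfderiv hj).mdiff (h₀.mul hω).mdiff, sub_apply, add_apply,
      mvfderiv_mul_apply h₁ hω, mvfderiv_mul_apply h₀ hω]
  rw [key, key, ← he.mvfderiv_connForm hp, mvfderiv_partialAt_comm hp h₀ i j,
    mvfderiv_partialAt_comm hp h₁ i j]
  module

/-- The Gaussian curvature in terms of a frame. -/
lemma gaussCurv_eq (he : IsFrame g e p) :
    gaussCurv g p = -frameCurv g e p (e 0 p) (e 1 p) := by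
  have hp := mem_chart_source (Coord 2) p
  have hX : ∀ i, ∀ᶠ q in 𝓝 p, extendVec (partialAt p p i) q = partialAt p q i := fun i ↦ by
    filter_upwards [chart_source_mem_nhds hp] with q hq using extendVec_partialAt i hq
  have ho := he.orthonormal.self_of_nhds
  have hY := smoothAlong_partialAt (m := 2) hp 1
  have hcurv : curvature g (extendVec (partialAt p p (0 : Fin 2)))
      (extendVec (partialAt p p (1 : Fin 2))) (extendVec (partialAt p p (1 : Fin 2))) p =
      frameCurv g e p (partialAt p p 0) (partialAt p p 1) •
        (g.inner p (partialAt p p 1) (e 0 p) • e 1 p -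
          g.inner p (partialAt p p 1) (e 1 p) • e 0 p) := by
    rw [← he.leviCivita_leviCivita_sub hp
      (f₀ := fun q ↦ g.inner q (partialAt p q 1) (e 0 q))
      (f₁ := fun q ↦ g.inner q (partialAt p q 1) (e 1 q)) (hY.inner g (he.smooth 0))
      (hY.inner g (he.smooth 1))
      (he.orthonormal.mono fun q hq ↦ eq_inner_smul_add hq _) 0 1, curvature,
      mlieBracket_extendVec_partialAt]
    have h0 : leviCivita g (extendVec (partialAt p p (1 : Fin 2))) p 0 = 0 := by
      have := leviCivita_smul_vec (g := g) (extendVec (partialAt p p (1 : Fin 2))) 0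
        (0 : TangentSpace (𝓡 2) p)
      simpa using this
    rw [h0, sub_zero, extendVec_self, extendVec_self]
    congr 1
    · refine leviCivita_congr ?_ _
      filter_upwards [hX 1, (hX 1).eventually_nhds] with q h1 h2
      rw [h1, leviCivita_congr h2]
    · refine leviCivita_congr ?_ _
      filter_upwards [hX 0, (hX 1).eventually_nhds] with q h1 h2
      rw [h1, leviCivita_congr h2]
  have h00 := ho 0 0
  have h01 := ho 0 1
  have h10 := ho 1 0
  have h11 := ho 1 1
  simp only [Fin.isValue, zero_ne_one, one_ne_zero, if_true, if_false] at h00 h01 h10 h11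
  have hdet := gram_det_ne_zero g hp
  rw [Matrix.det_fin_two] at hdet
  change g.inner p (partialAt p p 0) (partialAt p p 0) * g.inner p (partialAt p p 1)
    (partialAt p p 1) - g.inner p (partialAt p p 0) (partialAt p p 1) *
      g.inner p (partialAt p p 1) (partialAt p p 0) ≠ 0 at hdet
  simp only [gaussCurv]
  rw [hcurv, extendVec_self, extendVec_self]
  have e0 := eq_inner_smul_add ho (partialAt p p 0)
  have e1 := eq_inner_smul_add ho (partialAt p p 1)
  generalize g.inner p (partialAt p p 0) (e 0 p) = x0 at *
  generalize g.inner p (partialAt p p 0) (e 1 p) = x1 at *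
  generalize g.inner p (partialAt p p 1) (e 0 p) = y0 at *
  generalize g.inner p (partialAt p p 1) (e 1 p) = y1 at *
  -- The factor `x0 * y1 - x1 * y0` appears here and again in the pairing with `∂₀`, with opposite
  -- sign; the Gram determinant is its square.
  have hc : frameCurv g e p (partialAt p p 0) (partialAt p p 1) =
      (x0 * y1 - x1 * y0) * frameCurv g e p (e 0 p) (e 1 p) := by
    rw [e0, e1]
    exact he.frameCurv_eq ![x0, x1] ![y0, y1]
  rw [hc]
  rw [e0, e1] at hdet ⊢
  simp only [map_add, map_sub, map_smul, add_apply, sub_apply, smul_apply, smul_eq_mul, h00, h01,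
    h10, h11, mul_zero, mul_one, zero_add, add_zero, zero_sub, sub_zero] at hdet ⊢
  rw [div_eq_iff (fun h ↦ hdet (by linear_combination h))]
  ring

end IsFrame

/-- This is `dω = -K dA` in coordinates, since `P R` is the area density of an adapted frame. -/
lemma AdaptedFrame.mvfderiv_connForm {p₀ : M} (hp : p ∈ (chartAt (Coord 2) p₀).source)
    (fr : AdaptedFrame g p₀ p) :
    ∀ᶠ q in 𝓝 p,
      mvfderiv (𝓡 2) (fun q ↦ connForm g fr.e q (partialAt p₀ q 1)) q (partialAt p₀ q 0) -
      mvfderiv (𝓡 2) (fun q ↦ connForm g fr.e q (partialAt p₀ q 0)) q (partialAt p₀ q 1) =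
      -(gaussCurv g q * fr.P q * fr.R q) := by
  filter_upwards [fr.isFrame.eventually, chart_source_mem_nhds hp, fr.partial_zero, fr.partial_one]
    with q h1 h2 h3 h4
  rw [h1.mvfderiv_connForm h2 0 1, h1.gaussCurv_eq, h3, h4]
  have h5 := h1.frameCurv_eq ![fr.P q, 0] ![fr.Q q, fr.R q]
  simp only [Matrix.cons_val_zero, Matrix.cons_val_one, zero_smul, add_zero] at h5
  rw [h5]
  ring

end Curvature

/-! ### Coordinate derivatives and the maximum principle in divergence form. -/

section CoordDeriv

variable {M : Type*} [TopologicalSpace M] [ChartedSpace (Coord 2) M] [IsManifold (𝓡 2) ∞ M]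
  {p₀ p : M} {f f' : M → ℝ}

/-- The derivative `∂ᵢ f` with respect to the preferred chart around `p₀`. -/
def coordDeriv (p₀ : M) (i : Fin 2) (f : M → ℝ) (q : M) : ℝ :=
  mvfderiv (𝓡 2) f q (partialAt p₀ q i)

lemma SmoothNear.coordDeriv (hf : SmoothNear 2 f p) (hp : p ∈ (chartAt (Coord 2) p₀).source)
    (i : Fin 2) : SmoothNear 2 (coordDeriv p₀ i f) p :=
  hf.mvfderiv (smoothAlong_partialAt hp i)

lemma coordDeriv_congr (h : f =ᶠ[𝓝 p] f') (i : Fin 2) :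
    coordDeriv p₀ i f p = coordDeriv p₀ i f' p := by
  rw [coordDeriv, mvfderiv_congr h, coordDeriv]

lemma coordDeriv_add (hf : SmoothNear 2 f p) (hf' : SmoothNear 2 f' p) (i : Fin 2) :
    coordDeriv p₀ i (fun q ↦ f q + f' q) p = coordDeriv p₀ i f p + coordDeriv p₀ i f' p := by
  rw [coordDeriv, mvfderiv_fun_add hf.mdiff hf'.mdiff]
  rfl

lemma coordDeriv_sub (hf : SmoothNear 2 f p) (hf' : SmoothNear 2 f' p) (i : Fin 2) :
    coordDeriv p₀ i (fun q ↦ f q - f' q) p = coordDeriv p₀ i f p - coordDeriv p₀ i f' p := by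
  rw [coordDeriv, mvfderiv_fun_sub hf.mdiff hf'.mdiff]
  rfl

lemma coordDeriv_mul (hf : SmoothNear 2 f p) (hf' : SmoothNear 2 f' p) (i : Fin 2) :
    coordDeriv p₀ i (fun q ↦ f q * f' q) p = f p * coordDeriv p₀ i f' p + f' p * coordDeriv p₀ i f p :=
  mvfderiv_mul_apply hf hf' _

lemma coordDeriv_const (c : ℝ) (i : Fin 2) : coordDeriv p₀ i (fun _ ↦ c) p = 0 := by
  rw [coordDeriv, mvfderiv_const]
  rfl

lemma coordDeriv_comm (hf : SmoothNear 2 f p) (hp : p ∈ (chartAt (Coord 2) p₀).source)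
    (i j : Fin 2) :
    coordDeriv p₀ i (coordDeriv p₀ j f) p = coordDeriv p₀ j (coordDeriv p₀ i f) p :=
  mvfderiv_partialAt_comm hp hf j i

lemma coordDeriv_eq_pd (hf : SmoothNear 2 f p) (hp : p ∈ (chartAt (Coord 2) p₀).source)
    (i : Fin 2) : coordDeriv p₀ i f p =
      pd i (fun u ↦ f ((extChartAt (𝓡 2) p₀).symm u)) (extChartAt (𝓡 2) p₀ p) :=
  mvfderiv_ofCoord hp hf.mdiff _

lemma eventually_coordDeriv_eq_pd (hf : SmoothNear 2 f p)
    (hp : p ∈ (chartAt (Coord 2) p₀).source) (i : Fin 2) :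
    ∀ᶠ u in 𝓝 (extChartAt (𝓡 2) p₀ p), coordDeriv p₀ i f ((extChartAt (𝓡 2) p₀).symm u) =
      pd i (fun u ↦ f ((extChartAt (𝓡 2) p₀).symm u)) u := by
  filter_upwards [(tendsto_extChartAt_symm hp).eventually hf.eventually,
    eventually_extChartAt_apply hp] with u h1 h2
  rw [coordDeriv_eq_pd h1 h2.1, h2.2]

/-- The strong maximum principle for operators in divergence form, near a maximum. -/
lemma eventually_eq_of_divergence_nonneg (hp : p ∈ (chartAt (Coord 2) p₀).source)
    {w a b c : M → ℝ} (hw : SmoothNear 2 w p) (ha : SmoothNear 2 a p) (hb : SmoothNear 2 b p)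
    (hc : SmoothNear 2 c p) (hell : ∀ᶠ q in 𝓝 p, 0 < a q ∧ 0 < a q * c q - b q ^ 2)
    (hL : ∀ᶠ q in 𝓝 p, 0 ≤
      coordDeriv p₀ 0 (fun q ↦ a q * coordDeriv p₀ 0 w q + b q * coordDeriv p₀ 1 w q) q +
      coordDeriv p₀ 1 (fun q ↦ b q * coordDeriv p₀ 0 w q + c q * coordDeriv p₀ 1 w q) q)
    (hmax : ∀ᶠ q in 𝓝 p, w q ≤ w p) : ∀ᶠ q in 𝓝 p, w q = w p := by
  have ht := tendsto_extChartAt_symm hp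
  have hcont : ∀ {f : M → ℝ}, SmoothNear 2 f p → ∀ᶠ u in 𝓝 (extChartAt (𝓡 2) p₀ p),
      ContinuousAt (fun u ↦ f ((extChartAt (𝓡 2) p₀).symm u)) u := fun hf ↦
    (hf.eventually_contDiffAt hp).mono fun u hu ↦ hu.continuousAt
  have hsymm := extChartAt_symm_apply hp
  -- Expanding the divergence gives first-order coefficients `∂₀a + ∂₁b` and `∂₀b + ∂₁c`, supplied
  -- as `d` and `e`.
  have key := eventually_eq_of_elliptic_nonneg (x₀ := extChartAt (𝓡 2) p₀ p)
    (w := fun u ↦ w ((extChartAt (𝓡 2) p₀).symm u))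
    (a := fun u ↦ a ((extChartAt (𝓡 2) p₀).symm u))
    (b := fun u ↦ b ((extChartAt (𝓡 2) p₀).symm u))
    (c := fun u ↦ c ((extChartAt (𝓡 2) p₀).symm u))
    (d := fun u ↦ (fun q ↦ coordDeriv p₀ 0 a q + coordDeriv p₀ 1 b q)
      ((extChartAt (𝓡 2) p₀).symm u))
    (e := fun u ↦ (fun q ↦ coordDeriv p₀ 0 b q + coordDeriv p₀ 1 c q)
      ((extChartAt (𝓡 2) p₀).symm u))
    ((hw.eventually_contDiffAt hp).mono fun u hu ↦ hu.of_le (WithTop.coe_le_coe.2 le_top))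
    (hcont ha) (hcont hb) (hcont hc) (hcont ((ha.coordDeriv hp 0).add (hb.coordDeriv hp 1)))
    (hcont ((hb.coordDeriv hp 0).add (hc.coordDeriv hp 1))) (ht.eventually hell) ?_ ?_
  · filter_upwards [(tendsto_extChartAt hp).eventually key, chart_source_mem_nhds hp] with q h1 h2
    simpa only [hsymm, extChartAt_symm_apply h2] using h1
  · have hpd : ∀ i j, ∀ᶠ u in 𝓝 (extChartAt (𝓡 2) p₀ p),
        coordDeriv p₀ i (coordDeriv p₀ j w) ((extChartAt (𝓡 2) p₀).symm u) =
          pd i (pd j (fun u ↦ w ((extChartAt (𝓡 2) p₀).symm u))) u := fun i j ↦ by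
      filter_upwards [eventually_coordDeriv_eq_pd (hw.coordDeriv hp j) hp i,
        (eventually_coordDeriv_eq_pd hw hp j).eventually_nhds] with u h1 h2
      rw [h1, pd, Filter.EventuallyEq.fderiv_eq h2]
      rfl
    filter_upwards [hpd 0 0, hpd 0 1, hpd 1 1, eventually_coordDeriv_eq_pd hw hp 0,
      eventually_coordDeriv_eq_pd hw hp 1, ht.eventually hL, ht.eventually hw.eventually,
      ht.eventually ha.eventually, ht.eventually hb.eventually, ht.eventually hc.eventually,
      eventually_extChartAt_apply hp] with u h00 h01 h11 h0 h1 h2 hw ha hb hc hu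
    rw [← h00, ← h01, ← h11, ← h0, ← h1]
    have d0 := hw.coordDeriv hu.1 0
    have d1 := hw.coordDeriv hu.1 1
    rw [coordDeriv_add (ha.mul d0) (hb.mul d1), coordDeriv_add (hb.mul d0) (hc.mul d1),
      coordDeriv_mul ha d0, coordDeriv_mul hb d1, coordDeriv_mul hb d0, coordDeriv_mul hc d1,
      coordDeriv_comm hw hu.1 1 0] at h2
    linarith
  · filter_upwards [ht.eventually hmax] with u hu
    rwa [hsymm]

end CoordDeriv

/-! ### Divergence-free fields of constant trace as a Cauchy–Riemann system. -/

section Codazzi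

variable {M : Type*} [TopologicalSpace M] [ChartedSpace (Coord 2) M] [IsManifold (𝓡 2) ∞ M]
  {g : Metric 2 M} {p : M} {e : Fin 2 → ∀ q : M, TangentSpace (𝓡 2) q}
  {A : ∀ q : M, TangentSpace (𝓡 2) q →ₗ[ℝ] TangentSpace (𝓡 2) q} {κ : ℝ}

/-- `A` is a smooth field of self-adjoint endomorphisms with constant trace `2κ` and vanishing
divergence. -/
structure IsDivFreeCMC (g : Metric 2 M)
    (A : ∀ q : M, TangentSpace (𝓡 2) q →ₗ[ℝ] TangentSpace (𝓡 2) q) (κ : ℝ) : Prop where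
  smooth : ∀ (p : M) (X : ∀ p : M, TangentSpace (𝓡 2) p), SmoothAlong 2 (id : M → M) X p →
    SmoothAlong 2 (id : M → M) (fun q ↦ A q (X q)) p
  selfAdjoint : ∀ (p : M) (v w : TangentSpace (𝓡 2) p),
    g.inner p (A p v) w = g.inner p v (A p w)
  trace : ∀ (p : M) (e : Fin 2 → TangentSpace (𝓡 2) p),
    (∀ i j, g.inner p (e i) (e j) = if i = j then 1 else 0) →
      g.inner p (A p (e 0)) (e 0) + g.inner p (A p (e 1)) (e 1) = 2 * κ
  div : ∀ p : M, divEnd g (fun q ↦ A q) p = 0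

/-- The first component of the trace-free part of `A` in a frame. -/
def diagPart (g : Metric 2 M) (A : ∀ q : M, TangentSpace (𝓡 2) q →ₗ[ℝ] TangentSpace (𝓡 2) q)
    (κ : ℝ) (e : Fin 2 → ∀ q : M, TangentSpace (𝓡 2) q) (q : M) : ℝ :=
  g.inner q (A q (e 0 q)) (e 0 q) - κ

/-- The off-diagonal component of `A` in a frame. -/
def offDiagPart (g : Metric 2 M) (A : ∀ q : M, TangentSpace (𝓡 2) q →ₗ[ℝ] TangentSpace (𝓡 2) q)
    (e : Fin 2 → ∀ q : M, TangentSpace (𝓡 2) q) (q : M) : ℝ :=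
  g.inner q (A q (e 0 q)) (e 1 q)

/-- Half the squared norm of the trace-free part of `A`. -/
def umbilicity (g : Metric 2 M) (A : ∀ q : M, TangentSpace (𝓡 2) q →ₗ[ℝ] TangentSpace (𝓡 2) q)
    (κ : ℝ) (q : M) : ℝ :=
  (1 / 2) * metricTrace g q (fun v w ↦ g.inner q (A q v) (A q w)) - κ ^ 2

/-- The component `⟨(∇_v A) e₀, e₀⟩`. -/
def diagDeriv (g : Metric 2 M) (A : ∀ q : M, TangentSpace (𝓡 2) q →ₗ[ℝ] TangentSpace (𝓡 2) q)
    (κ : ℝ) (e : Fin 2 → ∀ q : M, TangentSpace (𝓡 2) q) (q : M) (v : TangentSpace (𝓡 2) q) : ℝ :=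
  mvfderiv (𝓡 2) (diagPart g A κ e) q v - 2 * offDiagPart g A e q * connForm g e q v

/-- The component `⟨(∇_v A) e₀, e₁⟩`. -/
def offDiagDeriv (g : Metric 2 M) (A : ∀ q : M, TangentSpace (𝓡 2) q →ₗ[ℝ] TangentSpace (𝓡 2) q)
    (κ : ℝ) (e : Fin 2 → ∀ q : M, TangentSpace (𝓡 2) q) (q : M) (v : TangentSpace (𝓡 2) q) : ℝ :=
  mvfderiv (𝓡 2) (offDiagPart g A e) q v + 2 * diagPart g A κ e q * connForm g e q v

lemma diagDeriv_comb (s t : ℝ) (v w : TangentSpace (𝓡 2) p) :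
    diagDeriv g A κ e p (s • v + t • w) = s * diagDeriv g A κ e p v + t * diagDeriv g A κ e p w := by
  simp only [diagDeriv, map_add, map_smul, smul_eq_mul, connForm_add, connForm_smul]
  ring

lemma offDiagDeriv_comb (s t : ℝ) (v w : TangentSpace (𝓡 2) p) :
    offDiagDeriv g A κ e p (s • v + t • w) =
      s * offDiagDeriv g A κ e p v + t * offDiagDeriv g A κ e p w := by
  simp only [offDiagDeriv, map_add, map_smul, smul_eq_mul, connForm_add, connForm_smul]
  ring

namespace IsDivFreeCMC

lemma smooth_diagPart (hA : IsDivFreeCMC g A κ) (he : IsFrame g e p) :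
    SmoothNear 2 (diagPart g A κ e) p :=
  ((hA.smooth p _ (he.smooth 0)).inner g (he.smooth 0)).sub (.const κ)

lemma smooth_offDiagPart (hA : IsDivFreeCMC g A κ) (he : IsFrame g e p) :
    SmoothNear 2 (offDiagPart g A e) p :=
  (hA.smooth p _ (he.smooth 0)).inner g (he.smooth 1)

lemma apply_zero (_ : IsDivFreeCMC g A κ) (he : IsFrame g e p) :
    A p (e 0 p) = (κ + diagPart g A κ e p) • e 0 p + offDiagPart g A e p • e 1 p := by
  rw [eq_inner_smul_add he.orthonormal.self_of_nhds (A p (e 0 p)), diagPart, offDiagPart,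
    add_sub_cancel]

lemma apply_one (hA : IsDivFreeCMC g A κ) (he : IsFrame g e p) :
    A p (e 1 p) = offDiagPart g A e p • e 0 p + (κ - diagPart g A κ e p) • e 1 p := by
  have h1 := hA.trace p (fun i ↦ e i p) he.orthonormal.self_of_nhds
  have h2 : g.inner p (A p (e 1 p)) (e 0 p) = offDiagPart g A e p := by
    rw [hA.selfAdjoint, g.symm]
    rfl
  rw [eq_inner_smul_add he.orthonormal.self_of_nhds (A p (e 1 p)), h2, diagPart,
    show g.inner p (A p (e 1 p)) (e 1 p) = κ - (g.inner p (A p (e 0 p)) (e 0 p) - κ) by linarith]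

lemma covEnd_zero (hA : IsDivFreeCMC g A κ) (he : IsFrame g e p) (v : TangentSpace (𝓡 2) p) :
    covEnd g (fun q ↦ A q) p v (e 0 p) =
      diagDeriv g A κ e p v • e 0 p + offDiagDeriv g A κ e p v • e 1 p := by
  have ha := hA.smooth_diagPart he
  have hb := hA.smooth_offDiagPart he
  rw [covEnd_eq (hA.smooth p) (he.smooth 0),
    leviCivita_congr (he.eventually.mono fun q hq ↦ hA.apply_zero hq),
    he.leviCivita_eq ((SmoothNear.const κ).add ha) hb, he.leviCivita_zero, map_smul,
    hA.apply_one he, mvfderiv_fun_add (SmoothNear.const κ).mdiff ha.mdiff, mvfderiv_const, zero_add,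
    diagDeriv, offDiagDeriv]
  module

lemma covEnd_one (hA : IsDivFreeCMC g A κ) (he : IsFrame g e p) (v : TangentSpace (𝓡 2) p) :
    covEnd g (fun q ↦ A q) p v (e 1 p) =
      offDiagDeriv g A κ e p v • e 0 p - diagDeriv g A κ e p v • e 1 p := by
  have ha := hA.smooth_diagPart he
  have hb := hA.smooth_offDiagPart he
  rw [covEnd_eq (hA.smooth p) (he.smooth 1),
    leviCivita_congr (he.eventually.mono fun q hq ↦ hA.apply_one hq),
    he.leviCivita_eq hb ((SmoothNear.const κ).sub ha), he.leviCivita_one, map_smul,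
    hA.apply_zero he, mvfderiv_fun_sub (SmoothNear.const κ).mdiff ha.mdiff, mvfderiv_const,
    zero_sub, neg_apply, diagDeriv, offDiagDeriv]
  module

/-- The two components of `(∇_{e₀} A) e₀ + (∇_{e₁} A) e₁ = 0`. These Cauchy–Riemann equations leave
only two independent components of `∇A`. -/
lemma div_eq (hA : IsDivFreeCMC g A κ) (he : IsFrame g e p) :
    offDiagDeriv g A κ e p (e 1 p) = -diagDeriv g A κ e p (e 0 p) ∧
      offDiagDeriv g A κ e p (e 0 p) = diagDeriv g A κ e p (e 1 p) := by
  have ho := he.orthonormal.self_of_nhds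
  have h1 := hA.div p
  rw [divEnd_eq_sum (hA.smooth p) ho, Fin.sum_univ_two, hA.covEnd_zero he, hA.covEnd_one he] at h1
  have h10 := ho 1 0
  have h01 := ho 0 1
  have h00 := ho 0 0
  have h11 := ho 1 1
  simp only [Fin.isValue, zero_ne_one, one_ne_zero, if_true, if_false] at h00 h01 h10 h11
  have e0 := congrArg (fun u ↦ g.inner p u (e 0 p)) h1
  have e1 := congrArg (fun u ↦ g.inner p u (e 1 p)) h1
  simp only [map_add, map_sub, map_smul, add_apply, sub_apply, smul_apply, smul_eq_mul, h00, h01,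
    h10, h11, map_zero, zero_apply] at e0 e1
  constructor <;> linarith

/-- The definition by a metric trace is global and frame-free; the local form `a² + b²` gives
smoothness and nonnegativity. -/
lemma umbilicity_eq (hA : IsDivFreeCMC g A κ) (he : IsFrame g e p) :
    umbilicity g A κ p = diagPart g A κ e p * diagPart g A κ e p +
      offDiagPart g A e p * offDiagPart g A e p := by
  have ho := he.orthonormal.self_of_nhds
  have h1 := metricTrace_eq_sum g
    (LinearMap.mk₂ ℝ (fun v w : TangentSpace (𝓡 2) p ↦ g.inner p (A p v) (A p w))
      (fun _ _ _ ↦ by simp) (fun _ _ _ ↦ by simp) (fun _ _ _ ↦ by simp)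
      (fun _ _ _ ↦ by simp)) ho
  simp only [LinearMap.mk₂_apply, Fin.sum_univ_two] at h1
  have h10 := ho 1 0
  have h01 := ho 0 1
  have h00 := ho 0 0
  have h11 := ho 1 1
  simp only [Fin.isValue, zero_ne_one, one_ne_zero, if_true, if_false] at h00 h01 h10 h11
  rw [umbilicity, h1, hA.apply_zero he, hA.apply_one he]
  simp only [map_add, map_smul, add_apply, smul_apply, smul_eq_mul, h00, h01, h10, h11]
  ring

lemma smooth_umbilicity (hA : IsDivFreeCMC g A κ) (p : M) : SmoothNear 2 (umbilicity g A κ) p := by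
  obtain ⟨fr⟩ := exists_adaptedFrame g (mem_chart_source (Coord 2) p)
  have ha := hA.smooth_diagPart fr.isFrame
  have hb := hA.smooth_offDiagPart fr.isFrame
  exact ((ha.mul ha).add (hb.mul hb)).congr
    (fr.isFrame.eventually.mono fun q hq ↦ hA.umbilicity_eq hq)

end IsDivFreeCMC

end Codazzi

/-! ### The equation for the logarithm of the umbilicity. -/

section LogUmbilicity

variable {M : Type*} [TopologicalSpace M] [ChartedSpace (Coord 2) M] [IsManifold (𝓡 2) ∞ M]
  {p₀ p : M}

lemma coordDeriv_log {u : M → ℝ} (hp : p ∈ (chartAt (Coord 2) p₀).source) (hu : SmoothNear 2 u p)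
    (h0 : u p ≠ 0) (i : Fin 2) :
    coordDeriv p₀ i (fun q ↦ Real.log (u q)) p = coordDeriv p₀ i u p / u p := by
  have h1 := ((hu.eventually_contDiffAt hp).self_of_nhds.differentiableAt (by simp)).hasFDerivAt
  have h2 := extChartAt_symm_apply hp
  rw [coordDeriv_eq_pd (hu.log h0) hp, coordDeriv_eq_pd hu hp, pd,
    (h1.log (by rwa [h2])).fderiv, h2]
  simp only [smul_apply, smul_eq_mul, pd]
  exact (div_eq_inv_mul _ _).symm

lemma coordDeriv_inv {u : M → ℝ} (hu : SmoothNear 2 u p) (h0 : u p ≠ 0) (i : Fin 2) :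
    coordDeriv p₀ i (fun q ↦ (u q)⁻¹) p = -coordDeriv p₀ i u p / u p ^ 2 := by
  have h1 := coordDeriv_mul (p₀ := p₀) hu (hu.inv h0) i
  rw [coordDeriv_congr (f' := fun _ ↦ 1) ((hu.self.continuousAt.eventually_ne h0).mono
    fun q hq ↦ mul_inv_cancel₀ hq), coordDeriv_const] at h1
  field_simp at h1 ⊢
  linarith

/-- The form `(a db - b da) / (a² + b²)` is closed. -/
lemma coordDeriv_angle_comm {a b : M → ℝ} (hp : p ∈ (chartAt (Coord 2) p₀).source)
    (ha : SmoothNear 2 a p) (hb : SmoothNear 2 b p) (h0 : a p * a p + b p * b p ≠ 0) (i j : Fin 2) :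
    coordDeriv p₀ i (fun q ↦ (a q * coordDeriv p₀ j b q - b q * coordDeriv p₀ j a q) *
      (a q * a q + b q * b q)⁻¹) p =
    coordDeriv p₀ j (fun q ↦ (a q * coordDeriv p₀ i b q - b q * coordDeriv p₀ i a q) *
      (a q * a q + b q * b q)⁻¹) p := by
  have hda := fun i ↦ ha.coordDeriv hp i
  have hdb := fun i ↦ hb.coordDeriv hp i
  have hu := (ha.mul ha).add (hb.mul hb)
  have hN := fun i ↦ (ha.mul (hdb i)).sub (hb.mul (hda i))
  have key : ∀ i j, coordDeriv p₀ i (fun q ↦ (a q * coordDeriv p₀ j b q -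
      b q * coordDeriv p₀ j a q) * (a q * a q + b q * b q)⁻¹) p = _ := fun i j ↦ by
    rw [coordDeriv_mul (hN j) (hu.inv h0), coordDeriv_inv hu h0,
      coordDeriv_add (ha.mul ha) (hb.mul hb), coordDeriv_mul ha ha, coordDeriv_mul hb hb,
      coordDeriv_sub (ha.mul (hdb j)) (hb.mul (hda j)), coordDeriv_mul ha (hdb j),
      coordDeriv_mul hb (hda j)]
  rw [key, key, coordDeriv_comm ha hp i j, coordDeriv_comm hb hp i j]
  field_simp
  ring

variable {g : Metric 2 M}
  {A : ∀ q : M, TangentSpace (𝓡 2) q →ₗ[ℝ] TangentSpace (𝓡 2) q} {κ : ℝ}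

namespace IsDivFreeCMC

lemma coordDeriv_umbilicity (hA : IsDivFreeCMC g A κ) {e : Fin 2 → ∀ q : M, TangentSpace (𝓡 2) q}
    (he : IsFrame g e p) (i : Fin 2) :
    coordDeriv p₀ i (umbilicity g A κ) p =
      2 * (diagPart g A κ e p * coordDeriv p₀ i (diagPart g A κ e) p +
        offDiagPart g A e p * coordDeriv p₀ i (offDiagPart g A e) p) := by
  have ha := hA.smooth_diagPart he
  have hb := hA.smooth_offDiagPart he
  rw [coordDeriv_congr (he.eventually.mono fun q hq ↦ hA.umbilicity_eq hq),
    coordDeriv_add (ha.mul ha) (hb.mul hb), coordDeriv_mul ha ha, coordDeriv_mul hb hb]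
  ring

/-- The Cauchy–Riemann system written along `∂₀, ∂₁`: the four coordinate derivatives of `a, b` are
governed by the parameters `s, t` and the connection form. -/
lemma deriv_relations (hA : IsDivFreeCMC g A κ) (fr : AdaptedFrame g p₀ p) :
    ∀ᶠ q in 𝓝 p, ∃ s t : ℝ, diagDeriv g A κ fr.e q (fr.e 0 q) = s ∧
      diagDeriv g A κ fr.e q (fr.e 1 q) = t ∧
      coordDeriv p₀ 0 (diagPart g A κ fr.e) q -
        2 * offDiagPart g A fr.e q * connForm g fr.e q (partialAt p₀ q 0) = fr.P q * s ∧
      coordDeriv p₀ 1 (diagPart g A κ fr.e) q -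
        2 * offDiagPart g A fr.e q * connForm g fr.e q (partialAt p₀ q 1) =
          fr.Q q * s + fr.R q * t ∧
      coordDeriv p₀ 0 (offDiagPart g A fr.e) q +
        2 * diagPart g A κ fr.e q * connForm g fr.e q (partialAt p₀ q 0) = fr.P q * t ∧
      coordDeriv p₀ 1 (offDiagPart g A fr.e) q +
        2 * diagPart g A κ fr.e q * connForm g fr.e q (partialAt p₀ q 1) =
          fr.Q q * t - fr.R q * s := by
  filter_upwards [fr.isFrame.eventually, fr.partial_zero, fr.partial_one] with q h1 h2 h3
  have hd := hA.div_eq h1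
  have h2' : partialAt p₀ q 0 = fr.P q • fr.e 0 q + (0 : ℝ) • fr.e 0 q := by
    rw [h2, zero_smul, add_zero]
  refine ⟨_, _, rfl, rfl, ?_, ?_, ?_, ?_⟩
  · refine (congrArg (diagDeriv g A κ fr.e q) h2').trans ?_
    rw [diagDeriv_comb, zero_mul, add_zero]
  · refine (congrArg (diagDeriv g A κ fr.e q) h3).trans ?_
    rw [diagDeriv_comb]
  · refine (congrArg (offDiagDeriv g A κ fr.e q) h2').trans ?_
    rw [offDiagDeriv_comb, zero_mul, add_zero, hd.2]
  · refine (congrArg (offDiagDeriv g A κ fr.e q) h3).trans ?_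
    rw [offDiagDeriv_comb, hd.1, hd.2]
    ring

/-- The equation `Δ log u = 4K` away from the umbilical points, in divergence form. -/
lemma divergence_log_umbilicity (hA : IsDivFreeCMC g A κ) (fr : AdaptedFrame g p₀ p)
    (hp : p ∈ (chartAt (Coord 2) p₀).source) (hu : 0 < umbilicity g A κ p) :
    ∀ᶠ q in 𝓝 p,
      coordDeriv p₀ 0 (fun q ↦ (fr.Q q * fr.Q q + fr.R q * fr.R q) / (fr.P q * fr.R q) *
          coordDeriv p₀ 0 (fun q ↦ Real.log (umbilicity g A κ q)) q +
        -(fr.Q q / fr.R q) * coordDeriv p₀ 1 (fun q ↦ Real.log (umbilicity g A κ q)) q) q +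
      coordDeriv p₀ 1 (fun q ↦ -(fr.Q q / fr.R q) *
          coordDeriv p₀ 0 (fun q ↦ Real.log (umbilicity g A κ q)) q +
        fr.P q / fr.R q * coordDeriv p₀ 1 (fun q ↦ Real.log (umbilicity g A κ q)) q) q =
      4 * (gaussCurv g q * fr.P q * fr.R q) := by
  have hue : ∀ᶠ q in 𝓝 p, 0 < umbilicity g A κ q :=
    (hA.smooth_umbilicity p).self.continuousAt.eventually (lt_mem_nhds hu)
  set a := diagPart g A κ fr.e with ha_def
  set b := offDiagPart g A fr.e with hb_def
  -- The coefficients are `√det g · gⁱʲ`, so the left sides are the flux of `log u`; the identities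
  -- say `*d log u = -2θ - 4ω`, with `s, t` eliminated. Taking the divergence then uses `dθ = 0` and
  -- `dω = -K dA`.
  have hrel : ∀ᶠ q in 𝓝 p,
      (fr.Q q * fr.Q q + fr.R q * fr.R q) / (fr.P q * fr.R q) *
          coordDeriv p₀ 0 (fun q ↦ Real.log (umbilicity g A κ q)) q +
        -(fr.Q q / fr.R q) * coordDeriv p₀ 1 (fun q ↦ Real.log (umbilicity g A κ q)) q =
        -2 * ((a q * coordDeriv p₀ 1 b q - b q * coordDeriv p₀ 1 a q) *
          (a q * a q + b q * b q)⁻¹) + -4 * connForm g fr.e q (partialAt p₀ q 1) ∧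
      -(fr.Q q / fr.R q) * coordDeriv p₀ 0 (fun q ↦ Real.log (umbilicity g A κ q)) q +
        fr.P q / fr.R q * coordDeriv p₀ 1 (fun q ↦ Real.log (umbilicity g A κ q)) q =
        2 * ((a q * coordDeriv p₀ 0 b q - b q * coordDeriv p₀ 0 a q) *
          (a q * a q + b q * b q)⁻¹) + 4 * connForm g fr.e q (partialAt p₀ q 0) := by
    filter_upwards [hA.deriv_relations fr, fr.isFrame.eventually, hue, fr.P_pos, fr.R_pos,
      chart_source_mem_nhds hp] with q ⟨s, t, _, _, h0, h1, h2, h3⟩ he hu hP hR hq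
    rw [coordDeriv_log hq (hA.smooth_umbilicity q) hu.ne',
      coordDeriv_log hq (hA.smooth_umbilicity q) hu.ne', hA.coordDeriv_umbilicity he,
      hA.coordDeriv_umbilicity he]
    have hue := hA.umbilicity_eq he
    rw [hue] at hu ⊢
    rw [← ha_def, ← hb_def] at *
    have e0 : coordDeriv p₀ 0 a q = fr.P q * s + 2 * b q * connForm g fr.e q (partialAt p₀ q 0) := by
      linarith
    have e1 : coordDeriv p₀ 1 a q = fr.Q q * s + fr.R q * t +
        2 * b q * connForm g fr.e q (partialAt p₀ q 1) := by linarith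
    have e2 : coordDeriv p₀ 0 b q = fr.P q * t - 2 * a q * connForm g fr.e q (partialAt p₀ q 0) := by
      linarith
    have e3 : coordDeriv p₀ 1 b q = fr.Q q * t - fr.R q * s -
        2 * a q * connForm g fr.e q (partialAt p₀ q 1) := by linarith
    rw [e0, e1, e2, e3]
    generalize connForm g fr.e q (partialAt p₀ q 0) = w0 at *
    generalize connForm g fr.e q (partialAt p₀ q 1) = w1 at *
    have := hP.ne'
    have := hR.ne'
    have hu' : a q ^ 2 + b q ^ 2 ≠ 0 := by
      have : a q ^ 2 + b q ^ 2 = a q * a q + b q * b q := by ring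
      rw [this]
      exact hu.ne'
    have hu'' := hu.ne'
    constructor
    · field_simp
      ring
    · field_simp
      ring
  filter_upwards [hrel.eventually_nhds, fr.isFrame.eventually, hue, chart_source_mem_nhds hp,
    fr.mvfderiv_connForm hp] with q h1 he hu hq hω
  have ha := hA.smooth_diagPart he
  have hb := hA.smooth_offDiagPart he
  have h0 : a q * a q + b q * b q ≠ 0 := by
    have := hA.umbilicity_eq he
    rw [this] at hu
    exact hu.ne'
  have hN := fun i ↦ ((ha.mul (hb.coordDeriv hq i)).sub (hb.mul (ha.coordDeriv hq i))).mul
    (((ha.mul ha).add (hb.mul hb)).inv h0)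
  have hw := fun i ↦ he.smooth_connForm (smoothAlong_partialAt hq i)
  rw [coordDeriv_congr (h1.mono fun _ h ↦ h.1), coordDeriv_congr (h1.mono fun _ h ↦ h.2),
    coordDeriv_add (SmoothNear.mul (.const (-2)) (hN 1)) (SmoothNear.mul (.const (-4)) (hw 1)),
    coordDeriv_add (SmoothNear.mul (.const 2) (hN 0)) (SmoothNear.mul (.const 4) (hw 0)),
    coordDeriv_mul (.const (-2)) (hN 1), coordDeriv_mul (.const (-4)) (hw 1),
    coordDeriv_mul (.const 2) (hN 0), coordDeriv_mul (.const 4) (hw 0),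
    coordDeriv_angle_comm hq ha hb h0 0 1]
  simp only [coordDeriv_const]
  change coordDeriv p₀ 0 (fun q ↦ connForm g fr.e q (partialAt p₀ q 1)) q -
    coordDeriv p₀ 1 (fun q ↦ connForm g fr.e q (partialAt p₀ q 0)) q = _ at hω
  linarith

end IsDivFreeCMC

end LogUmbilicity

/-! ### Rigidity at the maximum of the umbilicity. -/

section Rigidity

variable {M : Type*} [TopologicalSpace M] [ChartedSpace (Coord 2) M] [IsManifold (𝓡 2) ∞ M]
  {g : Metric 2 M} {p : M}
  {A : ∀ q : M, TangentSpace (𝓡 2) q →ₗ[ℝ] TangentSpace (𝓡 2) q} {κ : ℝ}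

namespace IsDivFreeCMC

lemma umbilicity_nonneg (hA : IsDivFreeCMC g A κ) (p : M) : 0 ≤ umbilicity g A κ p := by
  obtain ⟨fr⟩ := exists_adaptedFrame g (mem_chart_source (Coord 2) p)
  rw [hA.umbilicity_eq fr.isFrame]
  exact add_nonneg (mul_self_nonneg _) (mul_self_nonneg _)

lemma continuous_umbilicity (hA : IsDivFreeCMC g A κ) : Continuous (umbilicity g A κ) :=
  continuous_iff_continuousAt.2 fun p ↦ (hA.smooth_umbilicity p).self.continuousAt

/-- Near a positive maximum `log u` is defined and subharmonic because `K ≥ 0`, so the strong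
maximum principle applies to it. -/
lemma eventually_umbilicity_eq (hA : IsDivFreeCMC g A κ) (hK : ∀ q, 0 ≤ gaussCurv g q)
    (hu : 0 < umbilicity g A κ p) (hmax : ∀ q, umbilicity g A κ q ≤ umbilicity g A κ p) :
    ∀ᶠ q in 𝓝 p, umbilicity g A κ q = umbilicity g A κ p := by
  have hp := mem_chart_source (Coord 2) p
  obtain ⟨fr⟩ := exists_adaptedFrame g hp
  have hue : ∀ᶠ q in 𝓝 p, 0 < umbilicity g A κ q :=
    hA.continuous_umbilicity.continuousAt.eventually (lt_mem_nhds hu)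
  have hP := fr.P_pos.self_of_nhds.ne'
  have hR := fr.R_pos.self_of_nhds.ne'
  have key := eventually_eq_of_divergence_nonneg hp ((hA.smooth_umbilicity p).log hu.ne')
    (a := fun q ↦ (fr.Q q * fr.Q q + fr.R q * fr.R q) / (fr.P q * fr.R q))
    (b := fun q ↦ -(fr.Q q / fr.R q)) (c := fun q ↦ fr.P q / fr.R q)
    (((fr.smooth_Q.mul fr.smooth_Q).add (fr.smooth_R.mul fr.smooth_R)).div
      (fr.smooth_P.mul fr.smooth_R) (mul_ne_zero hP hR))
    (fr.smooth_Q.div fr.smooth_R hR).neg (fr.smooth_P.div fr.smooth_R hR) ?_ ?_ ?_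
  · filter_upwards [key, hue] with q h1 h2
    exact Real.log_injOn_pos h2 hu h1
  · filter_upwards [fr.P_pos, fr.R_pos] with q h1 h2
    -- In dimension two `√det g · g⁻¹` has determinant one, which settles ellipticity.
    have h3 : (fr.Q q * fr.Q q + fr.R q * fr.R q) / (fr.P q * fr.R q) * (fr.P q / fr.R q) -
        (-(fr.Q q / fr.R q)) ^ 2 = 1 := by
      field_simp
      ring
    have h4 := mul_self_nonneg (fr.Q q)
    exact ⟨by positivity, by rw [h3]; exact one_pos⟩
  · filter_upwards [hA.divergence_log_umbilicity fr hp hu, fr.P_pos, fr.R_pos] with q h1 h2 h3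
    rw [h1]
    have := hK q
    positivity
  · filter_upwards [hue] with q h1
    exact Real.log_le_log h1 (hmax q)

lemma gaussCurv_eq_zero (hA : IsDivFreeCMC g A κ) {c : ℝ} (hc : 0 < c)
    (hu : ∀ q, umbilicity g A κ q = c) (p : M) : gaussCurv g p = 0 := by
  have hp := mem_chart_source (Coord 2) p
  obtain ⟨fr⟩ := exists_adaptedFrame g hp
  have h1 := (hA.divergence_log_umbilicity fr hp (by rwa [hu])).self_of_nhds
  simp only [hu, coordDeriv_const, mul_zero, add_zero] at h1
  have hP := fr.P_pos.self_of_nhds.ne'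
  have hR := fr.R_pos.self_of_nhds.ne'
  simpa [hP, hR] using h1.symm

/-- The equation `du = 0` is a homogeneous linear system for the two free components `s, t` of `∇A`,
with determinant of absolute value `a² + b² = c`, so both vanish. -/
lemma parallel_of_umbilicity_eq (hA : IsDivFreeCMC g A κ) {c : ℝ} (hc : 0 < c)
    (hu : ∀ q, umbilicity g A κ q = c) : IsParallelEnd g fun q ↦ A q := by
  intro p v w
  have hp := mem_chart_source (Coord 2) p
  obtain ⟨fr⟩ := exists_adaptedFrame g hp
  have he := fr.isFrame
  have hP := fr.P_pos.self_of_nhds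
  have hR := fr.R_pos.self_of_nhds
  obtain ⟨s, t, hs, ht, h0, h1, h2, h3⟩ := (hA.deriv_relations fr).self_of_nhds
  have hd : ∀ i, coordDeriv p i (umbilicity g A κ) p = 0 := fun i ↦ by
    rw [show umbilicity g A κ = fun _ ↦ c from funext hu, coordDeriv_const]
  have hd0 := hd 0
  have hd1 := hd 1
  have hue := hA.umbilicity_eq he
  rw [hu] at hue
  rw [hA.coordDeriv_umbilicity he] at hd0 hd1
  obtain ⟨hv1, hv0⟩ := hA.div_eq he
  have hcov0 := fun v ↦ hA.covEnd_zero he v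
  have hcov1 := fun v ↦ hA.covEnd_one he v
  set a := diagPart g A κ fr.e p
  set b := offDiagPart g A fr.e p
  -- The connection form cancels in `a da + b db`, since it rotates `(a, b)`.
  have r0 : fr.P p * (a * s + b * t) = 0 := by linear_combination hd0 / 2 - a * h0 - b * h2
  have r0' : a * s + b * t = 0 := (mul_eq_zero.1 r0).resolve_left hP.ne'
  have r1 : fr.R p * (a * t - b * s) = 0 := by
    linear_combination hd1 / 2 - a * h1 - b * h3 - fr.Q p * r0'
  have r1' : a * t - b * s = 0 := (mul_eq_zero.1 r1).resolve_left hR.ne'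
  have hs0 : c * s = 0 := by rw [hue]; linear_combination a * r0' - b * r1'
  have ht0 : c * t = 0 := by rw [hue]; linear_combination b * r0' + a * r1'
  have hs0' := (mul_eq_zero.1 hs0).resolve_left hc.ne'
  have ht0' := (mul_eq_zero.1 ht0).resolve_left hc.ne'
  have h00 : covEnd g (fun q ↦ A q) p (fr.e 0 p) (fr.e 0 p) = 0 := by
    rw [hcov0, hv0, hs, ht, hs0', ht0']; simp
  have h01 : covEnd g (fun q ↦ A q) p (fr.e 0 p) (fr.e 1 p) = 0 := by
    rw [hcov1, hv0, hs, ht, hs0', ht0']; simp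
  have h10 : covEnd g (fun q ↦ A q) p (fr.e 1 p) (fr.e 0 p) = 0 := by
    rw [hcov0, hv1, hs, ht, hs0', ht0']; simp
  have h11 : covEnd g (fun q ↦ A q) p (fr.e 1 p) (fr.e 1 p) = 0 := by
    rw [hcov1, hv1, hs, ht, hs0', ht0']; simp
  have ho := he.orthonormal.self_of_nhds
  rw [eq_inner_smul_add ho v, eq_inner_smul_add ho w, ← covEndₗ_apply (hA.smooth p)]
  simp only [map_add, map_smul, LinearMap.add_apply, LinearMap.smul_apply, covEndₗ_apply, h00, h01,
    h10, h11, smul_zero, add_zero]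

lemma eq_smul_of_umbilicity_eq_zero (hA : IsDivFreeCMC g A κ) (hu : umbilicity g A κ p = 0)
    (v : TangentSpace (𝓡 2) p) : A p v = κ • v := by
  obtain ⟨fr⟩ := exists_adaptedFrame g (mem_chart_source (Coord 2) p)
  have he := fr.isFrame
  rw [hA.umbilicity_eq he] at hu
  have ha := mul_self_eq_zero.1 ((add_eq_zero_iff_of_nonneg (mul_self_nonneg _)
    (mul_self_nonneg _)).1 hu).1
  have hb := mul_self_eq_zero.1 ((add_eq_zero_iff_of_nonneg (mul_self_nonneg _)
    (mul_self_nonneg _)).1 hu).2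
  rw [eq_inner_smul_add he.orthonormal.self_of_nhds v, map_add, map_smul, map_smul,
    hA.apply_zero he, hA.apply_one he, ha, hb]
  module

lemma parallel_of_eq_smul (hA : ∀ (q : M) (v : TangentSpace (𝓡 2) q), A q v = κ • v) :
    IsParallelEnd g fun q ↦ A q := by
  intro p v w
  simp only [covEnd, hA]
  rw [leviCivita_const_smul κ (smoothAlong_extendVec w), sub_self]

/-- Rigidity of divergence free self-adjoint fields of endomorphisms of constant trace on compact
surfaces of nonnegative curvature. -/
theorem parallel_and_flat_or_umbilical [CompactSpace M] [ConnectedSpace M]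
    (hA : IsDivFreeCMC g A κ) (hK : ∀ q, 0 ≤ gaussCurv g q) :
    IsParallelEnd g (fun q ↦ A q) ∧
      (IsFlat g ∨ ∀ (q : M) (v : TangentSpace (𝓡 2) q), A q v = κ • v) := by
  obtain ⟨p, -, hp⟩ := isCompact_univ.exists_isMaxOn univ_nonempty
    hA.continuous_umbilicity.continuousOn
  have hmax : ∀ q, umbilicity g A κ q ≤ umbilicity g A κ p := fun q ↦ hp (mem_univ q)
  rcases (hA.umbilicity_nonneg p).eq_or_lt with h0 | hpos
  · have h1 : ∀ (q : M) (v : TangentSpace (𝓡 2) q), A q v = κ • v := fun q ↦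
      hA.eq_smul_of_umbilicity_eq_zero (le_antisymm (h0 ▸ hmax q) (hA.umbilicity_nonneg q))
    exact ⟨parallel_of_eq_smul h1, Or.inr h1⟩
  -- Every point of this set is itself a global maximum, so the local result applies at each of them
  -- and gives openness.
  · have hclopen : IsClopen {q | umbilicity g A κ q = umbilicity g A κ p} := by
      refine ⟨isClosed_eq hA.continuous_umbilicity continuous_const,
        isOpen_iff_mem_nhds.2 fun q hq ↦ ?_⟩
      have hq' : umbilicity g A κ q = umbilicity g A κ p := hq
      have := hA.eventually_umbilicity_eq hK (p := q) (hq'.symm ▸ hpos) (hq'.symm ▸ hmax)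
      rwa [hq'] at this
    have hall : ∀ q, umbilicity g A κ q = umbilicity g A κ p := fun q ↦ by
      have h1 := hclopen.eq_univ ⟨p, rfl⟩
      exact (h1 ▸ mem_univ q : q ∈ {q | umbilicity g A κ q = umbilicity g A κ p})
    exact ⟨hA.parallel_of_umbilicity_eq hpos hall, Or.inl (hA.gaussCurv_eq_zero hpos hall)⟩

end IsDivFreeCMC

variable {n : ℕ} {N : Type*} [TopologicalSpace N] [ChartedSpace (Coord n) N]
  [IsManifold (𝓡 n) ∞ N] {h : Metric n N} {φ : M → N}

lemma isDivFreeCMC_shapeH (hφ : IsRiemannianImmersion g h φ)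
    (hκ : ∀ q, meanCurvSq g h φ q = κ) (hbic : IsBiconservative g h φ) :
    IsDivFreeCMC g (shapeHₗ g h hφ.1) κ where
  smooth _ _ hX := smoothAlong_shapeH hφ.1 hX
  selfAdjoint _ v w := shapeH_selfAdjoint hφ.1 v w
  trace p _ he := hκ p ▸ shapeH_trace hφ.1 he
  div p := divEnd_shapeH hφ hκ hbic p

/-- The hypothesis concerns the real square root, so nonnegativity of `|H|²` is needed to square it
back. -/
lemma IsCMC.meanCurvSq_eq (hcmc : IsCMC g h φ) : ∃ κ, ∀ q, meanCurvSq g h φ q = κ := by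
  obtain ⟨c, hc⟩ := hcmc
  refine ⟨c * c, fun q ↦ ?_⟩
  have h0 : 0 ≤ meanCurvSq g h φ q := by
    by_cases hH : meanCurv g h φ q = 0
    · rw [meanCurvSq, hH, map_zero]
    · exact (h.pos _ _ hH).le
  rw [← hc q, Real.mul_self_sqrt h0]

end Rigidity

end Submfd

end

/-! ### The theorem on biconservative CMC surfaces. -/

theorem mainTheorem3
    {M : Type*} [TopologicalSpace M] [T2Space M] [CompactSpace M] [ConnectedSpace M]
    [ChartedSpace (EuclideanSpace ℝ (Fin 2)) M] [IsManifold (𝓡 2) ∞ M]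
    {n : ℕ} {N : Type*} [TopologicalSpace N]
    [ChartedSpace (EuclideanSpace ℝ (Fin n)) N] [IsManifold (𝓡 n) ∞ N]
    (g : Submfd.Metric 2 M) (h : Submfd.Metric n N) (φ : M → N)
    (hφ : Submfd.IsRiemannianImmersion g h φ)
    (hcmc : Submfd.IsCMC g h φ)
    (hbic : Submfd.IsBiconservative g h φ)
    (hK : ∀ p : M, 0 ≤ Submfd.gaussCurv g p) :
    Submfd.IsParallelEnd g (Submfd.shapeH g h φ) ∧
      (Submfd.IsFlat g ∨ Submfd.IsPseudoumbilical g h φ) := by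
  obtain ⟨κ, hκ⟩ := hcmc.meanCurvSq_eq
  obtain ⟨h1, h2⟩ :=
    (Submfd.isDivFreeCMC_shapeH hφ hκ hbic).parallel_and_flat_or_umbilical hK
  exact ⟨h1, h2.imp_right fun h3 p v ↦ (h3 p v).trans (by rw [hκ])⟩
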